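/- Let $k\ge 1$ be a fixed integer. An instance of \textsc{Fair $k$-Division Under Conflicts} consists of a finite graph $G=(V,E)$ (the conflict graph) and $k$ profit functions $p_1,\dots,p_k:V\to\mathbb{Z}_{\ge 0}$. A partial $k$-coloring of $G$ is a sequence $(X_1,\dots,X_k)$ of $k$ pairwise disjoint independent sets of $G$; its satisfaction level is $\min_{1\le j\le k} p_j(X_j)$, where $p_j(X):=\sum_{v\in X}p_j(v)$. The task is to compute a partial $k$-coloring of $G$ with maximum satisfaction level. A graph is chordal if all its induced cycles have length three. Theorem. For every $k\ge 1$, \textsc{Fair $k$-Division Under Conflicts} restricted to instances with a chordal conflict graph $G$ is solvable in time $\mathcal{O}\bigl(n^{k+2}(Q+1)^{2k}\bigr)$, where $n=|V|\ge 1$, $Q=\max_{1\le j\le k}p_j(V)$, and the constant hidden in the $\mathcal{O}$-notation depends only on $k$. Here time is the number of steps on a random access machine that performs arithmetic operations, comparisons and memory accesses on words of $\mathcal{O}(\log(n+Q+1))$ bits in unit time, the graph being given by its adjacency matrix. -/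

import Mathlib

namespace FairDivision

/-! ### The optimization problem -/

/-- A graph is chordal if all its induced cycles have length three, that is, if no cycle of
length at least four embeds into it as an induced subgraph. -/
def IsChordal {V : Type*} (G : SimpleGraph V) : Prop :=
  ∀ m : ℕ, 4 ≤ m → IsEmpty (SimpleGraph.cycleGraph m ↪g G)

/-- A partial `k`-coloring: a sequence of `k` pairwise disjoint independent sets. -/
def IsPartialColoring {V : Type*} {k : ℕ} (G : SimpleGraph V) (X : Fin k → Finset V) : Prop :=
  (∀ i j, i ≠ j → Disjoint (X i) (X j)) ∧ ∀ j, G.IsIndepSet (X j : Set V)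

/-- The satisfaction level `min_j p_j(X_j)`, where `p_j(X_j)` is the sum of the `p_j(v)`, `v ∈ X_j`
(a genuine minimum as soon as `k ≥ 1`). -/
noncomputable def satisfaction {V : Type*} {k : ℕ} (p : Fin k → V → ℕ) (X : Fin k → Finset V) : ℕ :=
  ⨅ j, ∑ v ∈ X j, p j v

/-- `X` is a solution of Fair `k`-Division Under Conflicts on the input `(G, p_1, …, p_k)`:
a partial `k`-coloring of `G` with maximum satisfaction level. -/
def IsOptimal {V : Type*} {k : ℕ} (G : SimpleGraph V) (p : Fin k → V → ℕ)
    (X : Fin k → Finset V) : Prop :=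
  IsPartialColoring G X ∧
    ∀ Y : Fin k → Finset V, IsPartialColoring G Y → satisfaction p Y ≤ satisfaction p X

/-- `Q = max_j p_j(V)`. -/
def maxProfit {V : Type*} [Fintype V] {k : ℕ} (p : Fin k → V → ℕ) : ℕ :=
  Finset.univ.sup fun j => ∑ v, p j v

/-! ### The machine model: a word RAM with a step count

A program uses finitely many registers and finitely many memory banks (numbered by constants that
occur in the program text); a bank is an array of words that is addressed by a computed index. -/

/-- The contents of the registers and of the memory banks. -/
structure State where
  /-- the register with a given number -/
  reg : ℕ → ℕ
  /-- the cell with a given index of the bank with a given number -/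
  mem : ℕ → ℕ → ℕ

/-- The binary machine operations. -/
inductive Op where
  | add | sub | mul | div | mod | lt | eq

/-- Subtraction is truncated at `0`, division and remainder are those of the natural numbers,
comparisons return `1` or `0`. -/
def Op.eval : Op → ℕ → ℕ → ℕ
  | .add, a, b => a + b
  | .sub, a, b => a - b
  | .mul, a, b => a * b
  | .div, a, b => a / b
  | .mod, a, b => a % b
  | .lt, a, b => if a < b then 1 else 0
  | .eq, a, b => if a = b then 1 else 0

/-- Expressions: constants, registers, memory reads and machine operations. -/
inductive Expr where
  | const (c : ℕ)
  | reg (x : ℕ)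
  | load (bank : ℕ) (index : Expr)
  | bin (o : Op) (e₁ e₂ : Expr)

/-- The value of an expression. -/
def Expr.eval (s : State) : Expr → ℕ
  | .const c => c
  | .reg x => s.reg x
  | .load b e => s.mem b (e.eval s)
  | .bin o e₁ e₂ => o.eval (e₁.eval s) (e₂.eval s)

/-- The number of steps for evaluating an expression: one for each constant, register access,
memory access and operation in it. -/
def Expr.cost : Expr → ℕ
  | .const _ => 1
  | .reg _ => 1
  | .load _ e => e.cost + 1
  | .bin _ e₁ e₂ => e₁.cost + e₂.cost + 1

/-- All values that occur in the evaluation of an expression (memory addresses included) are at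
most `B`, the largest number that fits into a machine word. -/
def Expr.Fits (B : ℕ) (s : State) : Expr → Prop
  | .const c => c ≤ B
  | .reg x => s.reg x ≤ B
  | .load b e => e.Fits B s ∧ s.mem b (e.eval s) ≤ B
  | .bin o e₁ e₂ => e₁.Fits B s ∧ e₂.Fits B s ∧ o.eval (e₁.eval s) (e₂.eval s) ≤ B

/-- Programs. -/
inductive Program where
  | skip
  | assign (x : ℕ) (e : Expr)
  | store (bank : ℕ) (index e : Expr)
  | seq (P₁ P₂ : Program)
  | ite (e : Expr) (P₁ P₂ : Program)
  | while (e : Expr) (P : Program)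

/-- Write `a` into register `x`. -/
def State.setReg (s : State) (x a : ℕ) : State :=
  { s with reg := Function.update s.reg x a }

/-- Write `a` into cell `i` of bank `b`. -/
def State.setMem (s : State) (b i a : ℕ) : State :=
  { s with mem := Function.update s.mem b (Function.update (s.mem b) i a) }

/-- `Runs B P s t s'`: on a machine whose words hold the numbers `0, …, B`, the program `P`,
started in state `s`, halts after exactly `t` steps in state `s'`, and no value that is computed
on the way exceeds `B`. A program that overflows or does not halt has no run. A test succeeds if
its value is not `0`. -/
inductive Runs (B : ℕ) : Program → State → ℕ → State → Prop where
  | skip (s : State) : Runs B .skip s 1 s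
  | assign (x : ℕ) (e : Expr) (s : State) (h : e.Fits B s) :
      Runs B (.assign x e) s (e.cost + 1) (s.setReg x (e.eval s))
  | store (b : ℕ) (i e : Expr) (s : State) (hi : i.Fits B s) (he : e.Fits B s) :
      Runs B (.store b i e) s (i.cost + e.cost + 1) (s.setMem b (i.eval s) (e.eval s))
  | seq {P₁ P₂ : Program} {s s₁ s₂ : State} {t₁ t₂ : ℕ}
      (h₁ : Runs B P₁ s t₁ s₁) (h₂ : Runs B P₂ s₁ t₂ s₂) :
      Runs B (.seq P₁ P₂) s (t₁ + t₂) s₂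
  | ite_true {e : Expr} {P₁ P₂ : Program} {s s' : State} {t : ℕ}
      (h : e.Fits B s) (he : e.eval s ≠ 0) (h₁ : Runs B P₁ s t s') :
      Runs B (.ite e P₁ P₂) s (e.cost + 1 + t) s'
  | ite_false {e : Expr} {P₁ P₂ : Program} {s s' : State} {t : ℕ}
      (h : e.Fits B s) (he : e.eval s = 0) (h₂ : Runs B P₂ s t s') :
      Runs B (.ite e P₁ P₂) s (e.cost + 1 + t) s'
  | while_true {e : Expr} {P : Program} {s s₁ s₂ : State} {t₁ t₂ : ℕ}
      (h : e.Fits B s) (he : e.eval s ≠ 0) (h₁ : Runs B P s t₁ s₁)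
      (h₂ : Runs B (.while e P) s₁ t₂ s₂) :
      Runs B (.while e P) s (e.cost + 1 + t₁ + t₂) s₂
  | while_false {e : Expr} {P : Program} {s : State} (h : e.Fits B s) (he : e.eval s = 0) :
      Runs B (.while e P) s (e.cost + 1) s

/-! ### Input and output -/

open Classical in
/-- The initial state for the input `(G, p_1, …, p_k)` with vertex set `{0, …, n - 1}`:
register `0` holds `n`, bank `0` holds the adjacency matrix of `G` row by row, bank `1` holds the
`k × n` table of profits row by row, and everything else is `0`. -/
noncomputable def inputState {n k : ℕ} (G : SimpleGraph (Fin n)) (p : Fin k → Fin n → ℕ) :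
    State where
  reg x := if x = 0 then n else 0
  mem b i :=
    if b = 0 then
      (if ∃ u v : Fin n, i = u.val * n + v.val ∧ G.Adj u v then 1 else 0)
    else if b = 1 then
      (if h : i / n < k ∧ i % n < n then p ⟨i / n, h.1⟩ ⟨i % n, h.2⟩ else 0)
    else 0

/-- The `k` sets of vertices that a final state encodes: bank `2` is read as the `k × n` table of
memberships, row by row, with every word other than `0` meaning that the vertex belongs to the
set. -/
def outputSets (n k : ℕ) (s : State) : Fin k → Finset (Fin n) :=
  fun j => Finset.univ.filter fun v => s.mem 2 (j.val * n + v.val) ≠ 0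

end FairDivision

/-! A chordal graph has an ordering of its vertices in which the earlier neighbours of every vertex
form a clique. Maximum cardinality search, which always visits next a vertex with the most visited
neighbours, finds one (`search_spec`, `IsChordal.isClique_earlier`): two nonadjacent earlier
neighbours of a vertex would be the ends of a chordless path whose inner vertex is visited last, and
such a path can always be replaced by one that ends earlier (`IsChordal.no_late_path`).

Let the parent of a vertex be its last earlier neighbour, or the dummy position `0` if there is
none. The positions are processed from `n` down to `1`. The processed ones are split into blocks,
one hanging below each unprocessed position `v`. There are no edges between different blocks, and by
the clique property the unprocessed neighbours of the block below `v` are among `v` and the earlier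
neighbours of `v` (`Family.step`).

All that a coloring of a block has to know about the outside is one vertex for each of the `k`
colors, whose neighbours that color must avoid. When `w` receives the color `c`, the vertex `x`
remembered for `c` may be forgotten in favour of `w`: as `x` is not adjacent to `w`, it is adjacent
to nothing in the block below `w` (`Good.extend`). Hence `(n + 1) ^ k` restrictions suffice. For
each restriction and each profit vector a table holds a coloring that realizes them, if there is
one. Processing `w` means adding `w` to the table of its block (`extend_spec`) and combining the
result with the table of the parent (`merge_spec`). In the end the block of `0` contains everything,
the restriction `0` forbids nothing, and a best profit vector among the flagged ones is optimal
(`isOptimal_of_table`).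

Profit vectors are coded in base `T + 1`, where `T ≤ k * Q` is the sum of all profits, so that codes
add without carries and there are `O((Q + 1) ^ k)` of them. A merge tries all pairs of codes for all
restrictions and copies a coloring of length `n + 1` each time. Over `n` positions this gives `n ^
(k + 2) * (Q + 1) ^ (2 * k)` up to a constant (`solver_order`).

For the machine, the algorithm is written with counted loops only, which have a total semantics.
`runs_of_safe` turns this into runs with a step count. That words do not overflow is read off the
program text (`safe_of_tame`), except for the initialization, where values grow and explicit
invariants are needed (`setup_spec`). -/

namespace FairDivision

/-! ### Perfect elimination orderings of chordal graphs -/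

/-- A chordless path with `r + 1` vertices. -/
def IsChordlessPath {V : Type*} (G : SimpleGraph V) (r : ℕ) (f : ℕ → V) : Prop :=
  (∀ i j, i ≤ r → j ≤ r → (G.Adj (f i) (f j) ↔ i + 1 = j ∨ j + 1 = i)) ∧
    ∀ i j, i ≤ r → j ≤ r → f i = f j → i = j

lemma IsChordlessPath.reverse {V : Type*} {G : SimpleGraph V} {r : ℕ} {f : ℕ → V}
    (h : IsChordlessPath G r f) : IsChordlessPath G r fun i => f (r - i) := by
  refine ⟨fun i j hi hj => ?_, fun i j hi hj hij => ?_⟩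
  · have := h.1 (r - i) (r - j) (by omega) (by omega)
    simp only [this]
    omega
  · have := h.2 (r - i) (r - j) (by omega) (by omega) hij
    omega

/-- A chordless path closes to an induced cycle with a vertex that sees exactly its two ends. -/
lemma IsChordal.no_closed_path {V : Type*} {G : SimpleGraph V} (hG : IsChordal G) {r : ℕ}
    {f : ℕ → V} (hr : 2 ≤ r) (hf : IsChordlessPath G r f) {d : V}
    (hd : ∀ i ≤ r, d ≠ f i) (hadj : ∀ i ≤ r, (G.Adj d (f i) ↔ i = 0 ∨ i = r)) : False := by
  refine (hG (r + 2) (by omega)).false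
    ⟨⟨fun i => if i.val ≤ r then f i.val else d, ?_⟩, ?_⟩
  · intro i j hij
    have hi := i.isLt
    have hj := j.isLt
    ext
    by_cases h1 : i.val ≤ r <;> by_cases h2 : j.val ≤ r <;> simp only [h1, h2, if_true, if_false] at hij
    · exact hf.2 _ _ h1 h2 hij
    · exact absurd hij.symm (hd _ h1)
    · exact absurd hij (hd _ h2)
    · omega
  · intro i j
    have hi := i.isLt
    have hj := j.isLt
    have key : (SimpleGraph.cycleGraph (r + 2)).Adj i j ↔
        (i.val + 1 = j.val ∨ j.val + 1 = i.val ∨ (i.val = 0 ∧ j.val = r + 1) ∨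
          (j.val = 0 ∧ i.val = r + 1)) := by
      rw [SimpleGraph.cycleGraph_adj']
      have e : ∀ a b : Fin (r + 2), (a - b).val = if b.val ≤ a.val then a.val - b.val else
          r + 2 + a.val - b.val := by
        intro a b
        have ha := a.isLt
        have hb := b.isLt
        rw [Fin.val_sub]
        split_ifs with h
        · rw [show r + 2 - b.val + a.val = (a.val - b.val) + (r + 2) by omega, Nat.add_mod_right,
            Nat.mod_eq_of_lt (by omega)]
        · rw [Nat.mod_eq_of_lt (by omega)]
          omega
      rw [e, e]
      split_ifs <;> omega
    rw [key]
    change G.Adj (if i.val ≤ r then f i.val else d) (if j.val ≤ r then f j.val else d) ↔ _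
    by_cases h1 : i.val ≤ r <;> by_cases h2 : j.val ≤ r <;> simp only [h1, h2, if_true, if_false]
    · rw [hf.1 _ _ h1 h2]
      omega
    · rw [G.adj_comm, hadj _ h1]
      omega
    · rw [hadj _ h2]
      omega
    · simp only [SimpleGraph.irrefl, false_iff]
      omega

/-- In a search order `t` of a chordal graph in which every vertex has a maximal set of visited
neighbours when it is visited, no chordless path has all its inner vertices visited last. -/
lemma IsChordal.no_late_path {V : Type*} {G : SimpleGraph V} (hG : IsChordal G) {t : V → ℕ}
    (ht : Function.Injective t)
    (hmax : ∀ a b c, t a < t b → t b < t c → G.Adj a c → ¬ G.Adj a b →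
      ∃ d, t d < t b ∧ G.Adj d b ∧ ¬ G.Adj d c)
    (N : ℕ) : ∀ (r : ℕ) (f : ℕ → V), t (f r) = N → 2 ≤ r → IsChordlessPath G r f →
      t (f 0) < t (f r) → (∀ i, 0 < i → i < r → t (f r) < t (f i)) → False := by
  induction N using Nat.strong_induction_on with
  | _ N ih =>
    intro r f hN hr hf h0r hint
    -- The vertex `f 1` comes after `f r` and sees `f 0`, which `f r` does not see. To be visited
    -- before `f 1` all the same, `f r` must have an earlier neighbour `d` that `f 1` does not see.
    obtain ⟨d, hdt, hdr, hd1⟩ := hmax (f 0) (f r) (f 1) h0r (hint 1 (by omega) (by omega))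
      ((hf.1 _ _ (by omega) (by omega)).2 (by omega))
      (fun h => by have := (hf.1 _ _ (by omega) (by omega)).1 h; omega)
    have hd : ∀ i ≤ r, d ≠ f i := by
      rintro i hi rfl
      rcases Nat.eq_zero_or_pos i with rfl | h0
      · exact hd1 ((hf.1 _ _ (by omega) (by omega)).2 (by omega))
      rcases Nat.lt_or_ge i r with h | h
      · have := hint i h0 h
        omega
      · obtain rfl : i = r := by omega
        exact G.irrefl hdr
    classical
    have hex : ∃ j, 1 ≤ j ∧ G.Adj d (f j) := ⟨r, by omega, hdr⟩
    -- The path is cut at the first neighbour of `d` after `f 0`. Since `d` does not see `f 1`, this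
    -- leaves `j ≥ 2`, so that closing the path through `d` gives a cycle of length at least four.
    obtain ⟨j, ⟨hj1, hdj⟩, hjmin⟩ : ∃ j, (1 ≤ j ∧ G.Adj d (f j)) ∧
        ∀ i, i < j → ¬ (1 ≤ i ∧ G.Adj d (f i)) :=
      ⟨Nat.find hex, Nat.find_spec hex, fun i hi => Nat.find_min hex hi⟩
    have hjr : j ≤ r := by
      by_contra h
      exact hjmin r (by omega) ⟨by omega, hdr⟩
    have hj2 : 2 ≤ j := by
      by_contra h
      obtain rfl : j = 1 := by omega
      exact hd1 hdj
    have hfj : IsChordlessPath G j f :=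
      ⟨fun a b ha hb => hf.1 a b (by omega) (by omega), fun a b ha hb => hf.2 a b (by omega) (by omega)⟩
    by_cases hd0 : G.Adj d (f 0)
    · refine hG.no_closed_path hj2 hfj (fun i hi => hd i (by omega)) fun i hi => ⟨fun h => ?_, ?_⟩
      · by_contra hne
        exact hjmin i (by omega) ⟨by omega, h⟩
      · rintro (rfl | rfl) <;> assumption
    · have hda : ∀ i ≤ j, (G.Adj d (f i) ↔ i = j) := by
        refine fun i hi => ⟨fun h => ?_, by rintro rfl; exact hdj⟩
        by_contra hne
        rcases Nat.eq_zero_or_pos i with rfl | h0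
        · exact hd0 h
        · exact hjmin i (by omega) ⟨by omega, h⟩
      -- Appending `d` gives a chordless path whose two ends come before `f r` and whose inner
      -- vertices do not. Its later end is earlier than `f r`, so the induction hypothesis applies
      -- after a reversal if necessary.
      set g : ℕ → V := fun i => if i ≤ j then f i else d with hg
      have hgp : IsChordlessPath G (j + 1) g := by
        refine ⟨fun a b ha hb => ?_, fun a b ha hb hab => ?_⟩
        · by_cases h1 : a ≤ j <;> by_cases h2 : b ≤ j <;> simp only [hg, h1, h2, if_true, if_false]
          · rw [hfj.1 _ _ h1 h2]
          · rw [G.adj_comm, hda _ h1]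
            omega
          · rw [hda _ h2]
            omega
          · simp only [SimpleGraph.irrefl, false_iff]
            omega
        · by_cases h1 : a ≤ j <;> by_cases h2 : b ≤ j <;> simp only [hg, h1, h2, if_true, if_false] at hab
          · exact hfj.2 _ _ h1 h2 hab
          · exact absurd hab.symm (hd _ (by omega))
          · exact absurd hab (hd _ (by omega))
          · omega
      have hg0 : g 0 = f 0 := by simp [hg]
      have hgl : g (j + 1) = d := by simp [hg]
      have hgi : ∀ i, 0 < i → i < j + 1 → t (f r) ≤ t (g i) := by
        intro i h0 h1
        have : g i = f i := by simp [hg, show i ≤ j by omega]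
        rw [this]
        rcases Nat.lt_or_ge i r with h | h
        · exact (hint i h0 h).le
        · rw [show i = r by omega]
      rcases lt_trichotomy (t (f 0)) (t d) with h | h | h
      · refine ih (t d) (by omega) (j + 1) g (by rw [hgl]) (by omega) hgp (by rw [hg0, hgl]; exact h)
          fun i h0 h1 => ?_
        rw [hgl]
        exact lt_of_lt_of_le hdt (hgi i h0 h1)
      · exact hd 0 (by omega) (ht h).symm
      · refine ih (t (f 0)) (by omega) (j + 1) _ (by simp [hg0]) (by omega) hgp.reverse
          (by simpa [hg0, hgl] using h) fun i h0 h1 => ?_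
        simp only [Nat.sub_self, hg0]
        exact lt_of_lt_of_le h0r (hgi _ (by omega) (by omega))

/-- A maximal neighbourhood search of a chordal graph visits the vertices in the reverse of a
perfect elimination ordering. -/
theorem IsChordal.isClique_earlier {V : Type*} {G : SimpleGraph V} (hG : IsChordal G) {t : V → ℕ}
    (ht : Function.Injective t)
    (hmax : ∀ a b c, t a < t b → t b < t c → G.Adj a c → ¬ G.Adj a b →
      ∃ d, t d < t b ∧ G.Adj d b ∧ ¬ G.Adj d c)
    {a b c : V} (hab : a ≠ b) (hac : t a < t c) (hbc : t b < t c) (h1 : G.Adj a c)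
    (h2 : G.Adj b c) : G.Adj a b := by
  by_contra hn
  wlog hlt : t a < t b generalizing a b
  · exact this hab.symm hbc hac h2 h1 (fun h => hn h.symm)
      (lt_of_le_of_ne (not_lt.1 hlt) fun h => hab (ht h.symm))
  have hn' : ¬ G.Adj b a := fun h => hn h.symm
  have hac' := h1.ne
  have hbc' := h2.ne
  refine hG.no_late_path ht hmax _ 2 (fun i => if i = 0 then a else if i = 1 then c else b) rfl le_rfl
    ⟨fun i j hi hj => ?_, fun i j hi hj hij => ?_⟩ (by simpa using hlt) fun i h0 h1 => ?_
  · interval_cases i <;> interval_cases j <;> simp [h1, h2, h1.symm, h2.symm, hn, hn']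
  · interval_cases i <;> interval_cases j <;> simp_all
  · obtain rfl : i = 1 := by omega
    simpa using hbc

/-! ### Tuples coded as numbers -/

/-- The digit of `f` at the place `c` in base `N`. -/
def dig (N f c : ℕ) : ℕ := f / N ^ c % N

lemma dig_lt {N : ℕ} (hN : 0 < N) (f c : ℕ) : dig N f c < N := Nat.mod_lt _ hN

lemma sum_digits_lt {N : ℕ} : ∀ (k : ℕ) (d : ℕ → ℕ), (∀ c < k, d c < N) →
    ∑ c ∈ Finset.range k, d c * N ^ c < N ^ k
  | 0, _, _ => by simp
  | k + 1, d, h => by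
    have h1 := sum_digits_lt k d fun c hc => h c (by omega)
    have h2 := h k (by omega)
    rw [Finset.sum_range_succ]
    calc _ < N ^ k + d k * N ^ k := by omega
      _ = (d k + 1) * N ^ k := by ring
      _ ≤ N * N ^ k := Nat.mul_le_mul_right _ h2
      _ = N ^ (k + 1) := by ring

lemma dig_sum {N : ℕ} : ∀ (k : ℕ) (d : ℕ → ℕ), (∀ c < k, d c < N) → ∀ c < k,
    dig N (∑ j ∈ Finset.range k, d j * N ^ j) c = d c
  | 0, _, _, c, hc => by omega
  | k + 1, d, h, c, hc => by
    have h0 := h 0 (by omega)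
    have e : ∑ j ∈ Finset.range (k + 1), d j * N ^ j =
        d 0 + N * ∑ j ∈ Finset.range k, d (j + 1) * N ^ j := by
      rw [Finset.sum_range_succ', Finset.mul_sum, add_comm]
      simp only [pow_zero, mul_one]
      congr 1
      exact Finset.sum_congr rfl fun j _ => by ring
    rw [e]
    cases c with
    | zero => simp [dig, Nat.mod_eq_of_lt h0]
    | succ c =>
      have := dig_sum k (fun j => d (j + 1)) (fun j hj => h _ (by omega)) c (by omega)
      rw [dig] at this ⊢
      rw [pow_succ', ← Nat.div_div_eq_div_mul, Nat.add_mul_div_left _ _ (by omega),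
        Nat.div_eq_of_lt h0, zero_add]
      exact this

lemma sum_dig {N : ℕ} : ∀ (k f : ℕ), f < N ^ k → ∑ c ∈ Finset.range k, dig N f c * N ^ c = f
  | 0, f, h => by simp at h; simp [h]
  | k + 1, f, h => by
    rw [Finset.sum_range_succ']
    have h1 := sum_dig k (f / N) (Nat.div_lt_of_lt_mul (by rwa [pow_succ'] at h))
    have h2 : ∀ c, dig N f (c + 1) * N ^ (c + 1) = N * (dig N (f / N) c * N ^ c) := fun c => by
      rw [dig, dig, Nat.div_div_eq_div_mul, ← pow_succ']
      ring
    simp only [h2, ← Finset.mul_sum, h1]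
    simp [dig, Nat.div_add_mod]

/-- Put `w` at the place `c` of `f`. -/
def setDig (N f c w : ℕ) : ℕ := f - dig N f c * N ^ c + w * N ^ c

/-- The truncated subtraction in `setDig` is exact, because `dig N f c * N ^ c` is one of the
summands of the expansion of `f`. -/
lemma setDig_eq {N k f c w : ℕ} (hf : f < N ^ k) (hc : c < k) :
    setDig N f c w = ∑ j ∈ Finset.range k, (if j = c then w else dig N f j) * N ^ j := by
  have hm : c ∈ Finset.range k := Finset.mem_range.2 hc
  have h1 := sum_dig k f hf
  rw [← Finset.add_sum_erase _ _ hm] at h1 ⊢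
  rw [Finset.sum_congr rfl (g := fun j => dig N f j * N ^ j) fun j hj => by
    rw [if_neg (Finset.ne_of_mem_erase hj)]]
  rw [setDig, if_pos rfl]
  omega

lemma setDig_lt {N k f c w : ℕ} (hf : f < N ^ k) (hc : c < k) (hw : w < N) :
    setDig N f c w < N ^ k := by
  rw [setDig_eq hf hc]
  refine sum_digits_lt k _ fun j _ => ?_
  split_ifs
  · exact hw
  · exact dig_lt (by omega) _ _

lemma dig_setDig {N k f c w j : ℕ} (hf : f < N ^ k) (hc : c < k) (hw : w < N) (hj : j < k) :
    dig N (setDig N f c w) j = if j = c then w else dig N f j := by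
  rw [setDig_eq hf hc, dig_sum k _ (fun j _ => ?_) j hj]
  split_ifs
  · exact hw
  · exact dig_lt (by omega) _ _

/-! ### Partial colorings along an elimination ordering

The vertices are the positions `1, …, n` of the ordering; the position `0` stands for no vertex. A
coloring maps positions to `0` (in no set) or to `c + 1` (in the set number `c`). -/

/-- The data of an instance whose vertices are the positions of an ordering: the number of
vertices, the number of sets, a base for coding profit vectors, adjacency and profits. -/
structure Layout where
  /-- number of vertices -/
  n : ℕ
  /-- number of sets -/
  k : ℕ
  /-- base for coding profit vectors -/
  base : ℕ
  /-- adjacency of positions -/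
  R : ℕ → ℕ → Prop
  /-- profit of a position for a set -/
  p : ℕ → ℕ → ℕ

/-- The ordering is the reverse of a perfect elimination ordering, and profit vectors are coded
without carries. -/
structure Layout.Valid (L : Layout) : Prop where
  symm : ∀ {u v}, L.R u v → L.R v u
  irrefl : ∀ u, ¬ L.R u u
  range : ∀ {u v}, L.R u v → 1 ≤ u ∧ u ≤ L.n
  clique : ∀ {x y w}, x ≠ y → x < w → y < w → L.R x w → L.R y w → L.R x y
  carry : ∀ c < L.k, ∑ u ∈ Finset.Icc 1 L.n, L.p c u < L.base

/-! ### Colorings under a restriction and the codes of their profit vectors. -/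

namespace Layout

variable (L : Layout)

/-- `col` is a partial coloring of the positions in `D` in which color `c` avoids the neighbours
of the digit `c` of `f`. -/
structure Good (D : Set ℕ) (f : ℕ) (col : ℕ → ℕ) : Prop where
  le : ∀ u ∈ Finset.Icc 1 L.n, col u ≤ L.k
  mem : ∀ u ∈ Finset.Icc 1 L.n, col u ≠ 0 → u ∈ D
  proper : ∀ u v, L.R u v → col u ≠ 0 → col u ≠ col v
  avoid : ∀ c < L.k, ∀ u ∈ Finset.Icc 1 L.n, col u = c + 1 → ¬ L.R (dig (L.n + 1) f c) u

/-- The contribution to the profit code of the position `u` with color `x`. -/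
def gain (x u : ℕ) : ℕ := if x = 0 then 0 else L.p (x - 1) u * L.base ^ (x - 1)

/-- The code of the profit vector of a coloring. -/
def weight (col : ℕ → ℕ) : ℕ := ∑ u ∈ Finset.Icc 1 L.n, L.gain (col u) u

variable {L}

lemma weight_congr {col col' : ℕ → ℕ} (h : ∀ u ∈ Finset.Icc 1 L.n, col u = col' u) :
    L.weight col = L.weight col' :=
  Finset.sum_congr rfl fun u hu => by rw [h u hu]

/-- Adjacency is confined to the positions `1, …, n`, so other values do not matter. The value at
`0` is thus free to serve as the flag of a table entry. -/
lemma Good.congr (hL : L.Valid) {D : Set ℕ} {f : ℕ} {col col' : ℕ → ℕ} (hg : L.Good D f col)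
    (h : ∀ u ∈ Finset.Icc 1 L.n, col u = col' u) : L.Good D f col' where
  le u hu := h u hu ▸ hg.le u hu
  mem u hu := h u hu ▸ hg.mem u hu
  proper u v huv := by
    rw [← h u (Finset.mem_Icc.2 (hL.range huv)), ← h v (Finset.mem_Icc.2 (hL.range (hL.symm huv)))]
    exact hg.proper u v huv
  avoid c hc u hu := h u hu ▸ hg.avoid c hc u hu

lemma Good.mono {D D' : Set ℕ} {f : ℕ} {col : ℕ → ℕ} (hg : L.Good D f col) (h : D ⊆ D') :
    L.Good D' f col :=
  ⟨hg.le, fun u hu h0 => h (hg.mem u hu h0), hg.proper, hg.avoid⟩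

/-- Grouping the positions by color exhibits the code as an expansion whose digits are the profits
of the color classes. By `class_lt` these digits are smaller than the base. -/
lemma weight_eq_sum {col : ℕ → ℕ} (h : ∀ u ∈ Finset.Icc 1 L.n, col u ≤ L.k) :
    L.weight col = ∑ c ∈ Finset.range L.k,
      (∑ u ∈ (Finset.Icc 1 L.n).filter (fun u => col u = c + 1), L.p c u) * L.base ^ c := by
  simp only [Finset.sum_mul, Finset.sum_filter]
  rw [weight]
  simp only [ite_mul, zero_mul]
  rw [Finset.sum_comm]
  refine Finset.sum_congr rfl fun u hu => ?_
  rcases Nat.eq_zero_or_pos (col u) with h0 | h0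
  · simp [gain, h0]
  · obtain ⟨x, hx⟩ : ∃ x, col u = x + 1 := ⟨col u - 1, by omega⟩
    have := h u hu
    simp only [gain, hx, Nat.add_right_cancel_iff, Nat.add_one_ne_zero, if_false,
      Nat.add_sub_cancel]
    rw [Finset.sum_ite_eq, if_pos (Finset.mem_range.2 (by omega))]

lemma class_lt (hL : L.Valid) (col : ℕ → ℕ) (c : ℕ) (hc : c < L.k) :
    ∑ u ∈ (Finset.Icc 1 L.n).filter (fun u => col u = c + 1), L.p c u < L.base :=
  lt_of_le_of_lt (Finset.sum_le_sum_of_subset (Finset.filter_subset _ _)) (hL.carry c hc)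

lemma weight_lt (hL : L.Valid) {col : ℕ → ℕ} (h : ∀ u ∈ Finset.Icc 1 L.n, col u ≤ L.k) :
    L.weight col < L.base ^ L.k := by
  rw [weight_eq_sum h]
  exact sum_digits_lt _ _ fun c hc => class_lt hL col c hc

lemma dig_weight (hL : L.Valid) {col : ℕ → ℕ} (h : ∀ u ∈ Finset.Icc 1 L.n, col u ≤ L.k) {c : ℕ}
    (hc : c < L.k) : dig L.base (L.weight col) c =
      ∑ u ∈ (Finset.Icc 1 L.n).filter (fun u => col u = c + 1), L.p c u := by
  rw [weight_eq_sum h]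
  exact dig_sum L.k _ (fun c hc => class_lt hL col c hc) c hc

lemma weight_update {col : ℕ → ℕ} {w x : ℕ} (hw : w ∈ Finset.Icc 1 L.n) (h0 : col w = 0) :
    L.weight (Function.update col w x) = L.weight col + L.gain x w := by
  rw [weight, weight, ← Finset.add_sum_erase _ _ hw, ← Finset.add_sum_erase _ (fun u => L.gain (col u) u) hw]
  rw [Finset.sum_congr rfl (g := fun u => L.gain (col u) u) fun u hu => by
    rw [Function.update_of_ne (Finset.ne_of_mem_erase hu)]]
  simp [h0, gain]
  omega

/-- Colorings of `D` that keep color `c` away from `w` extend to `w`. -/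
lemma Good.extend (hL : L.Valid) {D : Set ℕ} {w f c : ℕ} {col : ℕ → ℕ} (hw : w ∈ Finset.Icc 1 L.n)
    (hD : ∀ u ∈ D, w < u) (hN : ∀ u ∈ D, ∀ y < w, L.R y u → L.R y w)
    (hf : f < (L.n + 1) ^ L.k) (hc : c < L.k) (hx : dig (L.n + 1) f c < w)
    (hxw : ¬ L.R (dig (L.n + 1) f c) w) (hg : L.Good D (setDig (L.n + 1) f c w) col) :
    L.Good (insert w D) f (Function.update col w (c + 1)) ∧
      L.weight (Function.update col w (c + 1)) = L.weight col + L.p c w * L.base ^ c := by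
  have hwn : w < L.n + 1 := by have := Finset.mem_Icc.1 hw; omega
  have h0 : col w = 0 := by
    by_contra h
    exact lt_irrefl _ (hD w (hg.mem w hw h))
  have hav : ∀ u ∈ Finset.Icc 1 L.n, col u = c + 1 → ¬ L.R w u := fun u hu h => by
    have := hg.avoid c hc u hu h
    rwa [dig_setDig hf hc hwn hc, if_pos rfl] at this
  refine ⟨⟨fun u hu => ?_, fun u hu h => ?_, fun u v huv h => ?_, fun j hj u hu h => ?_⟩, ?_⟩
  · rcases eq_or_ne u w with rfl | hne
    · rw [Function.update_self]; omega
    · rw [Function.update_of_ne hne]; exact hg.le u hu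
  · rcases eq_or_ne u w with rfl | hne
    · exact Or.inl rfl
    · rw [Function.update_of_ne hne] at h; exact Or.inr (hg.mem u hu h)
  · have hu := Finset.mem_Icc.2 (hL.range huv)
    have hv := Finset.mem_Icc.2 (hL.range (hL.symm huv))
    rcases eq_or_ne u w with rfl | hne
    · have hvu : v ≠ u := by rintro rfl; exact hL.irrefl _ huv
      rw [Function.update_self, Function.update_of_ne hvu]
      exact fun e => hav v hv e.symm huv
    · rw [Function.update_of_ne hne] at h ⊢
      rcases eq_or_ne v w with rfl | hne'
      · rw [Function.update_self]
        exact fun e => hav u hu e (hL.symm huv)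
      · rw [Function.update_of_ne hne']
        exact hg.proper u v huv h
  · rcases eq_or_ne u w with rfl | hne
    · rw [Function.update_self] at h
      obtain rfl : c = j := by omega
      exact hxw
    · rw [Function.update_of_ne hne] at h
      have := hg.avoid j hj u hu h
      rw [dig_setDig hf hc hwn hj] at this
      split_ifs at this with hjc
      · subst hjc
        -- This is where the old digit of color `c` is forgotten: if it were adjacent to some `u`
        -- below `w`, it would be adjacent to `w` by `hN`.
        exact fun hr => hxw (hN u (hg.mem u hu (by omega)) _ hx hr)
      · exact this
  · rw [weight_update hw h0]
    simp [gain]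

/-- Colorings of `D` and `w` that give `w` a color arise by extension. -/
lemma Good.restrict {D : Set ℕ} {w f c : ℕ} {col : ℕ → ℕ}
    (hw : w ∈ Finset.Icc 1 L.n) (hf : f < (L.n + 1) ^ L.k)
    (hg : L.Good (insert w D) f col) (hcw : col w = c + 1) :
    ¬ L.R (dig (L.n + 1) f c) w ∧
      L.Good D (setDig (L.n + 1) f c w) (Function.update col w 0) ∧
      L.weight col = L.weight (Function.update col w 0) + L.p c w * L.base ^ c := by
  have hwn : w < L.n + 1 := by have := Finset.mem_Icc.1 hw; omega
  have hc : c < L.k := by have := hg.le w hw; omega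
  refine ⟨hg.avoid c hc w hw hcw, ⟨fun u hu => ?_, fun u hu h => ?_, fun u v huv h => ?_,
    fun j hj u hu h => ?_⟩, ?_⟩
  · rcases eq_or_ne u w with rfl | hne
    · rw [Function.update_self]; omega
    · rw [Function.update_of_ne hne]; exact hg.le u hu
  · rcases eq_or_ne u w with rfl | hne
    · simp at h
    · rw [Function.update_of_ne hne] at h
      exact (hg.mem u hu h).resolve_left hne
  · rcases eq_or_ne u w with rfl | hne
    · simp at h
    · rw [Function.update_of_ne hne] at h ⊢
      rcases eq_or_ne v w with rfl | hne'
      · rwa [Function.update_self]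
      · rw [Function.update_of_ne hne']
        exact hg.proper u v huv h
  · rcases eq_or_ne u w with rfl | hne
    · simp at h
    · rw [Function.update_of_ne hne] at h
      rw [dig_setDig hf hc hwn hj]
      split_ifs with hjc
      · subst hjc
        exact fun hr => hg.proper _ _ hr (by omega) (by omega)
      · exact hg.avoid j hj u hu h
  · have := weight_update (L := L) (col := Function.update col w 0) (x := c + 1) hw (by simp)
    rw [Function.update_idem, ← hcw, Function.update_eq_self] at this
    rw [this, hcw]
    simp [gain]

/-- Superposition of two colorings. -/
def merge (col col' : ℕ → ℕ) (u : ℕ) : ℕ := if col u ≠ 0 then col u else col' u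

/-- With no common position and no edge in between, two colorings cannot conflict. Both obey the
same `f`, so nothing else has to be compared, and each position contributes to at most one of the
two codes. -/
lemma Good.merge (hL : L.Valid) {D D' : Set ℕ} {f : ℕ} {col col' : ℕ → ℕ}
    (hd : ∀ u ∈ D, ∀ v ∈ D', u ≠ v ∧ ¬ L.R u v) (hg : L.Good D f col) (hg' : L.Good D' f col') :
    L.Good (D ∪ D') f (Layout.merge col col') ∧
      L.weight (Layout.merge col col') = L.weight col + L.weight col' := by
  have hdis : ∀ u ∈ Finset.Icc 1 L.n, col u ≠ 0 → col' u = 0 := fun u hu h => by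
    by_contra h'
    exact (hd u (hg.mem u hu h) u (hg'.mem u hu h')).1 rfl
  refine ⟨⟨fun u hu => ?_, fun u hu h => ?_, fun u v huv h => ?_, fun j hj u hu h => ?_⟩, ?_⟩
  · rw [Layout.merge]
    split_ifs
    · exact hg.le u hu
    · exact hg'.le u hu
  · rw [Layout.merge] at h
    split_ifs at h with h1
    · exact Or.inl (hg.mem u hu h1)
    · exact Or.inr (hg'.mem u hu h)
  · have hu := Finset.mem_Icc.2 (hL.range huv)
    have hv := Finset.mem_Icc.2 (hL.range (hL.symm huv))
    have n1 : col u ≠ 0 → col' v ≠ 0 → False := fun h1 h2 =>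
      (hd u (hg.mem u hu h1) v (hg'.mem v hv h2)).2 huv
    have n2 : col v ≠ 0 → col' u ≠ 0 → False := fun h1 h2 =>
      (hd v (hg.mem v hv h1) u (hg'.mem u hu h2)).2 (hL.symm huv)
    have p1 := hg.proper u v huv
    have p2 := hg'.proper u v huv
    simp only [Layout.merge] at h ⊢
    split_ifs at h ⊢ with h1 h2
    · exact p1 h1
    · intro e
      exact n1 h1 (by omega)
    · exact fun _ => n2 (by assumption) h
    · exact p2 h
  · rw [Layout.merge] at h
    split_ifs at h with h1
    · exact hg.avoid j hj u hu h
    · exact hg'.avoid j hj u hu h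
  · rw [weight, weight, weight, ← Finset.sum_add_distrib]
    refine Finset.sum_congr rfl fun u hu => ?_
    rw [Layout.merge]
    split_ifs with h1
    · simp [hdis u hu h1, gain]
    · rw [not_not] at h1
      simp [h1, gain]

/-- Cutting along `D` and its complement, rather than along `D` and `D'`, counts every position once
even if the two sets overlap. -/
lemma Good.split {D D' : Set ℕ} {f : ℕ} {col : ℕ → ℕ} (hg : L.Good (D ∪ D') f col) :
    ∃ col₁ col₂, L.Good D f col₁ ∧ L.Good D' f col₂ ∧
      L.weight col = L.weight col₁ + L.weight col₂ := by
  classical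
  have key : ∀ (S T : Set ℕ), (∀ u ∈ Finset.Icc 1 L.n, col u ≠ 0 → u ∈ S → u ∈ T) →
      L.Good T f fun u => if u ∈ S then col u else 0 := fun S T hST =>
    ⟨fun u hu => by
      split_ifs
      · exact hg.le u hu
      · omega, fun u hu h => by
      split_ifs at h with h1
      · exact hST u hu h h1
      · exact absurd rfl h, fun u v huv h => by
      split_ifs at h ⊢ with h1 h2
      · exact hg.proper u v huv h
      · exact h
      · exact absurd rfl h
      · exact absurd rfl h, fun c hc u hu h => by
      split_ifs at h with h1
      · exact hg.avoid c hc u hu h⟩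
  refine ⟨_, _, key D D fun u _ _ h => h, key Dᶜ D' fun u hu h0 h => (hg.mem u hu h0).resolve_left h,
    ?_⟩
  rw [weight, weight, weight, ← Finset.sum_add_distrib]
  refine Finset.sum_congr rfl fun u hu => ?_
  by_cases h : u ∈ D <;> simp [h, gain]

/-! ### Tables of attainable profit codes and the blocks of processed positions. -/

variable (L) in
/-- `T` tabulates the profit codes of the colorings of `D`: the entry at `f` and `a` is a coloring
with profit code `a` if its flag, the value at `0`, does not vanish; for the tuples `f` with digits
at most `v` no attainable profit code is missed. -/
structure IsTable (T : ℕ → ℕ → ℕ → ℕ) (D : Set ℕ) (v : ℕ) : Prop where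
  sound : ∀ f < (L.n + 1) ^ L.k, ∀ a < L.base ^ L.k, T f a 0 ≠ 0 →
    L.Good D f (T f a) ∧ L.weight (T f a) = a
  complete : ∀ f < (L.n + 1) ^ L.k, (∀ c < L.k, dig (L.n + 1) f c ≤ v) → ∀ col, L.Good D f col →
    T f (L.weight col) 0 ≠ 0

/-- The sets `D v`, `v ≤ m`, of descendants after the positions larger than `m` are processed. -/
structure Family (L : Layout) (m : ℕ) (D : ℕ → Set ℕ) : Prop where
  lt : ∀ v ≤ m, ∀ u ∈ D v, m < u
  apart : ∀ v ≤ m, ∀ v' ≤ m, v ≠ v' → ∀ u ∈ D v, ∀ u' ∈ D v', u ≠ u' ∧ ¬ L.R u u'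
  near : ∀ v ≤ m, ∀ u ∈ D v, ∀ y ≤ m, L.R y u → y ≤ v ∧ (y = v ∨ L.R y v)
  cover : ∀ u, m < u → u ≤ L.n → ∃ v ≤ m, u ∈ D v

lemma family_init : L.Family L.n fun _ => ∅ where
  lt := by simp
  apart := by simp
  near := by simp
  cover u h h' := by omega

/-- Processing `w`, the sets of `w` and of its parent `v` are joined. -/
lemma Family.step (hL : L.Valid) {w v : ℕ} {D : ℕ → Set ℕ} (hF : L.Family w D) (hw : w ≤ L.n)
    (hv : v < w) (hvw : v = 0 ∨ L.R v w) (hmax : ∀ x, v < x → x < w → ¬ L.R x w) :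
    L.Family (w - 1) (Function.update D v (insert w (D w) ∪ D v)) ∧
      (∀ u ∈ insert w (D w), ∀ u' ∈ D v, u ≠ u' ∧ ¬ L.R u u') ∧
      (∀ u ∈ D w, w < u) ∧ (∀ u ∈ D w, ∀ y < w, L.R y u → L.R y w) := by
  -- Among the unprocessed positions, the block of `v'` sees none after `v'`, in particular not `w`.
  have hwD : ∀ v' < w, ∀ u ∈ D v', ¬ L.R w u := fun v' hv' u hu h => by
    have := (hF.near v' hv'.le u hu w le_rfl h).1
    omega
  have hap : ∀ v' < w, ∀ u ∈ insert w (D w), ∀ u' ∈ D v', u ≠ u' ∧ ¬ L.R u u' := by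
    rintro v' hv' u (rfl | hu) u' hu'
    · exact ⟨(hF.lt v' hv'.le u' hu').ne, hwD v' hv' u' hu'⟩
    · exact hF.apart w le_rfl v' hv'.le hv'.ne' u hu u' hu'
  have hnear : ∀ u ∈ D w, ∀ y < w, L.R y u → L.R y w := fun u hu y hy h =>
    (hF.near w le_rfl u hu y hy.le h).2.resolve_left hy.ne
  -- Here the clique property enters: `v` is the last earlier neighbour of `w`, so every other one
  -- is adjacent to `v`. What the joined block sees from outside is therefore controlled by `v`.
  have hpar : ∀ y < w, L.R y w → y ≤ v ∧ (y = v ∨ L.R y v) := fun y hy h => by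
    have hyv : y ≤ v := by
      by_contra hlt
      exact hmax y (by omega) hy h
    refine ⟨hyv, ?_⟩
    rcases eq_or_ne y v with e | hne
    · exact Or.inl e
    · rcases hvw with rfl | hvw
      · omega
      · exact Or.inr (hL.clique hne hy hv h hvw)
  refine ⟨⟨fun v' hv' u hu => ?_, fun v₁ h₁ v₂ h₂ hne u₁ hu₁ u₂ hu₂ => ?_,
    fun v' hv' u hu y hy h => ?_, fun u hu hun => ?_⟩, hap v hv, hF.lt w le_rfl, hnear⟩
  · rcases eq_or_ne v' v with rfl | hne
    · rw [Function.update_self] at hu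
      rcases hu with (rfl | hu) | hu
      · omega
      · have := hF.lt w le_rfl u hu
        omega
      · have := hF.lt v' hv.le u hu
        omega
    · rw [Function.update_of_ne hne] at hu
      have := hF.lt v' (by omega) u hu
      omega
  · rcases eq_or_ne v₁ v with rfl | hne₁
    · rw [Function.update_of_ne hne.symm] at hu₂
      rw [Function.update_self] at hu₁
      rcases hu₁ with hu₁ | hu₁
      · exact hap v₂ (by omega) u₁ hu₁ u₂ hu₂
      · exact hF.apart v₁ (by omega) v₂ (by omega) hne u₁ hu₁ u₂ hu₂
    · rw [Function.update_of_ne hne₁] at hu₁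
      rcases eq_or_ne v₂ v with rfl | hne₂
      · rw [Function.update_self] at hu₂
        rcases hu₂ with hu₂ | hu₂
        · have := hap v₁ (by omega) u₂ hu₂ u₁ hu₁
          exact ⟨this.1.symm, fun h => this.2 (hL.symm h)⟩
        · exact hF.apart v₁ (by omega) v₂ (by omega) hne u₁ hu₁ u₂ hu₂
      · rw [Function.update_of_ne hne₂] at hu₂
        exact hF.apart v₁ (by omega) v₂ (by omega) hne u₁ hu₁ u₂ hu₂
  · rcases eq_or_ne v' v with rfl | hne
    · rw [Function.update_self] at hu
      rcases hu with (rfl | hu) | hu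
      · exact hpar y (by omega) h
      · exact hpar y (by omega) (hnear u hu y (by omega) h)
      · exact hF.near v' (by omega) u hu y (by omega) h
    · rw [Function.update_of_ne hne] at hu
      exact hF.near v' (by omega) u hu y (by omega) h
  · rcases Nat.lt_or_ge w u with hlt | hge
    · obtain ⟨v', hv', hu'⟩ := hF.cover u hlt hun
      rcases eq_or_ne v' w with rfl | hne
      · exact ⟨v, by omega, by rw [Function.update_self]; exact Or.inl (Or.inr hu')⟩
      · refine ⟨v', by omega, ?_⟩
        rcases eq_or_ne v' v with rfl | hne'
        · rw [Function.update_self]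
          exact Or.inr hu'
        · rwa [Function.update_of_ne hne']
    · obtain rfl : u = w := by omega
      exact ⟨v, by omega, by rw [Function.update_self]; exact Or.inl (Or.inl rfl)⟩

end Layout

/-! ### Structured programs

Programs whose only loops are counted loops have a total semantics. -/

/-- Programs with counted loops: `loop x y P` runs `P` with register `x` counting from `0` up to
the value of register `y`. -/
inductive Prog where
  | skip
  | assign (x : ℕ) (e : Expr)
  | store (bank : ℕ) (index e : Expr)
  | seq (P₁ P₂ : Prog)
  | ite (e : Expr) (P₁ P₂ : Prog)
  | loop (x y : ℕ) (P : Prog)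

namespace Prog

/-- Translation into machine programs. -/
def compile : Prog → Program
  | skip => .skip
  | assign x e => .assign x e
  | store b i e => .store b i e
  | seq P₁ P₂ => .seq P₁.compile P₂.compile
  | ite e P₁ P₂ => .ite e P₁.compile P₂.compile
  | loop x y P => .seq (.assign x (.const 0)) (.while (.bin .lt (.reg x) (.reg y))
      (.seq P.compile (.assign x (.bin .add (.reg x) (.const 1)))))

/-- The final state. -/
def run : Prog → State → State
  | skip, s => s
  | assign x e, s => s.setReg x (e.eval s)
  | store b i e, s => s.setMem b (i.eval s) (e.eval s)
  | seq P₁ P₂, s => P₂.run (P₁.run s)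
  | ite e P₁ P₂, s => if e.eval s ≠ 0 then P₁.run s else P₂.run s
  | loop x y P, s =>
    Nat.rec (s.setReg x 0) (fun i s' => (P.run s').setReg x (i + 1)) (s.reg y)

/-- The state before round `i` of a loop with counter `x` and body `P` that starts in `s`. -/
def iter (P : Prog) (x : ℕ) (s : State) (i : ℕ) : State :=
  Nat.rec (s.setReg x 0) (fun i s' => (P.run s').setReg x (i + 1)) i

@[simp] lemma iter_zero (P : Prog) (x : ℕ) (s : State) : P.iter x s 0 = s.setReg x 0 := rfl

lemma iter_succ (P : Prog) (x : ℕ) (s : State) (i : ℕ) :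
    P.iter x s (i + 1) = (P.run (P.iter x s i)).setReg x (i + 1) := rfl

lemma run_seq (P₁ P₂ : Prog) (s : State) : (seq P₁ P₂).run s = P₂.run (P₁.run s) := rfl

lemma run_loop (x y : ℕ) (P : Prog) (s : State) : (loop x y P).run s = P.iter x s (s.reg y) := rfl

/-- Does the program write into register `z`? -/
def wr (z : ℕ) : Prog → Bool
  | skip => false
  | assign x _ => x == z
  | store _ _ _ => false
  | seq P₁ P₂ => P₁.wr z || P₂.wr z
  | ite _ P₁ P₂ => P₁.wr z || P₂.wr z
  | loop x _ P => x == z || P.wr z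

/-- Does the program write into bank `z`? -/
def wm (z : ℕ) : Prog → Bool
  | skip => false
  | assign _ _ => false
  | store b _ _ => b == z
  | seq P₁ P₂ => P₁.wm z || P₂.wm z
  | ite _ P₁ P₂ => P₁.wm z || P₂.wm z
  | loop _ _ P => P.wm z

lemma run_reg (P : Prog) : ∀ {z : ℕ} (_ : P.wr z = false) (s : State),
    (P.run s).reg z = s.reg z := by
  induction P with
  | skip => intros; rfl
  | assign x e =>
    intro z h s
    exact Function.update_of_ne (by rintro rfl; simp [wr] at h) _ _
  | store => intros; rfl
  | seq P₁ P₂ h₁ h₂ =>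
    intro z h s
    rw [wr, Bool.or_eq_false_iff] at h
    rw [run, h₂ h.2, h₁ h.1]
  | ite e P₁ P₂ h₁ h₂ =>
    intro z h s
    rw [wr, Bool.or_eq_false_iff] at h
    rw [run]
    split_ifs
    · exact h₁ h.1 s
    · exact h₂ h.2 s
  | loop x y P hP =>
    intro z h s
    rw [wr, Bool.or_eq_false_iff] at h
    have hz : z ≠ x := by rintro rfl; simp at h
    rw [run_loop]
    induction s.reg y with
    | zero => exact Function.update_of_ne hz _ _
    | succ i ih =>
      rw [iter_succ]
      exact (Function.update_of_ne hz _ _).trans ((hP h.2 _).trans ih)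

lemma run_mem (P : Prog) : ∀ {z : ℕ} (_ : P.wm z = false) (s : State),
    (P.run s).mem z = s.mem z := by
  induction P with
  | skip => intros; rfl
  | assign x e => intros; rfl
  | store b i e =>
    intro z h s
    exact Function.update_of_ne (by rintro rfl; simp [wm] at h) _ _
  | seq P₁ P₂ h₁ h₂ =>
    intro z h s
    rw [wm, Bool.or_eq_false_iff] at h
    rw [run, h₂ h.2, h₁ h.1]
  | ite e P₁ P₂ h₁ h₂ =>
    intro z h s
    rw [wm, Bool.or_eq_false_iff] at h
    rw [run]
    split_ifs
    · exact h₁ h.1 s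
    · exact h₂ h.2 s
  | loop x y P hP =>
    intro z h s
    rw [wm] at h
    rw [run_loop]
    induction s.reg y with
    | zero => rfl
    | succ i ih =>
      rw [iter_succ]
      exact (hP h _).trans ih

lemma iter_reg {P : Prog} {x z : ℕ} (h : P.wr z = false) (hz : z ≠ x) (s : State) (i : ℕ) :
    (P.iter x s i).reg z = s.reg z := by
  induction i with
  | zero => exact Function.update_of_ne hz _ _
  | succ i ih => exact (Function.update_of_ne hz _ _).trans ((P.run_reg h _).trans ih)

lemma iter_mem {P : Prog} {x z : ℕ} (h : P.wm z = false) (s : State) (i : ℕ) :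
    (P.iter x s i).mem z = s.mem z := by
  induction i with
  | zero => rfl
  | succ i ih => exact (P.run_mem h _).trans ih

lemma iter_counter {P : Prog} {x : ℕ} (s : State) (i : ℕ) : (P.iter x s i).reg x = i := by
  cases i <;> exact Function.update_self _ _ _

/-- `s'` agrees with `s` outside of what `P` writes. -/
def Frame (P : Prog) (s s' : State) : Prop :=
  (∀ z, P.wr z = false → s'.reg z = s.reg z) ∧ ∀ z, P.wm z = false → s'.mem z = s.mem z

lemma frame_run (P : Prog) (s : State) : P.Frame s (P.run s) :=
  ⟨fun _ h => P.run_reg h s, fun _ h => P.run_mem h s⟩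

lemma frame_iter (P : Prog) (x y : ℕ) (s : State) (i : ℕ) :
    (loop x y P).Frame s (P.iter x s i) := by
  refine ⟨fun z h => ?_, fun z h => iter_mem (P := P) h s i⟩
  rw [wr, Bool.or_eq_false_iff] at h
  exact iter_reg h.2 (by rintro rfl; simp at h) s i

/-- Induction over the rounds of a loop. -/
lemma loop_induction {x y : ℕ} {P : Prog} {s : State} (I : ℕ → State → Prop)
    (h0 : I 0 (s.setReg x 0))
    (hstep : ∀ i < s.reg y, ∀ s', (loop x y P).Frame s s' → s'.reg x = i → I i s' →
      I (i + 1) ((P.run s').setReg x (i + 1))) : I (s.reg y) ((loop x y P).run s) := by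
  rw [run_loop]
  suffices ∀ i ≤ s.reg y, I i (P.iter x s i) from this _ le_rfl
  intro i hi
  induction i with
  | zero => exact h0
  | succ i ih =>
    exact hstep i (by omega) _ (frame_iter P x y s i) (iter_counter s i) (ih (by omega))

/-! ### Overflow and running time -/

/-- Running `P` in state `s` does not exceed the word bound `B`, and the loops run for at most as
many rounds as `env` allows. -/
def Safe (B : ℕ) (env : ℕ → ℕ) : Prog → State → Prop
  | skip, _ => True
  | assign _ e, s => e.Fits B s
  | store _ i e, s => i.Fits B s ∧ e.Fits B s
  | seq P₁ P₂, s => P₁.Safe B env s ∧ P₂.Safe B env (P₁.run s)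
  | ite e P₁ P₂, s => e.Fits B s ∧ if e.eval s ≠ 0 then P₁.Safe B env s else P₂.Safe B env s
  | loop x y P, s => x ≠ y ∧ P.wr x = false ∧ P.wr y = false ∧ 1 ≤ B ∧ s.reg y ≤ B ∧
      s.reg y ≤ env y ∧ ∀ i < s.reg y, P.Safe B env (P.iter x s i)

/-- A bound for the number of steps when the loops with bound register `y` run for at most `env y`
rounds. -/
def cost (env : ℕ → ℕ) : Prog → ℕ
  | skip => 1
  | assign _ e => e.cost + 1
  | store _ i e => i.cost + e.cost + 1
  | seq P₁ P₂ => P₁.cost env + P₂.cost env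
  | ite e P₁ P₂ => e.cost + 1 + (P₁.cost env + P₂.cost env)
  | loop _ y P => 6 + env y * (P.cost env + 8)

/-- A compiled loop spends 2 steps on resetting the counter, 4 on each test and 4 on each increment,
hence 8 extra steps per round and 6 for the reset and the final test. `Safe` forbids the body to
write into the counter and the bound register, so the `while` loop passes through the states of
`iter`. -/
theorem runs_of_safe {B : ℕ} {env : ℕ → ℕ} (P : Prog) : ∀ s, P.Safe B env s →
    ∃ t ≤ P.cost env, Runs B P.compile s t (P.run s) := by
  induction P with
  | skip => exact fun s _ => ⟨1, le_rfl, .skip s⟩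
  | assign x e => exact fun s h => ⟨_, le_rfl, .assign x e s h⟩
  | store b i e => exact fun s h => ⟨_, le_rfl, .store b i e s h.1 h.2⟩
  | seq P₁ P₂ h₁ h₂ =>
    intro s h
    obtain ⟨t₁, ht₁, r₁⟩ := h₁ s h.1
    obtain ⟨t₂, ht₂, r₂⟩ := h₂ _ h.2
    exact ⟨t₁ + t₂, Nat.add_le_add ht₁ ht₂, .seq r₁ r₂⟩
  | ite e P₁ P₂ h₁ h₂ =>
    intro s h
    obtain ⟨hf, h⟩ := h
    rw [run, cost]
    split_ifs at h ⊢ with he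
    · obtain ⟨t, ht, r⟩ := h₁ s h
      exact ⟨_, by omega, .ite_true hf he r⟩
    · obtain ⟨t, ht, r⟩ := h₂ s h
      exact ⟨_, by omega, .ite_false hf (not_not.1 he) r⟩
  | loop x y P hP =>
    intro s ⟨hxy, hwx, hwy, hB, hyB, hye, hs⟩
    -- The induction is on the number `j` of rounds still to come, because a run of `while` unfolds
    -- at its first round.
    have key : ∀ j ≤ s.reg y, ∃ t ≤ j * (P.cost env + 8) + 4,
        Runs B (.while (.bin .lt (.reg x) (.reg y))
          (.seq P.compile (.assign x (.bin .add (.reg x) (.const 1)))))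
          (P.iter x s (s.reg y - j)) t (P.iter x s (s.reg y)) := by
      intro j
      induction j with
      | zero =>
        intro _
        refine ⟨_, ?_, .while_false ?_ ?_⟩
        · simp [Expr.cost]
        · simp [Expr.Fits, Expr.eval, Op.eval, iter_counter, iter_reg hwy hxy.symm, hyB]
        · simp [Expr.eval, Op.eval, iter_counter, iter_reg hwy hxy.symm]
      | succ j ih =>
        intro hj
        obtain ⟨t₂, ht₂, r₂⟩ := ih (by omega)
        set i := s.reg y - (j + 1) with hi
        have hi' : s.reg y - j = i + 1 := by omega
        obtain ⟨t₁, ht₁, r₁⟩ := hP _ (hs i (by omega))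
        rw [hi', iter_succ] at r₂
        have hc : (P.run (P.iter x s i)).reg x = i := by rw [P.run_reg hwx, iter_counter]
        have r₃ : Runs B (.seq P.compile (.assign x (.bin .add (.reg x) (.const 1))))
            (P.iter x s i) (t₁ + 4) ((P.run (P.iter x s i)).setReg x (i + 1)) := by
          refine .seq r₁ ?_
          have := Runs.assign (B := B) x (.bin .add (.reg x) (.const 1)) (P.run (P.iter x s i))
            (by simp only [Expr.Fits, Expr.eval, Op.eval, hc]; omega)
          simpa [Expr.eval, Op.eval, hc, Expr.cost] using this
        refine ⟨_, ?_, .while_true ?_ ?_ r₃ r₂⟩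
        · simp only [Expr.cost]
          rw [Nat.succ_mul]
          omega
        · simp only [Expr.Fits, Expr.eval, Op.eval, iter_counter, iter_reg hwy hxy.symm]
          refine ⟨by omega, by omega, ?_⟩
          split_ifs <;> omega
        · simp only [Expr.eval, Op.eval, iter_counter, iter_reg hwy hxy.symm]
          rw [if_pos (by omega)]
          omega
    obtain ⟨t, ht, r⟩ := key _ le_rfl
    rw [Nat.sub_self, iter_zero] at r
    refine ⟨_, ?_, .seq (.assign x (.const 0) s (Nat.zero_le _)) r⟩
    have := Nat.mul_le_mul_right (P.cost env + 8) hye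
    simp only [Expr.cost, cost]
    omega

end Prog

/-! ### Values are polynomially bounded -/

/-- All registers and memory cells hold at most `A`. -/
def State.Bounded (A : ℕ) (s : State) : Prop := (∀ x, s.reg x ≤ A) ∧ ∀ b i, s.mem b i ≤ A

lemma State.Bounded.setReg {A x a : ℕ} {s : State} (h : s.Bounded A) (ha : a ≤ A) :
    (s.setReg x a).Bounded A := by
  refine ⟨fun y => ?_, h.2⟩
  rcases eq_or_ne y x with rfl | hne
  · simpa [State.setReg] using ha
  · simpa [State.setReg, hne] using h.1 y

lemma State.Bounded.setMem {A b i a : ℕ} {s : State} (h : s.Bounded A) (ha : a ≤ A) :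
    (s.setMem b i a).Bounded A := by
  refine ⟨h.1, fun b' i' => ?_⟩
  simp only [State.setMem, Function.update_apply]
  split_ifs with hb
  · rw [Function.update_apply]
    split_ifs
    · exact ha
    · exact h.2 _ _
  · exact h.2 _ _

/-- The exponent of a bound for the values in an expression when the registers and memory cells
are bounded with exponent `D`. -/
def Expr.deg (D : ℕ) : Expr → ℕ
  | .const c => c
  | .reg _ => D
  | .load _ e => max (e.deg D) D
  | .bin _ e₁ e₂ => e₁.deg D + e₂.deg D + 1

lemma Expr.Fits.mono {B B' : ℕ} (hB : B ≤ B') {s : State} : ∀ {e : Expr}, e.Fits B s → e.Fits B' s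
  | .const _, h => le_trans h hB
  | .reg _, h => le_trans h hB
  | .load _ e, h => ⟨mono hB (e := e) h.1, h.2.trans hB⟩
  | .bin _ e₁ e₂, h => ⟨mono hB (e := e₁) h.1, mono hB (e := e₂) h.2.1, h.2.2.trans hB⟩

/-- No operation does worse than multiplying the bounds of its arguments, up to a factor `2` for
sums. The extra `1` in the exponent absorbs this factor, as `2 ≤ b`. -/
lemma Expr.fits_of_bounded {b D : ℕ} (hb : 2 ≤ b) {s : State} (hs : s.Bounded (b ^ D)) :
    ∀ e : Expr, e.eval s ≤ b ^ e.deg D ∧ e.Fits (b ^ e.deg D) s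
  | .const c => by
    have : c ≤ b ^ c := (Nat.lt_pow_self hb).le
    exact ⟨this, this⟩
  | .reg x => ⟨hs.1 x, hs.1 x⟩
  | .load m e => by
    have h := fits_of_bounded hb hs e
    have h2 : s.mem m (e.eval s) ≤ b ^ max (e.deg D) D :=
      (hs.2 _ _).trans (Nat.pow_le_pow_right (by omega) (le_max_right _ _))
    exact ⟨h2, h.2.mono (Nat.pow_le_pow_right (by omega) (le_max_left _ _)), h2⟩
  | .bin o e₁ e₂ => by
    have h₁ := fits_of_bounded hb hs e₁
    have h₂ := fits_of_bounded hb hs e₂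
    have l₁ : b ^ e₁.deg D ≤ b ^ (e₁.deg D + e₂.deg D + 1) := Nat.pow_le_pow_right (by omega) (by omega)
    have l₂ : b ^ e₂.deg D ≤ b ^ (e₁.deg D + e₂.deg D + 1) := Nat.pow_le_pow_right (by omega) (by omega)
    have hv : o.eval (e₁.eval s) (e₂.eval s) ≤ b ^ (e₁.deg D + e₂.deg D + 1) := by
      have hone : 1 ≤ b ^ (e₁.deg D + e₂.deg D + 1) := Nat.one_le_pow _ _ (by omega)
      have v₁ := h₁.1
      have v₂ := h₂.1
      cases o <;> simp only [Op.eval]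
      · have g₁ : b ^ e₁.deg D ≤ b ^ (e₁.deg D + e₂.deg D) := Nat.pow_le_pow_right (by omega) (by omega)
        have g₂ : b ^ e₂.deg D ≤ b ^ (e₁.deg D + e₂.deg D) := Nat.pow_le_pow_right (by omega) (by omega)
        calc _ ≤ b ^ (e₁.deg D + e₂.deg D) * 2 := by omega
          _ ≤ b ^ (e₁.deg D + e₂.deg D) * b := Nat.mul_le_mul_left _ hb
          _ = _ := (pow_succ _ _).symm
      · omega
      · calc _ ≤ b ^ e₁.deg D * b ^ e₂.deg D := Nat.mul_le_mul v₁ v₂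
          _ = b ^ (e₁.deg D + e₂.deg D) := (pow_add _ _ _).symm
          _ ≤ _ := Nat.pow_le_pow_right (by omega) (by omega)
      · exact (Nat.div_le_self _ _).trans (v₁.trans l₁)
      · exact (Nat.mod_le _ _).trans (v₁.trans l₁)
      · split_ifs <;> omega
      · split_ifs <;> omega
    exact ⟨hv, h₁.2.mono l₁, h₂.2.mono l₂, hv⟩

/-- Expressions whose value is bounded by the contents of the registers and the memory. -/
def Expr.flat : Expr → Bool
  | .const c => c ≤ 1
  | .reg _ => true
  | .load _ _ => true
  | .bin .sub e _ => e.flat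
  | .bin .div e _ => e.flat
  | .bin .mod _ (.bin .add e (.const 1)) => e.flat
  | .bin .mod e _ => e.flat
  | .bin .lt _ _ => true
  | .bin .eq _ _ => true
  | _ => false

/-- A sum is not flat, but a remainder modulo `e + 1` is at most `e`. For this reason some sums in
the programs below are reduced by a modulus that never changes them. -/
lemma Expr.flat_le {A : ℕ} (hA : 1 ≤ A) {s : State} (hs : s.Bounded A) (e : Expr) :
    e.flat = true → e.eval s ≤ A := by
  fun_induction Expr.flat e <;> intro h
  case case1 c => simp only [decide_eq_true_eq] at h; exact h.trans hA
  case case2 => exact hs.1 _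
  case case3 => exact hs.2 _ _
  case case4 ih => exact (Nat.sub_le _ _).trans (ih h)
  case case5 ih => exact (Nat.div_le_self _ _).trans (ih h)
  case case6 ih => exact (Nat.lt_succ_iff.1 (Nat.mod_lt _ (Nat.succ_pos _))).trans (ih h)
  case case7 ih => exact (Nat.mod_le _ _).trans (ih h)
  case case8 => simp only [Expr.eval, Op.eval]; split_ifs <;> omega
  case case9 => simp only [Expr.eval, Op.eval]; split_ifs <;> omega
  case case10 => simp at h

/-! ### Programs that never enlarge the stored values. -/

namespace Prog

/-- The program only computes values that are bounded by earlier contents, and `Y` lists the bounds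
of its loops, into which it does not write. -/
def tame (Y : List ℕ) : Prog → Bool
  | skip => true
  | assign x e => !Y.contains x && e.flat
  | store _ _ e => e.flat
  | seq P₁ P₂ => P₁.tame Y && P₂.tame Y
  | ite _ P₁ P₂ => P₁.tame Y && P₂.tame Y
  | loop x y P => Y.contains y && !Y.contains x && !P.wr x && P.tame Y

/-- The exponent of a bound for the values in a program when the registers and memory cells
are bounded with exponent `D`. -/
def deg (D : ℕ) : Prog → ℕ
  | skip => D
  | assign _ e => e.deg D
  | store _ i e => i.deg D + e.deg D
  | seq P₁ P₂ => P₁.deg D + P₂.deg D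
  | ite e P₁ P₂ => e.deg D + P₁.deg D + P₂.deg D
  | loop _ _ P => D + P.deg D

lemma wr_of_tame {Y : List ℕ} {P : Prog} (h : P.tame Y = true) {y : ℕ} (hy : y ∈ Y) :
    P.wr y = false := by
  induction P with
  | skip => rfl
  | assign x e =>
    simp only [tame, Bool.and_eq_true, Bool.not_eq_true', List.contains_eq_mem, decide_eq_false_iff_not] at h
    simp only [wr, beq_eq_false_iff_ne]
    rintro rfl
    exact h.1 hy
  | store => rfl
  | seq P₁ P₂ h₁ h₂ =>
    simp only [tame, Bool.and_eq_true] at h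
    simp [wr, h₁ h.1, h₂ h.2]
  | ite e P₁ P₂ h₁ h₂ =>
    simp only [tame, Bool.and_eq_true] at h
    simp [wr, h₁ h.1, h₂ h.2]
  | loop x z P hP =>
    simp only [tame, Bool.and_eq_true, Bool.not_eq_true', List.contains_eq_mem, decide_eq_false_iff_not,
      decide_eq_true_eq] at h
    simp only [wr, hP h.2, Bool.or_false, beq_eq_false_iff_ne]
    rintro rfl
    exact h.1.1.2 hy

/-- A tame program stores nothing above `b ^ D`, and loop counters stay within their bound
registers. The same bound therefore holds before every round, and the exponent needed for
intermediate values, such as addresses, does not depend on the number of rounds. -/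
lemma safe_of_tame {Y : List ℕ} {b D B : ℕ} {env : ℕ → ℕ} (hb : 2 ≤ b) (P : Prog) :
    ∀ s, P.tame Y = true → b ^ P.deg D ≤ B → s.Bounded (b ^ D) → (∀ y ∈ Y, s.reg y ≤ env y) →
      P.Safe B env s ∧ (P.run s).Bounded (b ^ D) := by
  have hA : 1 ≤ b ^ D := Nat.one_le_pow _ _ (by omega)
  have hpow : ∀ {i j : ℕ}, i ≤ j → b ^ j ≤ B → b ^ i ≤ B := fun h hB =>
    (Nat.pow_le_pow_right (by omega) h).trans hB
  induction P with
  | skip => exact fun s _ _ h _ => ⟨trivial, h⟩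
  | assign x e =>
    intro s ht hB hs _
    simp only [tame, Bool.and_eq_true] at ht
    exact ⟨(e.fits_of_bounded hb hs).2.mono hB, hs.setReg (e.flat_le hA hs ht.2)⟩
  | store m i e =>
    intro s ht hB hs _
    exact ⟨⟨(i.fits_of_bounded hb hs).2.mono (hpow (Nat.le_add_right _ _) hB),
      (e.fits_of_bounded hb hs).2.mono (hpow (Nat.le_add_left _ _) hB)⟩,
      hs.setMem (e.flat_le hA hs ht)⟩
  | seq P₁ P₂ h₁ h₂ =>
    intro s ht hB hs hY
    simp only [tame, Bool.and_eq_true] at ht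
    have g₁ := h₁ s ht.1 (hpow (Nat.le_add_right _ _) hB) hs hY
    have g₂ := h₂ _ ht.2 (hpow (Nat.le_add_left _ _) hB) g₁.2
      fun y hy => by rw [P₁.run_reg (wr_of_tame ht.1 hy)]; exact hY y hy
    exact ⟨⟨g₁.1, g₂.1⟩, g₂.2⟩
  | ite e P₁ P₂ h₁ h₂ =>
    intro s ht hB hs hY
    simp only [tame, Bool.and_eq_true] at ht
    simp only [deg] at hB
    have g₁ := h₁ s ht.1 (hpow (by omega) hB) hs hY
    have g₂ := h₂ s ht.2 (hpow (by omega) hB) hs hY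
    have g := (e.fits_of_bounded hb hs).2.mono (hpow (by omega) hB)
    rw [Safe, run]
    split_ifs
    · exact ⟨⟨g, g₁.1⟩, g₁.2⟩
    · exact ⟨⟨g, g₂.1⟩, g₂.2⟩
  | loop x y P hP =>
    intro s ht hB hs hY
    simp only [tame, Bool.and_eq_true, Bool.not_eq_true', List.contains_eq_mem, decide_eq_false_iff_not,
      decide_eq_true_eq] at ht
    obtain ⟨⟨⟨hy, hx⟩, hwx⟩, ht⟩ := ht
    simp only [deg] at hB
    have hxy : x ≠ y := by rintro rfl; exact hx hy
    have hwy := wr_of_tame ht hy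
    have hyA := hs.1 y
    have hiter : ∀ i ≤ s.reg y, (P.iter x s i).Bounded (b ^ D) ∧
        ∀ z ∈ Y, (P.iter x s i).reg z ≤ env z := by
      intro i hi
      refine ⟨?_, fun z hz => ?_⟩
      · induction i with
        | zero => exact hs.setReg (Nat.zero_le _)
        | succ i ih =>
          refine State.Bounded.setReg (hP _ ht (hpow (by omega) hB) (ih (by omega)) fun z hz => ?_).2
            (by omega)
          rw [iter_reg (wr_of_tame ht hz) (by rintro rfl; exact hx hz)]
          exact hY z hz
      · rw [iter_reg (wr_of_tame ht hz) (by rintro rfl; exact hx hz)]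
        exact hY z hz
    refine ⟨⟨hxy, hwx, hwy, ?_, ?_, hY y hy, fun i hi => ?_⟩, (hiter _ le_rfl).1⟩
    · exact hA.trans (hpow (Nat.le_add_right _ _) hB)
    · exact hyA.trans (hpow (Nat.le_add_right _ _) hB)
    · exact (hP _ ht (hpow (by omega) hB) (hiter i hi.le).1 (hiter i hi.le).2).1

end Prog

local infixl:65 " +ₑ " => Expr.bin Op.add
local infixl:65 " -ₑ " => Expr.bin Op.sub
local infixl:70 " *ₑ " => Expr.bin Op.mul
local infixl:70 " /ₑ " => Expr.bin Op.div
local infixl:70 " %ₑ " => Expr.bin Op.mod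
local infix:50 " <ₑ " => Expr.bin Op.lt
local infix:50 " =ₑ " => Expr.bin Op.eq

open FairDivision.Expr FairDivision.Prog

/-! ### The dynamic program

With `N = n + 1`, `K = N ^ k` and `M = base ^ k`, the registers are used as follows:
`0`: `n`, `1`: `N`, `2`: `k`, `3`: `K`, `4`: `M`, `5`: `K * M * N`, `8`: `base`, `10`–`15`: loop
counters, `19`: the current position, `20`: its parent, `21`, `22`: the tables of the two,
`23`: a digit.

The banks are: `3`: the vertex at a position, `4`: marks of visited vertices, `5`: the table that
belongs to a position, `6`: the table under construction, `7`: the finished tables, `8`: the powers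
of `N`, `9`: the powers of `base`. -/

/-- The address of the cell `u` of the entry at `f` and `a` of the table `w`. -/
def cellE (w f a u : Expr) : Expr := ((w *ₑ reg 3 +ₑ f) *ₑ reg 4 +ₑ a) *ₑ reg 1 +ₑ u

/-- Copy the table of the current position. -/
def copyProg : Prog := loop 12 5 (store 6 (reg 12) (load 7 (reg 21 *ₑ reg 5 +ₑ reg 12)))

/-- The tuple in register `11` with the current position at the place in register `15`. -/
def placedE : Expr := reg 11 -ₑ reg 23 *ₑ load 8 (reg 15) +ₑ reg 19 *ₑ load 8 (reg 15)

/-- The profit code in register `13` increased by the profit of the current position. -/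
def raisedE : Expr := reg 13 +ₑ load 1 (reg 15 *ₑ reg 0 +ₑ load 3 (reg 19)) *ₑ load 9 (reg 15)

/-- Extend one coloring by the current position. -/
def extendEntry : Prog :=
  ite (load 7 (cellE (reg 21) placedE (reg 13) (const 0)))
    (seq (loop 12 1 (store 6 (cellE (const 0) (reg 11) raisedE (reg 12))
        (load 7 (cellE (reg 21) placedE (reg 13) (reg 12)))))
      (store 6 (cellE (const 0) (reg 11) raisedE (reg 19))
        ((reg 15 +ₑ const 1) %ₑ (reg 2 +ₑ const 1))))
    skip

/-- Extend the colorings for one tuple by the current position with one color. -/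
def extendColor : Prog :=
  seq (assign 23 ((reg 11 /ₑ load 8 (reg 15)) %ₑ reg 1))
    (ite (reg 23 <ₑ reg 19)
      (ite ((const 0 <ₑ reg 23) *ₑ load 0 (load 3 (reg 19) *ₑ reg 0 +ₑ load 3 (reg 23))) skip
        (loop 13 4 extendEntry)) skip)

/-- Add the current position to its table. -/
def extendProg : Prog := loop 11 3 (loop 15 2 extendColor)

/-- Superpose two colorings. -/
def mergeEntry : Prog :=
  ite (load 6 (cellE (const 0) (reg 11) (reg 13) (const 0)) *ₑ
      load 7 (cellE (reg 22) (reg 11) (reg 14) (const 0)))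
    (loop 12 1 (ite (load 6 (cellE (const 0) (reg 11) (reg 13) (reg 12)))
      (store 7 (cellE (reg 19) (reg 11) (reg 13 +ₑ reg 14) (reg 12))
        (load 6 (cellE (const 0) (reg 11) (reg 13) (reg 12))))
      (store 7 (cellE (reg 19) (reg 11) (reg 13 +ₑ reg 14) (reg 12))
        (load 7 (cellE (reg 22) (reg 11) (reg 14) (reg 12))))))
    skip

/-- Merge the table of the current position into that of its parent. -/
def mergeProg : Prog := loop 11 3 (loop 13 4 (loop 14 4 mergeEntry))

/-- Find the parent of the current position. -/
def parentProg : Prog :=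
  seq (assign 20 (const 0))
    (loop 11 1 (ite ((const 0 <ₑ reg 11) *ₑ (reg 11 <ₑ reg 19) *ₑ
      load 0 (load 3 (reg 19) *ₑ reg 0 +ₑ load 3 (reg 11))) (assign 20 (reg 11)) skip))

/-- Process one position. -/
def positionProg : Prog :=
  seq (assign 19 (reg 0 -ₑ reg 10)) <| seq parentProg <| seq (assign 21 (load 5 (reg 19))) <|
  seq copyProg <| seq extendProg <| seq (assign 22 (load 5 (reg 20))) <| seq mergeProg <|
  store 5 (reg 20) (reg 19)

/-- Initialize the table of the empty set. -/
def initProg : Prog := loop 11 3 (store 7 (cellE (const 0) (reg 11) (const 0) (const 0)) (const 1))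

/-- The dynamic program. -/
def tableProg : Prog := seq initProg (loop 10 0 positionProg)

/-! ### Loops that fill a table -/

/-- Running `P` in state `s` preserves the property `Inv` of the bank `b`, keeps the elements of
`Fl` and adds those of `item`. -/
def Prog.Collects {α : Type*} (b : ℕ) (Inv : (ℕ → ℕ) → Prop) (Fl : (ℕ → ℕ) → Set α) (P : Prog)
    (s : State) (item : Set α) : Prop :=
  Inv (s.mem b) → Inv ((P.run s).mem b) ∧ Fl (s.mem b) ⊆ Fl ((P.run s).mem b) ∧
    item ⊆ Fl ((P.run s).mem b)

/-- Since no round loses what earlier rounds have collected, a nest of loops is understood as soon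
as its innermost round is. Overwriting is allowed as long as the invariant survives. -/
lemma Prog.Collects.loop {α : Type*} {b x y : ℕ} {Inv : (ℕ → ℕ) → Prop} {Fl : (ℕ → ℕ) → Set α}
    {P : Prog} {s : State} (item : ℕ → Set α)
    (h : ∀ i < s.reg y, ∀ s', (loop x y P).Frame s s' → s'.reg x = i →
      P.Collects b Inv Fl s' (item i)) :
    (Prog.loop x y P).Collects b Inv Fl s {z | ∃ i < s.reg y, z ∈ item i} := by
  intro h0
  have := loop_induction (x := x) (y := y) (P := P) (s := s)
    (fun i s' => Inv (s'.mem b) ∧ Fl (s.mem b) ⊆ Fl (s'.mem b) ∧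
      ∀ j < i, item j ⊆ Fl (s'.mem b)) ⟨h0, subset_rfl, by simp⟩ ?_
  · refine ⟨this.1, this.2.1, ?_⟩
    rintro z ⟨i, hi, hz⟩
    exact this.2.2 i hi hz
  · rintro i hi s' hF hx ⟨h1, h2, h3⟩
    obtain ⟨g1, g2, g3⟩ := h i hi s' hF hx h1
    refine ⟨g1, h2.trans g2, fun j hj => ?_⟩
    rcases Nat.lt_succ_iff_lt_or_eq.1 hj with hj | rfl
    · exact (h3 j hj).trans g2
    · exact g3

lemma mul_add_inj {B x y x' y' : ℕ} (hy : y < B) (hy' : y' < B) (h : x * B + y = x' * B + y') :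
    x = x' ∧ y = y' := by
  have h1 : x = x' := by
    have e : ∀ a b, b < B → (a * B + b) / B = a := fun a b hb => by
      rw [mul_comm, Nat.mul_add_div (by omega), Nat.div_eq_of_lt hb, add_zero]
    rw [← e x y hy, h, e x' y' hy']
  subst h1
  exact ⟨rfl, by omega⟩

/-! ### Addresses of table entries, and layouts as seen by the machine. -/

namespace Layout

variable (L : Layout)

/-- The address of the cell `u` of the entry at `f` and `a` of the table `w`. -/
def cell (w f a u : ℕ) : ℕ :=
  ((w * (L.n + 1) ^ L.k + f) * L.base ^ L.k + a) * (L.n + 1) + u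

/-- The tables of a bank. -/
def tab (m : ℕ → ℕ) (w f a u : ℕ) : ℕ := m (L.cell w f a u)

variable {L}

lemma cell_inj {w f a u w' f' a' u' : ℕ} (hf : f < (L.n + 1) ^ L.k) (hf' : f' < (L.n + 1) ^ L.k)
    (ha : a < L.base ^ L.k) (ha' : a' < L.base ^ L.k) (hu : u ≤ L.n) (hu' : u' ≤ L.n)
    (h : L.cell w f a u = L.cell w' f' a' u') : w = w' ∧ f = f' ∧ a = a' ∧ u = u' := by
  obtain ⟨h1, h2⟩ := mul_add_inj (Nat.lt_succ_of_le hu) (Nat.lt_succ_of_le hu') h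
  obtain ⟨h3, h4⟩ := mul_add_inj ha ha' h1
  obtain ⟨h5, h6⟩ := mul_add_inj hf hf' h3
  exact ⟨h5, h6, h4, h2⟩

variable (L) in
/-- The registers and the read-only banks describe `L`. -/
structure Env (s : State) : Prop where
  n : s.reg 0 = L.n
  N : s.reg 1 = L.n + 1
  k : s.reg 2 = L.k
  K : s.reg 3 = (L.n + 1) ^ L.k
  M : s.reg 4 = L.base ^ L.k
  KMN : s.reg 5 = (L.n + 1) ^ L.k * L.base ^ L.k * (L.n + 1)
  base : s.reg 8 = L.base
  adj : ∀ x ∈ Finset.Icc 1 L.n, ∀ w ∈ Finset.Icc 1 L.n,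
    (s.mem 0 (s.mem 3 w * L.n + s.mem 3 x) ≠ 0 ↔ L.R x w)
  profit : ∀ c < L.k, ∀ u ∈ Finset.Icc 1 L.n, s.mem 1 (c * L.n + s.mem 3 u) = L.p c u
  powN : ∀ c ≤ L.k, s.mem 8 c = (L.n + 1) ^ c
  powB : ∀ c ≤ L.k, s.mem 9 c = L.base ^ c

/-- The description of `L` lives in a few registers and banks. The default arguments check on the
text of `P` that it writes into none of them. -/
lemma Env.of_frame {s s' : State} (h : L.Env s) {P : Prog} (hF : P.Frame s s')
    (hr : ∀ z ∈ [0, 1, 2, 3, 4, 5, 8], P.wr z = false := by decide)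
    (hm : ∀ z ∈ [0, 1, 3, 8, 9], P.wm z = false := by decide) : L.Env s' := by
  have r := fun z hz => hF.1 z (hr z hz)
  have m := fun z hz => hF.2 z (hm z hz)
  simp only [List.mem_cons, List.not_mem_nil, or_false, forall_eq_or_imp, forall_eq] at r m
  obtain ⟨r0, r1, r2, r3, r4, r5, r8⟩ := r
  obtain ⟨m0, m1, m3, m8, m9⟩ := m
  constructor
  · rw [r0, h.n]
  · rw [r1, h.N]
  · rw [r2, h.k]
  · rw [r3, h.K]
  · rw [r4, h.M]
  · rw [r5, h.KMN]
  · rw [r8, h.base]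
  · rw [m0, m3]; exact h.adj
  · rw [m1, m3]; exact h.profit
  · rw [m8]; exact h.powN
  · rw [m9]; exact h.powB

lemma Env.eval_cellE {s : State} (h : L.Env s) (w f a u : Expr) :
    (cellE w f a u).eval s = L.cell (w.eval s) (f.eval s) (a.eval s) (u.eval s) := by
  simp [cellE, Expr.eval, Op.eval, cell, h.N, h.K, h.M]

/-- A loop that writes the values `v` into an entry of a table. -/
lemma fill {s : State} (hN : s.reg 1 = L.n + 1) {b w f a : ℕ} (hf : f < (L.n + 1) ^ L.k)
    (ha : a < L.base ^ L.k) (Q : Prog) (v : ℕ → ℕ)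
    (hQ : ∀ u ≤ L.n, ∀ s', (loop 12 1 Q).Frame s s' → s'.reg 12 = u →
      (∀ w' f' a' u', f' < (L.n + 1) ^ L.k → a' < L.base ^ L.k → u' ≤ L.n →
        ¬ (w' = w ∧ f' = f ∧ a' = a) → L.tab (s'.mem b) w' f' a' u' = L.tab (s.mem b) w' f' a' u') →
      Q.run s' = s'.setMem b (L.cell w f a u) (v u)) :
    (∀ u ≤ L.n, L.tab (((loop 12 1 Q).run s).mem b) w f a u = v u) ∧
    ∀ w' f' a' u', f' < (L.n + 1) ^ L.k → a' < L.base ^ L.k → u' ≤ L.n →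
      ¬ (w' = w ∧ f' = f ∧ a' = a) →
      L.tab (((loop 12 1 Q).run s).mem b) w' f' a' u' = L.tab (s.mem b) w' f' a' u' := by
  have := loop_induction (x := 12) (y := 1) (P := Q) (s := s)
    (fun i s' => (∀ u < i, L.tab (s'.mem b) w f a u = v u) ∧
      ∀ w' f' a' u', f' < (L.n + 1) ^ L.k → a' < L.base ^ L.k → u' ≤ L.n →
        ¬ (w' = w ∧ f' = f ∧ a' = a) → L.tab (s'.mem b) w' f' a' u' = L.tab (s.mem b) w' f' a' u')
    ⟨by simp, fun _ _ _ _ _ _ _ _ => rfl⟩ ?_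
  · rw [hN] at this
    exact ⟨fun u hu => this.1 u (by omega), this.2⟩
  · rintro i hi s' hF hx ⟨h1, h2⟩
    rw [hN] at hi
    rw [hQ i (by omega) s' hF hx h2]
    simp only [State.setReg, State.setMem, Function.update_self, tab]
    refine ⟨fun u hu => ?_, fun w' f' a' u' hf' ha' hu' hne => ?_⟩
    · rw [Function.update_apply]
      split_ifs with he
      · rw [(cell_inj hf hf ha ha (by omega) (by omega) he).2.2.2]
      · exact h1 u (lt_of_le_of_ne (by omega) (by rintro rfl; exact he rfl))
    · rw [Function.update_of_ne]
      · exact h2 w' f' a' u' hf' ha' hu' hne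
      · intro he
        obtain ⟨e1, e2, e3, -⟩ := cell_inj hf' hf ha' ha hu' (by omega) he
        exact hne ⟨e1, e2, e3⟩

/-! ### Construction of the tables -/

/-- A table is a block of `(n + 1) ^ k * base ^ k * (n + 1)` consecutive cells, which is the content
of register `5`, so a linear copy reaches every entry. -/
lemma copy_spec {s : State} (h : L.Env s) (f a u : ℕ) (hf : f < (L.n + 1) ^ L.k)
    (ha : a < L.base ^ L.k) (hu : u ≤ L.n) :
    L.tab ((copyProg.run s).mem 6) 0 f a u = L.tab (s.mem 7) (s.reg 21) f a u := by
  have := loop_induction (x := 12) (y := 5) (s := s)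
    (P := store 6 (reg 12) (load 7 (reg 21 *ₑ reg 5 +ₑ reg 12)))
    (fun i s' => ∀ x < i, s'.mem 6 x = s.mem 7 (s.reg 21 * s.reg 5 + x)) (by simp) ?_
  · have hlt : L.cell 0 f a u < s.reg 5 := by
      rw [h.KMN, cell]
      have h1 : (0 * (L.n + 1) ^ L.k + f) * L.base ^ L.k + a + 1 ≤
          (L.n + 1) ^ L.k * L.base ^ L.k := by
        calc _ ≤ f * L.base ^ L.k + L.base ^ L.k := by rw [zero_mul, zero_add]; omega
          _ = (f + 1) * L.base ^ L.k := by ring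
          _ ≤ _ := Nat.mul_le_mul_right _ hf
      have h2 := Nat.mul_le_mul_right (L.n + 1) h1
      rw [Nat.succ_mul] at h2
      omega
    rw [tab, copyProg, this _ hlt, tab, h.KMN]
    congr 1
    simp only [cell]
    ring
  · intro i hi s' hF hx ih y hy
    simp only [Prog.run, Expr.eval, Op.eval, State.setMem, State.setReg, Function.update_self, hx,
      hF.1 21 rfl, hF.1 5 rfl, hF.2 7 rfl]
    rw [Function.update_apply]
    split_ifs with he
    · rw [he]
    · exact ih y (by omega)

/-- The flagged entries of `T` are colorings of `D` with the profit codes they are filed under. -/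
def Sound (T : ℕ → ℕ → ℕ → ℕ) (D : Set ℕ) : Prop :=
  ∀ f < (L.n + 1) ^ L.k, ∀ a < L.base ^ L.k, T f a 0 ≠ 0 → L.Good D f (T f a) ∧ L.weight (T f a) = a

variable (L) in
/-- The flagged entries of a table. -/
def flags (T : ℕ → ℕ → ℕ → ℕ) : Set (ℕ × ℕ) :=
  {z | z.1 < (L.n + 1) ^ L.k ∧ z.2 < L.base ^ L.k ∧ T z.1 z.2 0 ≠ 0}

/-- Overwriting an entry by a valid one preserves soundness and flags. -/
lemma Sound.write (hL : L.Valid) {T T' : ℕ → ℕ → ℕ → ℕ} {D : Set ℕ} {f a : ℕ} {col : ℕ → ℕ}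
    (hT : L.Sound T D) (hf : f < (L.n + 1) ^ L.k) (ha : a < L.base ^ L.k)
    (hw : ∀ u ≤ L.n, T' f a u = col u) (h0 : col 0 ≠ 0) (hg : L.Good D f col)
    (hwt : L.weight col = a)
    (ho : ∀ f' a' u, f' < (L.n + 1) ^ L.k → a' < L.base ^ L.k → u ≤ L.n → ¬ (f' = f ∧ a' = a) →
      T' f' a' u = T f' a' u) :
    L.Sound T' D ∧ L.flags T ⊆ L.flags T' ∧ (f, a) ∈ L.flags T' := by
  refine ⟨fun f' hf' a' ha' h => ?_, ?_, hf, ha, by rw [hw 0 (Nat.zero_le _)]; exact h0⟩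
  · by_cases he : f' = f ∧ a' = a
    · obtain ⟨rfl, rfl⟩ := he
      have e : ∀ u ∈ Finset.Icc 1 L.n, col u = T' f' a' u := fun u hu =>
        (hw u (Finset.mem_Icc.1 hu).2).symm
      exact ⟨hg.congr hL e, by rw [← weight_congr e, hwt]⟩
    · rw [ho f' a' 0 hf' ha' (Nat.zero_le _) he] at h
      obtain ⟨g1, g2⟩ := hT f' hf' a' ha' h
      have e : ∀ u ∈ Finset.Icc 1 L.n, T f' a' u = T' f' a' u := fun u hu =>
        (ho f' a' u hf' ha' (Finset.mem_Icc.1 hu).2 he).symm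
      exact ⟨g1.congr hL e, by rw [← weight_congr e, g2]⟩
  · rintro ⟨f', a'⟩ ⟨hf', ha', h⟩
    refine ⟨hf', ha', ?_⟩
    by_cases he : f' = f ∧ a' = a
    · obtain ⟨rfl, rfl⟩ := he
      dsimp only
      rw [hw 0 (Nat.zero_le _)]
      exact h0
    · dsimp only
      rw [ho f' a' 0 hf' ha' (Nat.zero_le _) he]
      exact h

lemma IsTable.mono {T : ℕ → ℕ → ℕ → ℕ} {D : Set ℕ} {v v' : ℕ} (h : L.IsTable T D v) (hv : v' ≤ v) :
    L.IsTable T D v' :=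
  ⟨h.sound, fun f hf hd => h.complete f hf fun c hc => (hd c hc).trans hv⟩

lemma IsTable.congr (hL : L.Valid) {T T' : ℕ → ℕ → ℕ → ℕ} {D : Set ℕ} {v : ℕ}
    (h : L.IsTable T D v) (e : ∀ f < (L.n + 1) ^ L.k, ∀ a < L.base ^ L.k, ∀ u ≤ L.n,
      T' f a u = T f a u) : L.IsTable T' D v where
  sound f hf a ha h0 := by
    rw [e f hf a ha 0 (Nat.zero_le _)] at h0
    have e' : ∀ u ∈ Finset.Icc 1 L.n, T f a u = T' f a u := fun u hu =>
      (e f hf a ha u (Finset.mem_Icc.1 hu).2).symm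
    have := h.sound f hf a ha h0
    exact ⟨this.1.congr hL e', by rw [← weight_congr e', this.2]⟩
  complete f hf hd col hg := by
    rw [e f hf _ (weight_lt hL hg.le) 0 (Nat.zero_le _)]
    exact h.complete f hf hd col hg

/-- The flag is all that has to be tested. The new code stays in range because it is the weight of
an actual coloring, and replacing an entry already present for the same tuple and code does no harm
by `Sound.write`. -/
lemma extendEntry_spec (hL : L.Valid) {D : Set ℕ} {w : ℕ} (hw : w ∈ Finset.Icc 1 L.n)
    (hD : ∀ u ∈ D, w < u) (hN : ∀ u ∈ D, ∀ y < w, L.R y u → L.R y w)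
    {s : State} (h : L.Env s) (hs : s.reg 19 = w) {T : ℕ → ℕ → ℕ → ℕ}
    (hT : L.tab (s.mem 7) (s.reg 21) = T) (hE : L.Sound T D) {f a c : ℕ} (hf : f < (L.n + 1) ^ L.k) (ha : a < L.base ^ L.k) (hc : c < L.k)
    (hsf : s.reg 11 = f) (hsa : s.reg 13 = a) (hsc : s.reg 15 = c)
    (hsx : s.reg 23 = dig (L.n + 1) f c) (hx : dig (L.n + 1) f c < w)
    (hxw : ¬ L.R (dig (L.n + 1) f c) w) :
    extendEntry.Collects 6 (fun m => L.Sound (L.tab m 0) (insert w D)) (fun m => L.flags (L.tab m 0)) s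
      {z | T (setDig (L.n + 1) f c w) a 0 ≠ 0 ∧ z = (f, a + L.p c w * L.base ^ c)} := by
  intro hI
  have hwn : w < L.n + 1 := by have := Finset.mem_Icc.1 hw; omega
  have e1 : placedE.eval s = setDig (L.n + 1) f c w := by
    simp [placedE, Expr.eval, Op.eval, setDig, hsf, hsx, hsc, hs, h.powN c hc.le]
  have e2 : raisedE.eval s = a + L.p c w * L.base ^ c := by
    simp [raisedE, Expr.eval, Op.eval, hsa, hsc, hs, h.n, h.profit c hc w hw, h.powB c hc.le]
  have hf' := setDig_lt hf hc hwn
  have e3 : (load 7 (cellE (reg 21) placedE (reg 13) (const 0))).eval s =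
      T (setDig (L.n + 1) f c w) a 0 := by
    rw [← hT, Expr.eval, h.eval_cellE, e1]
    simp [Expr.eval, hsa, tab]
  rw [extendEntry, run, e3]
  split_ifs with h0
  swap
  · exact ⟨hI, subset_rfl, fun z hz => absurd hz.1 h0⟩
  obtain ⟨g1, g2⟩ := hE _ hf' a ha h0
  obtain ⟨g3, g4⟩ := g1.extend hL hw hD hN hf hc hx hxw
  rw [g2] at g4
  have ha' : a + L.p c w * L.base ^ c < L.base ^ L.k := by
    rw [← g4]
    exact weight_lt hL g3.le
  set col := T (setDig (L.n + 1) f c w) a with hcol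
  set a' := a + L.p c w * L.base ^ c with ha'_def
  obtain ⟨k1, k2⟩ := fill (b := 6) (w := 0) h.N hf ha'
    (store 6 (cellE (const 0) (reg 11) raisedE (reg 12))
        (load 7 (cellE (reg 21) placedE (reg 13) (reg 12)))) col (by
    intro u hu s' hF hx _
    have h' := h.of_frame hF
    have e1' : placedE.eval s' = setDig (L.n + 1) f c w := by
      rw [← e1]
      simp [placedE, Expr.eval, Op.eval, hF.1 11 rfl, hF.1 23 rfl, hF.1 15 rfl, hF.1 19 rfl,
        hF.2 8 rfl]
    have e2' : raisedE.eval s' = a' := by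
      rw [← e2]
      simp [raisedE, Expr.eval, Op.eval, hF.1 13 rfl, hF.1 0 rfl, hF.1 15 rfl, hF.1 19 rfl,
        hF.2 1 rfl, hF.2 3 rfl, hF.2 9 rfl]
    rw [run, Expr.eval, h'.eval_cellE, h'.eval_cellE, e1', e2']
    simp [Expr.eval, hF.1 11 rfl, hF.1 21 rfl, hF.1 13 rfl, hF.2 7 rfl, hx, hsf, hsa, hcol, ← hT, tab])
  have hF := frame_run (loop 12 1 (store 6 (cellE (const 0) (reg 11) raisedE (reg 12))
        (load 7 (cellE (reg 21) placedE (reg 13) (reg 12))))) s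
  rw [run]
  set s₁ := (loop 12 1 (store 6 (cellE (const 0) (reg 11) raisedE (reg 12))
        (load 7 (cellE (reg 21) placedE (reg 13) (reg 12))))).run s
  have h₁ := h.of_frame hF
  have e2' : raisedE.eval s₁ = a' := by
    rw [← e2]
    simp [raisedE, Expr.eval, Op.eval, hF.1 13 rfl, hF.1 0 rfl, hF.1 15 rfl, hF.1 19 rfl,
      hF.2 1 rfl, hF.2 3 rfl, hF.2 9 rfl]
  have e4 : (store 6 (cellE (const 0) (reg 11) raisedE (reg 19))
      ((reg 15 +ₑ const 1) %ₑ (reg 2 +ₑ const 1))).run s₁ =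
      s₁.setMem 6 (L.cell 0 f a' w) (c + 1) := by
    rw [run, h₁.eval_cellE, e2']
    simp only [Expr.eval, Op.eval, hF.1 11 rfl, hF.1 19 rfl, hF.1 15 rfl, h₁.k, hsf, hsc, hs]
    -- The modulus `k + 1` has no effect on `c + 1`; it only keeps the stored expression flat.
    rw [Nat.mod_eq_of_lt (by omega)]
  rw [e4]
  have key := Sound.write hL hI hf ha' (T' := L.tab ((s₁.setMem 6 (L.cell 0 f a' w) (c + 1)).mem 6) 0)
    (col := Function.update col w (c + 1)) (fun u hu => ?_) ?_ g3 g4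
    (fun f' a'' u hf' ha'' hu hne => ?_)
  · exact ⟨key.1, key.2.1, fun z hz => by rw [hz.2]; exact key.2.2⟩
  · simp only [tab, State.setMem, Function.update_self]
    rcases eq_or_ne u w with rfl | hne
    · simp
    · rw [Function.update_of_ne hne, Function.update_of_ne]
      · exact k1 u hu
      · exact fun he => hne (cell_inj hf hf ha' ha' hu (by omega) he).2.2.2
  -- As `1 ≤ w`, recording the color of `w` does not overwrite the flag at `0`.
  · rw [Function.update_of_ne (by have := Finset.mem_Icc.1 hw; omega)]
    exact h0
  · simp only [tab, State.setMem, Function.update_self]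
    rw [Function.update_of_ne]
    · exact k2 0 f' a'' u hf' ha'' hu fun he => hne he.2
    · intro he
      obtain ⟨-, i1, i2, -⟩ := cell_inj hf' hf ha'' ha' hu (by omega) he
      exact hne ⟨i1, i2⟩

lemma extendColor_spec (hL : L.Valid) {D : Set ℕ} {w : ℕ} (hw : w ∈ Finset.Icc 1 L.n)
    (hD : ∀ u ∈ D, w < u) (hN : ∀ u ∈ D, ∀ y < w, L.R y u → L.R y w)
    {s : State} (h : L.Env s) (hs : s.reg 19 = w) {T : ℕ → ℕ → ℕ → ℕ}
    (hT : L.tab (s.mem 7) (s.reg 21) = T) (hE : L.Sound T D) {f c : ℕ}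
    (hf : f < (L.n + 1) ^ L.k) (hc : c < L.k) (hsf : s.reg 11 = f) (hsc : s.reg 15 = c) :
    extendColor.Collects 6 (fun m => L.Sound (L.tab m 0) (insert w D)) (fun m => L.flags (L.tab m 0)) s
      {z | dig (L.n + 1) f c < w ∧ ¬ L.R (dig (L.n + 1) f c) w ∧ ∃ a < L.base ^ L.k,
        z ∈ {z : ℕ × ℕ | T (setDig (L.n + 1) f c w) a 0 ≠ 0 ∧
          z = (f, a + L.p c w * L.base ^ c)}} := by
  intro hI
  have hwn : w < L.n + 1 := by have := Finset.mem_Icc.1 hw; omega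
  have er : ((reg 11 /ₑ load 8 (reg 15)) %ₑ reg 1).eval s = dig (L.n + 1) f c := by
    simp [Expr.eval, Op.eval, hsf, hsc, h.powN c hc.le, h.N, dig]
  rw [extendColor, run, run, er]
  set s₁ := s.setReg 23 (dig (L.n + 1) f c) with hs₁
  have hF : (assign 23 (const 0)).Frame s s₁ := by
    refine ⟨fun z hz => ?_, fun z hz => rfl⟩
    have : z ≠ 23 := by rintro rfl; simp [wr] at hz
    simp [hs₁, State.setReg, this]
  have h₁ := h.of_frame hF
  have r23 : s₁.reg 23 = dig (L.n + 1) f c := by simp [hs₁, State.setReg]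
  have r19 : s₁.reg 19 = w := by rw [hF.1 19 rfl, hs]
  have hI₁ : L.Sound (L.tab (s₁.mem 6) 0) (insert w D) := hI
  have e1 : (reg 23 <ₑ reg 19).eval s₁ ≠ 0 ↔ dig (L.n + 1) f c < w := by
    simp [Expr.eval, Op.eval, r23, r19]
  have e2 : ((const 0 <ₑ reg 23) *ₑ load 0 (load 3 (reg 19) *ₑ reg 0 +ₑ load 3 (reg 23))).eval s₁ ≠
      0 ↔ L.R (dig (L.n + 1) f c) w := by
    simp only [Expr.eval, Op.eval, r23, r19, h₁.n, mul_ne_zero_iff]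
    rcases Nat.eq_zero_or_pos (dig (L.n + 1) f c) with h0 | h0
    · simp only [h0, lt_irrefl, if_false, ne_eq, not_true, false_and, false_iff]
      intro hr
      have := (hL.range hr).1
      omega
    · rw [h₁.adj _ (Finset.mem_Icc.2 ⟨h0, Nat.lt_succ_iff.1 (dig_lt (Nat.succ_pos _) _ _)⟩) _ hw]
      simp [h0]
  rw [run]
  split_ifs with hlt
  swap
  · exact ⟨hI, subset_rfl, fun z hz => absurd (e1.2 hz.1) hlt⟩
  rw [run]
  split_ifs with hR
  · exact ⟨hI, subset_rfl, fun z hz => absurd (e2.1 hR) hz.2.1⟩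
  obtain ⟨k1, k2, k3⟩ := Prog.Collects.loop (x := 13) (y := 4) (P := extendEntry) (s := s₁) (b := 6)
    (Inv := fun m => L.Sound (L.tab m 0) (insert w D)) (Fl := fun m => L.flags (L.tab m 0)) _
    (fun a ha s₂ hF₂ hx₂ => extendEntry_spec hL hw hD hN (h₁.of_frame hF₂)
      (by rw [hF₂.1 19 rfl, r19]) (T := T) (by rw [hF₂.1 21 rfl, hF₂.2 7 rfl]; exact hT) hE
      hf (by rwa [h₁.M] at ha) hc (by rw [hF₂.1 11 rfl, hF.1 11 rfl, hsf]) hx₂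
      (by rw [hF₂.1 15 rfl, hF.1 15 rfl, hsc]) (by rw [hF₂.1 23 rfl, r23]) (e1.1 hlt)
      (fun hr => hR (e2.2 hr))) hI₁
  rw [h₁.M] at k3
  exact ⟨k1, k2, fun z hz => k3 hz.2.2⟩

/-- Colorings are read from bank `7`, where the table of `D` remains unchanged, and written into the
working copy in bank `6`, so none is extended by `w` twice. A coloring that leaves `w` out is
already in the copy; any other one comes from the entry that `Good.restrict` points to. That entry
may carry the digit `w`, which is why completeness up to `w` yields completeness up to `w - 1` only.
-/
lemma extend_spec (hL : L.Valid) {D : Set ℕ} {w : ℕ} (hw : w ∈ Finset.Icc 1 L.n)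
    (hD : ∀ u ∈ D, w < u) (hN : ∀ u ∈ D, ∀ y < w, L.R y u → L.R y w)
    {s : State} (h : L.Env s) (hs : s.reg 19 = w) (hE : L.IsTable (L.tab (s.mem 7) (s.reg 21)) D w)
    (hS : ∀ f < (L.n + 1) ^ L.k, ∀ a < L.base ^ L.k, ∀ u ≤ L.n,
      L.tab (s.mem 6) 0 f a u = L.tab (s.mem 7) (s.reg 21) f a u) :
    L.IsTable (L.tab ((extendProg.run s).mem 6) 0) (insert w D) (w - 1) := by
  have hS' := hE.congr hL hS
  have hwn : w < L.n + 1 := by have := Finset.mem_Icc.1 hw; omega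
  have hw1 : 1 ≤ w := (Finset.mem_Icc.1 hw).1
  have h0 : L.Sound (L.tab (s.mem 6) 0) (insert w D) := fun f hf a ha h0 =>
    ⟨(hS'.sound f hf a ha h0).1.mono (Set.subset_insert _ _), (hS'.sound f hf a ha h0).2⟩
  obtain ⟨k1, k2, k3⟩ := Prog.Collects.loop (x := 11) (y := 3) (P := loop 15 2 extendColor) (s := s)
    (b := 6) (Inv := fun m => L.Sound (L.tab m 0) (insert w D)) (Fl := fun m => L.flags (L.tab m 0))
    (fun f => {z | ∃ c < s.reg 2, z ∈ {z | dig (L.n + 1) f c < w ∧ ¬ L.R (dig (L.n + 1) f c) w ∧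
      ∃ a < L.base ^ L.k, z ∈ {z : ℕ × ℕ |
        L.tab (s.mem 7) (s.reg 21) (setDig (L.n + 1) f c w) a 0 ≠ 0 ∧
          z = (f, a + L.p c w * L.base ^ c)}}}) (by
    intro f hf s₁ hF₁ hx₁
    have h₁ := h.of_frame hF₁
    rw [h.K] at hf
    rw [← hF₁.1 2 rfl]
    refine Prog.Collects.loop _ fun c hc s₂ hF₂ hx₂ => ?_
    rw [h₁.k] at hc
    exact extendColor_spec hL hw hD hN (h₁.of_frame hF₂) (by rw [hF₂.1 19 rfl, hF₁.1 19 rfl, hs])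
      (by rw [hF₂.1 21 rfl, hF₁.1 21 rfl, hF₂.2 7 rfl, hF₁.2 7 rfl]) hE.sound hf hc
      (by rw [hF₂.1 11 rfl, hx₁]) hx₂) h0
  refine ⟨k1, fun f hf hd col hg => ?_⟩
  rcases Nat.eq_zero_or_pos (col w) with hc0 | hc0
  · have hg' : L.Good D f col := ⟨hg.le, fun u hu hcu => (hg.mem u hu hcu).resolve_left
      (by rintro rfl; exact hcu hc0), hg.proper, hg.avoid⟩
    exact (k2 (a := (f, L.weight col)) ⟨hf, weight_lt hL hg.le,
      hS'.complete f hf (fun c hc => (hd c hc).trans (Nat.sub_le _ _)) col hg'⟩).2.2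
  · obtain ⟨c, hc⟩ : ∃ c, col w = c + 1 := ⟨col w - 1, by omega⟩
    have hck : c < L.k := by have := hg.le w hw; omega
    obtain ⟨g1, g2, g3⟩ := hg.restrict hw hf hc
    have hfl := hE.complete _ (setDig_lt hf hck hwn) (fun j hj => by
      rw [dig_setDig hf hck hwn hj]
      split_ifs
      · exact le_rfl
      · exact (hd j hj).trans (Nat.sub_le _ _)) _ g2
    refine (k3 (a := (f, L.weight col)) ⟨f, by rwa [h.K], c, by rwa [h.k], ?_, g1,
      _, weight_lt hL g2.le, hfl, by rw [g3]⟩).2.2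
    have := hd c hck
    omega

/-- One source, the table `x`, lies in the same bank as the target `w`. The invariant therefore also
records that all tables other than `w` keep their original contents `T'`. -/
lemma mergeEntry_spec (hL : L.Valid) {D D' : Set ℕ} {w x : ℕ} (hwx : w ≠ x)
    (hd : ∀ u ∈ D, ∀ v ∈ D', u ≠ v ∧ ¬ L.R u v)
    {s : State} (h : L.Env s) (hs : s.reg 19 = w) (hs' : s.reg 22 = x) {T T₀ : ℕ → ℕ → ℕ → ℕ}
    {T' : ℕ → ℕ → ℕ → ℕ → ℕ} (hT : L.tab (s.mem 6) 0 = T) (hT₀ : T' x = T₀) (hE : L.Sound T D)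
    (hE' : L.Sound T₀ D') {f a b : ℕ} (hf : f < (L.n + 1) ^ L.k) (ha : a < L.base ^ L.k)
    (hb : b < L.base ^ L.k) (hsf : s.reg 11 = f) (hsa : s.reg 13 = a) (hsb : s.reg 14 = b) :
    mergeEntry.Collects 7 (fun m => L.Sound (L.tab m w) (D ∪ D') ∧
        ∀ w' f a u, w' ≠ w → f < (L.n + 1) ^ L.k → a < L.base ^ L.k → u ≤ L.n →
          L.tab m w' f a u = T' w' f a u) (fun m => L.flags (L.tab m w)) s
      {z | T f a 0 ≠ 0 ∧ T₀ f b 0 ≠ 0 ∧ z = (f, a + b)} := by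
  rintro ⟨hI, hrow⟩
  have e1 : (load 6 (cellE (const 0) (reg 11) (reg 13) (const 0)) *ₑ
      load 7 (cellE (reg 22) (reg 11) (reg 14) (const 0))).eval s = T f a 0 * T₀ f b 0 := by
    simp only [Expr.eval, Op.eval, h.eval_cellE, hsf, hsa, hsb, hs', ← hT, ← hT₀]
    rw [← hrow x f b 0 hwx.symm hf hb (Nat.zero_le _)]
    rfl
  rw [mergeEntry, run, e1]
  split_ifs with h0
  swap
  · exact ⟨⟨hI, hrow⟩, subset_rfl, fun z hz => absurd (mul_ne_zero hz.1 hz.2.1) h0⟩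
  rw [mul_ne_zero_iff] at h0
  obtain ⟨g1, g2⟩ := hE f hf a ha h0.1
  obtain ⟨g1', g2'⟩ := hE' f hf b hb h0.2
  obtain ⟨g3, g4⟩ := g1.merge hL hd g1'
  rw [g2, g2'] at g4
  have hab : a + b < L.base ^ L.k := by
    rw [← g4]
    exact weight_lt hL g3.le
  obtain ⟨k1, k2⟩ := fill (s := s) (b := 7) (w := w) h.N hf hab
    (ite (load 6 (cellE (const 0) (reg 11) (reg 13) (reg 12)))
      (store 7 (cellE (reg 19) (reg 11) (reg 13 +ₑ reg 14) (reg 12))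
        (load 6 (cellE (const 0) (reg 11) (reg 13) (reg 12))))
      (store 7 (cellE (reg 19) (reg 11) (reg 13 +ₑ reg 14) (reg 12))
        (load 7 (cellE (reg 22) (reg 11) (reg 14) (reg 12))))) (Layout.merge (T f a) (T₀ f b)) (by
    intro u hu s' hF hx ho
    have h' := h.of_frame hF
    have e2 : (load 6 (cellE (const 0) (reg 11) (reg 13) (reg 12))).eval s' = T f a u := by
      simp only [Expr.eval, h'.eval_cellE, hF.1 11 rfl, hF.1 13 rfl, hF.2 6 rfl, hx, hsf, hsa, ← hT]
      rfl
    have e3 : (load 7 (cellE (reg 22) (reg 11) (reg 14) (reg 12))).eval s' = T₀ f b u := by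
      simp only [Expr.eval, h'.eval_cellE, hF.1 11 rfl, hF.1 14 rfl, hF.1 22 rfl, hx, hsf, hsb, hs',
        ← hT₀]
      rw [← hrow x f b u hwx.symm hf hb hu, ← ho x f b u hf hb hu fun e => hwx e.1.symm]
      rfl
    have e4 : (cellE (reg 19) (reg 11) (reg 13 +ₑ reg 14) (reg 12)).eval s' = L.cell w f (a + b) u := by
      simp only [Expr.eval, Op.eval, h'.eval_cellE, hF.1 11 rfl, hF.1 13 rfl, hF.1 14 rfl,
        hF.1 19 rfl, hx, hsf, hsa, hsb, hs]
    rw [run, run, run, e2, e3, e4, Layout.merge]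
    split_ifs <;> rfl)
  have key := Sound.write hL hI hf hab k1 (by rw [Layout.merge, if_pos h0.1]; exact h0.1) g3 g4
    fun f' a' u hf' ha' hu hne => k2 w f' a' u hf' ha' hu fun e => hne e.2
  refine ⟨⟨key.1, fun w' f' a' u hne hf' ha' hu => ?_⟩, key.2.1, ?_⟩
  · rw [← hrow w' f' a' u hne hf' ha' hu]
    exact k2 w' f' a' u hf' ha' hu fun e => hne e.1
  · rintro z ⟨-, -, rfl⟩
    exact key.2.2

/-- All pairs of codes are tried, and `Good.split` supplies the pair that produces a given coloring.
The target has no flags at the beginning, hence is sound for trivial reasons. -/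
lemma merge_spec (hL : L.Valid) {D D' : Set ℕ} {v w x : ℕ} (hwx : w ≠ x)
    (hd : ∀ u ∈ D, ∀ v ∈ D', u ≠ v ∧ ¬ L.R u v)
    {s : State} (h : L.Env s) (hs : s.reg 19 = w) (hs' : s.reg 22 = x)
    (hE : L.IsTable (L.tab (s.mem 6) 0) D v) (hE' : L.IsTable (L.tab (s.mem 7) x) D' v)
    (h0 : ∀ f < (L.n + 1) ^ L.k, ∀ a < L.base ^ L.k, L.tab (s.mem 7) w f a 0 = 0) :
    L.IsTable (L.tab ((mergeProg.run s).mem 7) w) (D ∪ D') v ∧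
      ∀ w' f a u, w' ≠ w → f < (L.n + 1) ^ L.k → a < L.base ^ L.k → u ≤ L.n →
        L.tab ((mergeProg.run s).mem 7) w' f a u = L.tab (s.mem 7) w' f a u := by
  obtain ⟨k1, k2, k3⟩ := Prog.Collects.loop (x := 11) (y := 3) (P := loop 13 4 (loop 14 4 mergeEntry))
    (s := s) (b := 7) (Inv := fun m => L.Sound (L.tab m w) (D ∪ D') ∧
        ∀ w' f a u, w' ≠ w → f < (L.n + 1) ^ L.k → a < L.base ^ L.k → u ≤ L.n →
          L.tab m w' f a u = L.tab (s.mem 7) w' f a u) (Fl := fun m => L.flags (L.tab m w))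
    (fun f => {z | ∃ a < s.reg 4, z ∈ {z | ∃ b < s.reg 4, z ∈ {z : ℕ × ℕ |
      L.tab (s.mem 6) 0 f a 0 ≠ 0 ∧ L.tab (s.mem 7) x f b 0 ≠ 0 ∧ z = (f, a + b)}}}) (by
    intro f hf s₁ hF₁ hx₁
    have h₁ := h.of_frame hF₁
    rw [← hF₁.1 4 rfl]
    refine Prog.Collects.loop _ fun a ha s₂ hF₂ hx₂ => ?_
    rw [← hF₂.1 4 rfl]
    refine Prog.Collects.loop _ fun b hb s₃ hF₃ hx₃ => ?_
    rw [h.K] at hf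
    have h₂ := h₁.of_frame hF₂
    rw [h₁.M] at ha
    rw [h₂.M] at hb
    exact mergeEntry_spec hL hwx hd (h₂.of_frame hF₃)
      (by rw [hF₃.1 19 rfl, hF₂.1 19 rfl, hF₁.1 19 rfl, hs])
      (by rw [hF₃.1 22 rfl, hF₂.1 22 rfl, hF₁.1 22 rfl, hs'])
      (by rw [hF₃.2 6 rfl, hF₂.2 6 rfl, hF₁.2 6 rfl]) rfl hE.sound hE'.sound hf ha hb
      (by rw [hF₃.1 11 rfl, hF₂.1 11 rfl, hx₁]) (by rw [hF₃.1 13 rfl, hx₂]) hx₃)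
    ⟨fun f hf a ha hn => absurd (h0 f hf a ha) hn, fun _ _ _ _ _ _ _ _ => rfl⟩
  refine ⟨⟨k1.1, fun f hf hdig col hg => ?_⟩, k1.2⟩
  obtain ⟨c₁, c₂, g₁, g₂, e⟩ := hg.split
  refine (k3 (a := (f, L.weight col)) ⟨f, by rwa [h.K], L.weight c₁, ?_, L.weight c₂, ?_,
    hE.complete f hf hdig c₁ g₁, hE'.complete f hf hdig c₂ g₂, by rw [e]⟩).2.2
  · rw [h.M]; exact weight_lt hL g₁.le
  · rw [h.M]; exact weight_lt hL g₂.le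

end Layout

/-! ### The main loop: parents, one step, and the initial table. -/

namespace Layout

variable {L : Layout}

/-- Scanning upwards and overwriting leaves the largest earlier neighbour, or `0`. The position `0`
has to be excluded in the test, because it stands for no vertex. -/
lemma parent_spec (hL : L.Valid) {s : State} (h : L.Env s) {w : ℕ} (hw : w ∈ Finset.Icc 1 L.n)
    (hs : s.reg 19 = w) :
    (parentProg.run s).reg 20 < w ∧
      ((parentProg.run s).reg 20 = 0 ∨ L.R ((parentProg.run s).reg 20) w) ∧
      ∀ x, (parentProg.run s).reg 20 < x → x < w → ¬ L.R x w := by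
  have hw' := Finset.mem_Icc.1 hw
  rw [parentProg, run]
  have hF₀ := frame_run (assign 20 (const 0)) s
  have h20 : ((assign 20 (const 0)).run s).reg 20 = 0 := by simp [run, State.setReg, Expr.eval]
  set s₀ := (assign 20 (const 0)).run s
  have h₀ := h.of_frame hF₀
  have := loop_induction (x := 11) (y := 1) (s := s₀) (P := ite ((const 0 <ₑ reg 11) *ₑ
      (reg 11 <ₑ reg 19) *ₑ load 0 (load 3 (reg 19) *ₑ reg 0 +ₑ load 3 (reg 11)))
        (assign 20 (reg 11)) skip)
    (fun i s' => s'.reg 20 < w ∧ (s'.reg 20 = 0 ∨ L.R (s'.reg 20) w) ∧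
      ∀ x, s'.reg 20 < x → x < w → x < i → ¬ L.R x w) ?_ ?_
  · rw [h₀.N] at this
    exact ⟨this.1, this.2.1, fun x hx hxw => this.2.2 x hx hxw (by omega)⟩
  · simp only [State.setReg, Function.update_apply, h20]
    refine ⟨?_, by simp, fun x _ _ hx => by omega⟩
    simp only [Nat.reduceEqDiff, if_false]
    omega
  · rintro i hi s' hF hx ⟨i1, i2, i3⟩
    have h' := h₀.of_frame hF
    have e : ((const 0 <ₑ reg 11) *ₑ (reg 11 <ₑ reg 19) *ₑ
        load 0 (load 3 (reg 19) *ₑ reg 0 +ₑ load 3 (reg 11))).eval s' ≠ 0 ↔ i < w ∧ L.R i w := by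
      simp only [Expr.eval, Op.eval, hx, h'.n, hF.1 19 rfl, hF₀.1 19 rfl, hs, mul_ne_zero_iff]
      rcases Nat.eq_zero_or_pos i with h0 | h0
      · simp only [h0, lt_irrefl, if_false, ne_eq, not_true, false_and, false_iff, not_and]
        intro _ hr
        have := (hL.range hr).1
        omega
      · by_cases hlt : i < w
        · rw [h'.adj _ (Finset.mem_Icc.2 ⟨h0, by omega⟩) _ hw]
          simp [h0, hlt]
        · simp [hlt]
    rw [run]
    split_ifs with hc
    · have hc' := e.1 hc
      simp only [run, State.setReg, Function.update_apply, Expr.eval, hx, Nat.reduceEqDiff, if_false,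
        if_true]
      exact ⟨hc'.1, Or.inr hc'.2, fun x hx1 hx2 hx3 => by omega⟩
    · simp only [run, State.setReg, Function.update_apply, Nat.reduceEqDiff, if_false]
      refine ⟨i1, i2, fun x hx1 hx2 hx3 hr => ?_⟩
      rcases Nat.lt_succ_iff_lt_or_eq.1 hx3 with h4 | rfl
      · exact i3 x hx1 hx2 h4 hr
      · exact hc (e.2 ⟨hx2, hr⟩)

variable (L) in
/-- The state of the dynamic program when the positions larger than `m` are processed. -/
structure Progress (m : ℕ) (s : State) : Prop where
  tables : ∃ D, L.Family m D ∧ ∀ v ≤ m, L.IsTable (L.tab (s.mem 7) (s.mem 5 v)) (D v) v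
  head : ∀ v ≤ m, s.mem 5 v = 0 ∨ m < s.mem 5 v
  fresh : ∀ w, 1 ≤ w → w ≤ m → ∀ f < (L.n + 1) ^ L.k, ∀ a < L.base ^ L.k,
    L.tab (s.mem 7) w f a 0 = 0

/-- Bank `5` tells which table belongs to a position. The merged table is built at the unused index
`w`, and only the entry of the parent is redirected to it. All tables in use have index `0` or an
index larger than `w`, so they are not disturbed. -/
lemma position_spec (hL : L.Valid) {s : State} (h : L.Env s) {w : ℕ} (hw : w ∈ Finset.Icc 1 L.n)
    (hs : s.reg 10 = L.n - w) (hp : L.Progress w s) : L.Progress (w - 1) (positionProg.run s) := by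
  have hw' := Finset.mem_Icc.1 hw
  obtain ⟨⟨D, hD, hT⟩, hh, hfr⟩ := hp
  simp only [positionProg, run]
  have e₁ : s.setReg 19 ((reg 0 -ₑ reg 10).eval s) = s.setReg 19 w := by
    simp only [Expr.eval, Op.eval, h.n, hs]
    congr 1
    omega
  rw [e₁]
  have hF₁ : (assign 19 (const 0)).Frame s (s.setReg 19 w) := by
    refine ⟨fun z hz => ?_, fun z hz => rfl⟩
    have : z ≠ 19 := by rintro rfl; simp [wr] at hz
    simp [State.setReg, this]
  have r₁ : (s.setReg 19 w).reg 19 = w := by simp [State.setReg]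
  set s₁ := s.setReg 19 w
  have h₁ := h.of_frame hF₁
  obtain ⟨p1, p2, p3⟩ := parent_spec hL h₁ hw r₁
  have hF₂ := frame_run parentProg s₁
  set s₂ := parentProg.run s₁
  have h₂ := h₁.of_frame hF₂
  set v := s₂.reg 20 with hv
  have m5₂ : s₂.mem 5 = s.mem 5 := by rw [hF₂.2 5 rfl, hF₁.2 5 rfl]
  have m7₂ : s₂.mem 7 = s.mem 7 := by rw [hF₂.2 7 rfl, hF₁.2 7 rfl]
  have e₃ : (load 5 (reg 19)).eval s₂ = s.mem 5 w := by
    simp only [Expr.eval, m5₂, hF₂.1 19 rfl, r₁]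
  rw [e₃]
  have hF₃ : (assign 21 (const 0)).Frame s₂ (s₂.setReg 21 (s.mem 5 w)) := by
    refine ⟨fun z hz => ?_, fun z hz => rfl⟩
    have : z ≠ 21 := by rintro rfl; simp [wr] at hz
    simp [State.setReg, this]
  have r₃ : (s₂.setReg 21 (s.mem 5 w)).reg 21 = s.mem 5 w := by simp [State.setReg]
  set s₃ := s₂.setReg 21 (s.mem 5 w)
  have h₃ := h₂.of_frame hF₃
  have hc := copy_spec h₃
  have hF₄ := frame_run copyProg s₃
  set s₄ := copyProg.run s₃
  have h₄ := h₃.of_frame hF₄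
  have m7₄ : s₄.mem 7 = s.mem 7 := by rw [hF₄.2 7 rfl, hF₃.2 7 rfl, m7₂]
  have r21₄ : s₄.reg 21 = s.mem 5 w := by rw [hF₄.1 21 rfl, r₃]
  have r19₄ : s₄.reg 19 = w := by rw [hF₄.1 19 rfl, hF₃.1 19 rfl, hF₂.1 19 rfl, r₁]
  obtain ⟨q1, q2, q3, q4⟩ := hD.step hL hw'.2 p1 p2 p3
  have hx := extend_spec hL hw q3 q4 h₄ r19₄ (by rw [r21₄, m7₄]; exact hT w le_rfl)
    (fun f hf a ha u hu => by rw [hc f a u hf ha hu, r21₄, r₃, m7₄, hF₃.2 7 rfl, m7₂])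
  have hF₅ := frame_run extendProg s₄
  set s₅ := extendProg.run s₄
  have h₅ := h₄.of_frame hF₅
  have r20₅ : s₅.reg 20 = v := by rw [hF₅.1 20 rfl, hF₄.1 20 rfl, hF₃.1 20 rfl]
  have m5₅ : s₅.mem 5 = s.mem 5 := by rw [hF₅.2 5 rfl, hF₄.2 5 rfl, hF₃.2 5 rfl, m5₂]
  have e₆ : (load 5 (reg 20)).eval s₅ = s.mem 5 v := by
    simp only [Expr.eval, m5₅, r20₅]
  rw [e₆]
  have hF₆ : (assign 22 (const 0)).Frame s₅ (s₅.setReg 22 (s.mem 5 v)) := by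
    refine ⟨fun z hz => ?_, fun z hz => rfl⟩
    have : z ≠ 22 := by rintro rfl; simp [wr] at hz
    simp [State.setReg, this]
  have r₆ : (s₅.setReg 22 (s.mem 5 v)).reg 22 = s.mem 5 v := by simp [State.setReg]
  set s₆ := s₅.setReg 22 (s.mem 5 v)
  have h₆ := h₅.of_frame hF₆
  have m7₆ : s₆.mem 7 = s.mem 7 := by rw [hF₆.2 7 rfl, hF₅.2 7 rfl, m7₄]
  have r19₆ : s₆.reg 19 = w := by rw [hF₆.1 19 rfl, hF₅.1 19 rfl, r19₄]
  have hne : w ≠ s.mem 5 v := by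
    rcases hh v p1.le with h0 | h0 <;> omega
  obtain ⟨k1, k2⟩ := merge_spec (v := v) hL hne q2 h₆ r19₆ r₆
    (by rw [hF₆.2 6 rfl]; exact hx.mono (by omega))
    (by rw [m7₆]; exact hT v p1.le) (by rw [m7₆]; exact hfr w hw'.1 le_rfl)
  have hF₇ := frame_run mergeProg s₆
  set s₇ := mergeProg.run s₆
  rw [m7₆] at k2
  have r20₇ : s₇.reg 20 = v := by rw [hF₇.1 20 rfl, hF₆.1 20 rfl, r20₅]
  have r19₇ : s₇.reg 19 = w := by rw [hF₇.1 19 rfl, r19₆]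
  have m5₇ : s₇.mem 5 = s.mem 5 := by rw [hF₇.2 5 rfl, hF₆.2 5 rfl, m5₅]
  have m5 : (s₇.setMem 5 ((reg 20).eval s₇) ((reg 19).eval s₇)).mem 5 =
      Function.update (s.mem 5) v w := by
    simp [State.setMem, Expr.eval, r20₇, r19₇, m5₇]
  have m7 : (s₇.setMem 5 ((reg 20).eval s₇) ((reg 19).eval s₇)).mem 7 = s₇.mem 7 := by
    simp [State.setMem]
  refine ⟨⟨_, q1, fun x hx => ?_⟩, fun x hx => ?_, fun x hx1 hx2 f hf a ha => ?_⟩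
  · rw [m5, m7]
    rcases eq_or_ne x v with e | hxv
    · rw [e, Function.update_self, Function.update_self]
      exact k1
    · rw [Function.update_of_ne hxv, Function.update_of_ne hxv]
      refine (hT x (by omega)).congr hL fun f hf a ha u hu => k2 _ f a u ?_ hf ha hu
      rcases hh x (by omega) with h0 | h0 <;> omega
  · rw [m5]
    rcases eq_or_ne x v with e | hxv
    · rw [e, Function.update_self]
      omega
    · rw [Function.update_of_ne hxv]
      have := hh x (by omega)
      omega
  · rw [m7, k2 _ f a 0 (by omega) hf ha (Nat.zero_le _)]
    exact hfr x hx1 (by omega) f hf a ha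

/-- All blocks are empty and share the table `0`, in which exactly the code `0` is flagged for every
tuple. This table is never a target of a merge. -/
lemma init_spec (hL : L.Valid) {s : State} (h : L.Env s) (h5 : ∀ x, s.mem 5 x = 0)
    (h7 : ∀ x, s.mem 7 x = 0) : L.Progress L.n (initProg.run s) := by
  have key := loop_induction (x := 11) (y := 3) (s := s)
    (P := store 7 (cellE (const 0) (reg 11) (const 0) (const 0)) (const 1))
    (fun i s' => ∀ w f a u, f < (L.n + 1) ^ L.k → a < L.base ^ L.k → u ≤ L.n →
      L.tab (s'.mem 7) w f a u = if w = 0 ∧ f < i ∧ a = 0 ∧ u = 0 then 1 else 0)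
    (fun w f a u _ _ _ => by simp [State.setReg, tab, h7]) (by
    intro i hi s' hF hx ih w f a u hf ha hu
    rw [h.K] at hi
    have h' := h.of_frame hF
    simp only [run, h'.eval_cellE, Expr.eval, hx, State.setReg, State.setMem, Function.update_self,
      tab]
    rw [Function.update_apply]
    have hM : 0 < L.base ^ L.k := by omega
    split_ifs with h1 h2 h2
    · rfl
    · obtain ⟨rfl, rfl, rfl, rfl⟩ := cell_inj hf hi ha hM hu (Nat.zero_le _) h1
      exact absurd ⟨rfl, by omega, rfl, rfl⟩ h2
    · have := ih w f a u hf ha hu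
      rw [tab] at this
      rw [this, if_pos]
      refine ⟨h2.1, lt_of_le_of_ne (by omega) ?_, h2.2.2⟩
      rintro rfl
      obtain ⟨rfl, -, rfl, rfl⟩ := h2
      exact h1 rfl
    · have := ih w f a u hf ha hu
      rw [tab] at this
      rw [this, if_neg fun h3 => h2 ⟨h3.1, by omega, h3.2.2⟩])
  rw [h.K] at key
  have hF := frame_run initProg s
  have m5 : ∀ x, (initProg.run s).mem 5 x = 0 := fun x => by rw [hF.2 5 rfl, h5]
  refine ⟨⟨_, family_init, fun v hv => ⟨fun f hf a ha h0 => ?_, fun f hf _ col hg => ?_⟩⟩,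
    fun v _ => Or.inl (m5 v), fun w hw1 hw2 f hf a ha => ?_⟩
  · rw [m5] at h0 ⊢
    have h1 := key 0 f a 0 hf ha (Nat.zero_le _)
    rw [initProg] at h0
    rw [h1] at h0
    have ha0 : a = 0 := by
      by_contra hne
      simp [hne] at h0
    have hz : ∀ u ∈ Finset.Icc 1 L.n, L.tab ((initProg.run s).mem 7) 0 f a u = 0 := fun u hu => by
      have := Finset.mem_Icc.1 hu
      rw [initProg, key 0 f a u hf ha this.2, if_neg (by omega)]
    refine ⟨⟨fun u hu => by rw [hz u hu]; exact Nat.zero_le _, fun u hu hn => absurd (hz u hu) hn,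
      fun u v huv hn => absurd (hz u (Finset.mem_Icc.2 (hL.range huv))) hn,
      fun c _ u hu hc => by rw [hz u hu] at hc; omega⟩, ?_⟩
    refine (Finset.sum_eq_zero fun u hu => ?_).trans ha0.symm
    rw [hz u hu, gain, if_pos rfl]
  · have hw0 : L.weight col = 0 := by
      refine Finset.sum_eq_zero fun u hu => ?_
      have : col u = 0 := by
        by_contra hne
        exact hg.mem u hu hne
      rw [this, gain, if_pos rfl]
    have hlt := weight_lt hL hg.le
    rw [m5, initProg, key 0 f _ 0 hf hlt (Nat.zero_le _), hw0]
    simp [hf]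
  · rw [initProg, key w f a 0 hf ha (Nat.zero_le _), if_neg (by omega)]

/-- When the loop ends, `0` is the only unprocessed position, so its block covers all vertices. -/
lemma table_spec (hL : L.Valid) {s : State} (h : L.Env s) (h5 : ∀ x, s.mem 5 x = 0)
    (h7 : ∀ x, s.mem 7 x = 0) : ∃ D : Set ℕ, (∀ u ∈ Finset.Icc 1 L.n, u ∈ D) ∧
      L.IsTable (L.tab ((tableProg.run s).mem 7) ((tableProg.run s).mem 5 0)) D 0 := by
  have hF := frame_run initProg s
  have h₁ := h.of_frame hF
  have hi := init_spec hL h h5 h7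
  have := loop_induction (x := 10) (y := 0) (P := positionProg) (s := initProg.run s)
    (fun i s' => L.Progress (L.n - i) s') ⟨hi.tables, hi.head, hi.fresh⟩ (by
    intro i hi s' hF' hx hp
    rw [h₁.n] at hi
    have := position_spec hL (h₁.of_frame hF') (w := L.n - i) (Finset.mem_Icc.2 ⟨by omega, by omega⟩)
      (by omega) hp
    rw [show L.n - (i + 1) = L.n - i - 1 by omega]
    exact ⟨this.tables, this.head, this.fresh⟩)
  rw [h₁.n, Nat.sub_self] at this
  obtain ⟨⟨D, hD, hT⟩, -, -⟩ := this
  refine ⟨D 0, fun u hu => ?_, hT 0 le_rfl⟩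
  obtain ⟨v, hv, hu'⟩ := hD.cover u (by have := Finset.mem_Icc.1 hu; omega) (Finset.mem_Icc.1 hu).2
  obtain rfl : v = 0 := by omega
  exact hu'

end Layout

/-! ### The search order

The search visits next a vertex with a maximal number of visited neighbours. -/

/-- Count the visited neighbours of the vertex in register `11`. -/
def countProg : Prog :=
  loop 12 0 (ite (load 4 (reg 12) *ₑ load 0 (reg 11 *ₑ reg 0 +ₑ reg 12))
    (assign 18 ((reg 18 +ₑ const 1) %ₑ (reg 1 +ₑ const 1))) skip)

/-- Select an unvisited vertex with a maximal number of visited neighbours. -/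
def selectProg : Prog :=
  loop 11 0 (ite (load 4 (reg 11)) skip
    (seq (assign 18 (const 1)) (seq countProg
      (ite (reg 16 <ₑ reg 18) (seq (assign 16 (reg 18)) (assign 17 (reg 11))) skip))))

/-- Visit one vertex. -/
def visitProg : Prog :=
  seq (assign 16 (const 0)) <| seq (assign 17 (const 0)) <| seq selectProg <|
  seq (store 3 (reg 10 +ₑ const 1) (reg 17)) (store 4 (reg 17) (const 1))

/-- Compute the search order. -/
def searchProg : Prog := loop 10 0 visitProg

/-- The number of neighbours `u` of `v` with `vis u`. -/
noncomputable def score (n : ℕ) (adj : ℕ → ℕ) (vis : ℕ → Prop) (v : ℕ) : ℕ :=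
  open Classical in ((Finset.range n).filter fun u => vis u ∧ adj (v * n + u) ≠ 0).card

lemma score_congr {n : ℕ} {adj : ℕ → ℕ} {vis vis' : ℕ → Prop} (h : ∀ u, vis u ↔ vis' u) (v : ℕ) :
    score n adj vis v = score n adj vis' v := by
  rw [show vis = vis' from funext fun u => propext (h u)]

lemma count_spec {s : State} {n : ℕ} (hn : s.reg 0 = n) (hN : s.reg 1 = n + 1)
    (h18 : s.reg 18 = 1) :
    (countProg.run s).reg 18 = 1 + score n (s.mem 0) (fun u => s.mem 4 u ≠ 0) (s.reg 11) := by
  classical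
  have := loop_induction (x := 12) (y := 0) (s := s)
    (P := ite (load 4 (reg 12) *ₑ load 0 (reg 11 *ₑ reg 0 +ₑ reg 12))
      (assign 18 ((reg 18 +ₑ const 1) %ₑ (reg 1 +ₑ const 1))) skip)
    (fun i s' => s'.reg 18 = 1 + ((Finset.range i).filter fun u => s.mem 4 u ≠ 0 ∧
      s.mem 0 (s.reg 11 * n + u) ≠ 0).card) (by simp [State.setReg, h18]) (by
    intro i hi s' hF hx ih
    have hc : ((Finset.range i).filter fun u => s.mem 4 u ≠ 0 ∧
        s.mem 0 (s.reg 11 * n + u) ≠ 0).card ≤ i :=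
      (Finset.card_filter_le _ _).trans (Finset.card_range i).le
    rw [Finset.range_add_one, Finset.filter_insert, run]
    have e : (load 4 (reg 12) *ₑ load 0 (reg 11 *ₑ reg 0 +ₑ reg 12)).eval s' ≠ 0 ↔
        s.mem 4 i ≠ 0 ∧ s.mem 0 (s.reg 11 * n + i) ≠ 0 := by
      simp only [Expr.eval, Op.eval, hx, hF.1 11 rfl, hF.1 0 rfl, hF.2 4 rfl, hF.2 0 rfl, hn,
        mul_ne_zero_iff]
    simp only [e]
    split_ifs with h
    · rw [Finset.card_insert_of_notMem (by simp)]
      simp only [run, State.setReg, Function.update_apply, Expr.eval, Op.eval, ih, hF.1 1 rfl, hN,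
        Nat.reduceEqDiff, if_false, if_true]
      -- At most `i < n` vertices have been counted so far, hence the modulus `n + 2` has no effect.
      rw [Nat.mod_eq_of_lt (by omega)]
      omega
    · simpa [run, State.setReg, Function.update_apply] using ih)
  rw [hn] at this
  rw [countProg, this, score]
  congr!

/-- Scores are shifted by one. The value `0` of register `16` then means that no candidate has been
seen, and the first unvisited vertex beats it even if its score is zero. -/
lemma select_spec {s : State} {n : ℕ} (hn : s.reg 0 = n) (hN : s.reg 1 = n + 1)
    (h16 : s.reg 16 = 0) (hex : ∃ v < n, s.mem 4 v = 0) :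
    (selectProg.run s).reg 17 < n ∧ s.mem 4 ((selectProg.run s).reg 17) = 0 ∧
      ∀ v < n, s.mem 4 v = 0 → score n (s.mem 0) (fun u => s.mem 4 u ≠ 0) v ≤
        score n (s.mem 0) (fun u => s.mem 4 u ≠ 0) ((selectProg.run s).reg 17) := by
  have := loop_induction (x := 11) (y := 0) (s := s)
    (P := ite (load 4 (reg 11)) skip (seq (assign 18 (const 1)) (seq countProg
      (ite (reg 16 <ₑ reg 18) (seq (assign 16 (reg 18)) (assign 17 (reg 11))) skip))))
    (fun i s' => (∀ v < i, s.mem 4 v = 0 →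
        1 + score n (s.mem 0) (fun u => s.mem 4 u ≠ 0) v ≤ s'.reg 16) ∧
      (s'.reg 16 ≠ 0 → s'.reg 17 < i ∧ s.mem 4 (s'.reg 17) = 0 ∧
        s'.reg 16 = 1 + score n (s.mem 0) (fun u => s.mem 4 u ≠ 0) (s'.reg 17)))
    (by simp [State.setReg, h16]) (by
    intro i hi s' hF hx ih
    have e : (load 4 (reg 11)).eval s' = s.mem 4 i := by
      simp only [Expr.eval, hx, hF.2 4 rfl]
    rw [run, e]
    split_ifs with h0
    · simp only [run, State.setReg, Function.update_apply, Nat.reduceEqDiff, if_false]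
      refine ⟨fun v hv hv0 => ?_, fun h => ?_⟩
      · rcases Nat.lt_succ_iff_lt_or_eq.1 hv with hv | rfl
        · exact ih.1 v hv hv0
        · exact absurd hv0 h0
      · obtain ⟨i1, i2, i3⟩ := ih.2 h
        exact ⟨by omega, i2, i3⟩
    · rw [not_not] at h0
      rw [run_seq, run_seq]
      have hF₁ := frame_run (assign 18 (const 1)) s'
      have h18 : ((assign 18 (const 1)).run s').reg 18 = 1 := by simp [run, State.setReg, Expr.eval]
      set s₁ := (assign 18 (const 1)).run s'
      have hc := count_spec (s := s₁) (n := n) (by rw [hF₁.1 0 rfl, hF.1 0 rfl, hn])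
        (by rw [hF₁.1 1 rfl, hF.1 1 rfl, hN]) h18
      have hF₂ := frame_run countProg s₁
      rw [hF₁.2 0 rfl, hF₁.2 4 rfl, hF.2 0 rfl, hF.2 4 rfl, hF₁.1 11 rfl, hx] at hc
      set s₂ := countProg.run s₁
      have r16 : s₂.reg 16 = s'.reg 16 := by rw [hF₂.1 16 rfl, hF₁.1 16 rfl]
      have r17 : s₂.reg 17 = s'.reg 17 := by rw [hF₂.1 17 rfl, hF₁.1 17 rfl]
      have r11 : s₂.reg 11 = i := by rw [hF₂.1 11 rfl, hF₁.1 11 rfl, hx]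
      have e' : (reg 16 <ₑ reg 18).eval s₂ ≠ 0 ↔
          s'.reg 16 < 1 + score n (s.mem 0) (fun u => s.mem 4 u ≠ 0) i := by
        simp [Expr.eval, Op.eval, r16, hc]
      rw [run]
      split_ifs with hlt
      · have hlt' := e'.1 hlt
        simp only [run, State.setReg, Function.update_apply, Nat.reduceEqDiff, if_false, if_true,
          Expr.eval, hc, r11]
        refine ⟨fun v hv hv0 => ?_, fun _ => ⟨Nat.lt_succ_self _, h0, trivial⟩⟩
        rcases Nat.lt_succ_iff_lt_or_eq.1 hv with hv | rfl
        · exact (ih.1 v hv hv0).trans hlt'.le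
        · exact le_rfl
      · rw [e', not_lt] at hlt
        simp only [run, State.setReg, Function.update_apply, Nat.reduceEqDiff, if_false, r16, r17]
        refine ⟨fun v hv hv0 => ?_, fun h => ?_⟩
        · rcases Nat.lt_succ_iff_lt_or_eq.1 hv with hv | rfl
          · exact ih.1 v hv hv0
          · exact hlt
        · obtain ⟨i1, i2, i3⟩ := ih.2 h
          exact ⟨by omega, i2, i3⟩)
  rw [hn] at this
  obtain ⟨h1, h2⟩ := this
  obtain ⟨v, hv, hv0⟩ := hex
  have := h1 v hv hv0
  obtain ⟨i1, i2, i3⟩ := h2 (by omega)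
  refine ⟨i1, i2, fun v hv hv0 => ?_⟩
  have := h1 v hv hv0
  rw [selectProg]
  omega

/-- `ord` lists on `1, …, m` different vertices, each of which had, when it was listed, a maximal
number of neighbours among the vertices that were listed before. -/
structure IsSearchOrder (n : ℕ) (adj : ℕ → ℕ) (m : ℕ) (ord : ℕ → ℕ) : Prop where
  lt : ∀ u, 1 ≤ u → u ≤ m → ord u < n
  inj : ∀ u v, 1 ≤ u → u ≤ m → 1 ≤ v → v ≤ m → ord u = ord v → u = v
  greedy : ∀ b, 1 ≤ b → b ≤ m → ∀ c < n, (∀ a, 1 ≤ a → a < b → ord a ≠ c) →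
    score n adj (fun u => ∃ a, 1 ≤ a ∧ a < b ∧ ord a = u) c ≤
      score n adj (fun u => ∃ a, 1 ≤ a ∧ a < b ∧ ord a = u) (ord b)

lemma search_spec {s : State} {n : ℕ} (hn : s.reg 0 = n) (hN : s.reg 1 = n + 1)
    (h4 : ∀ v, s.mem 4 v = 0) : IsSearchOrder n (s.mem 0) n ((searchProg.run s).mem 3) := by
  have := loop_induction (x := 10) (y := 0) (s := s) (P := visitProg)
    (fun i s' => IsSearchOrder n (s.mem 0) i (s'.mem 3) ∧
      ∀ v, s'.mem 4 v ≠ 0 ↔ ∃ a, 1 ≤ a ∧ a < i + 1 ∧ s'.mem 3 a = v) ?_ ?_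
  · rw [hn] at this
    exact this.1
  · refine ⟨⟨fun u h1 h2 => by omega, fun u v h1 h2 => by omega, fun b h1 h2 => by omega⟩, fun v => ?_⟩
    simp only [State.setReg, h4, ne_eq, not_true, false_iff]
    rintro ⟨a, h1, h2, -⟩
    omega
  · rintro i hi s' hF hx ⟨ih, ihv⟩
    rw [hn] at hi
    have hex : ∃ v < n, s'.mem 4 v = 0 := by
      by_contra! hall
      have hsub : Finset.range n ⊆ (Finset.Icc 1 i).image (s'.mem 3) := by
        intro v hv
        obtain ⟨a, h1, h2, h3⟩ := (ihv v).1 (hall v (Finset.mem_range.1 hv))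
        exact Finset.mem_image.2 ⟨a, Finset.mem_Icc.2 ⟨h1, by omega⟩, h3⟩
      have := (Finset.card_le_card hsub).trans Finset.card_image_le
      simp at this
      omega
    simp only [visitProg, run, Expr.eval]
    set s₁ := (s'.setReg 16 0).setReg 17 0 with hs₁
    have hF₁ : (seq (assign 16 (const 0)) (assign 17 (const 0))).Frame s' s₁ :=
      frame_run (seq (assign 16 (const 0)) (assign 17 (const 0))) s'
    obtain ⟨p1, p2, p3⟩ := select_spec (s := s₁) (n := n) (by rw [hF₁.1 0 rfl, hF.1 0 rfl, hn])
      (by rw [hF₁.1 1 rfl, hF.1 1 rfl, hN]) (by simp [hs₁, State.setReg]) hex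
    have hF₂ := frame_run selectProg s₁
    have hm0 : s₁.mem 0 = s.mem 0 := by rw [hF₁.2 0 rfl, hF.2 0 rfl]
    have hm4 : s₁.mem 4 = s'.mem 4 := hF₁.2 4 rfl
    rw [hm0, hm4] at p3
    rw [hm4] at p2
    have r10 : (selectProg.run s₁).reg 10 = i := by rw [hF₂.1 10 rfl, hF₁.1 10 rfl, hx]
    have m3 : (selectProg.run s₁).mem 3 = s'.mem 3 := by rw [hF₂.2 3 rfl, hF₁.2 3 rfl]
    have m4 : (selectProg.run s₁).mem 4 = s'.mem 4 := by rw [hF₂.2 4 rfl, hF₁.2 4 rfl]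
    set x := (selectProg.run s₁).reg 17 with hx17
    simp only [State.setMem, State.setReg, Op.eval, r10, Function.update_apply, Nat.reduceEqDiff,
      if_false, if_true, m3, m4, ← hx17]
    have hnew : ∀ a, 1 ≤ a → a < i + 1 → s'.mem 3 a ≠ x := fun a h1 h2 h3 =>
      (ihv x).2 ⟨a, h1, h2, h3⟩ p2
    have ho : ∀ a, a < i + 1 → Function.update (s'.mem 3) (i + 1) x a = s'.mem 3 a := fun a h =>
      Function.update_of_ne (by omega) _ _
    have hl : Function.update (s'.mem 3) (i + 1) x (i + 1) = x := Function.update_self ..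
    have hset : ∀ b, b ≤ i + 1 → ∀ u, (∃ a, 1 ≤ a ∧ a < b ∧
        Function.update (s'.mem 3) (i + 1) x a = u) ↔ ∃ a, 1 ≤ a ∧ a < b ∧ s'.mem 3 a = u := by
      intro b hb u
      refine exists_congr fun a => and_congr_right fun _ => and_congr_right fun hab => ?_
      rw [ho a (by omega)]
    refine ⟨⟨fun u h1 h2 => ?_, fun u v h1 h2 h3 h4 he => ?_, fun b h1 h2 c hc hnc => ?_⟩, fun v => ?_⟩
    · rcases Nat.lt_or_ge u (i + 1) with h | h
      · rw [ho u h]; exact ih.lt u h1 (by omega)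
      · rw [show u = i + 1 by omega, hl]; exact p1
    · rcases Nat.lt_or_ge u (i + 1) with h | h <;> rcases Nat.lt_or_ge v (i + 1) with h' | h'
      · rw [ho u h, ho v h'] at he
        exact ih.inj u v h1 (by omega) h3 (by omega) he
      · rw [ho u h, show v = i + 1 by omega, hl] at he
        exact absurd he (hnew u h1 h)
      · rw [ho v h', show u = i + 1 by omega, hl] at he
        exact absurd he.symm (hnew v h3 h')
      · omega
    · rw [score_congr (hset b h2), score_congr (hset b h2)]
      rcases Nat.lt_or_ge b (i + 1) with h | h
      · rw [ho b h]
        refine ih.greedy b h1 (by omega) c hc fun a ha1 ha2 => ?_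
        rw [← ho a (by omega)]
        exact hnc a ha1 ha2
      · obtain rfl : b = i + 1 := by omega
        rw [hl, ← score_congr ihv, ← score_congr ihv]
        refine p3 c hc ?_
        by_contra hvis
        obtain ⟨a, ha1, ha2, ha3⟩ := (ihv c).1 hvis
        exact hnc a ha1 ha2 (by rw [ho a ha2]; exact ha3)
    · split_ifs with h
      · subst h
        simp only [ne_eq, one_ne_zero, not_false_eq_true, true_iff]
        exact ⟨i + 1, by omega, by omega, by simp⟩
      · rw [ihv v]
        constructor
        · rintro ⟨a, h1, h2, h3⟩
          exact ⟨a, h1, by omega, by rw [if_neg (by omega), h3]⟩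
        · rintro ⟨a, h1, h2, h3⟩
          split_ifs at h3 with h4
          · exact absurd h3.symm h
          · exact ⟨a, h1, by omega, h3⟩

/-! ### Output of an optimal coloring -/

/-- The smallest entry of the profit vector whose code is in register `13`. -/
def minProg : Prog :=
  seq (assign 24 (reg 8))
    (loop 15 2 (ite ((reg 13 /ₑ load 9 (reg 15)) %ₑ reg 8 <ₑ reg 24)
      (assign 24 ((reg 13 /ₑ load 9 (reg 15)) %ₑ reg 8)) skip))

/-- Find the best attainable profit code. -/
def bestProg : Prog :=
  seq (assign 22 (load 5 (const 0))) <| seq (assign 16 (const 0)) <| seq (assign 25 (const 0)) <|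
  loop 13 4 (ite (load 7 (cellE (reg 22) (const 0) (reg 13) (const 0)))
    (seq minProg (ite (reg 16 <ₑ reg 24) (seq (assign 16 (reg 24)) (assign 25 (reg 13))) skip)) skip)

/-- Write the coloring of the best attainable profit code into the output bank. -/
def writeProg : Prog :=
  loop 12 0 (loop 15 2 (store 2 (reg 15 *ₑ reg 0 +ₑ load 3 (reg 12 +ₑ const 1))
    (load 7 (cellE (reg 22) (const 0) (reg 25) (reg 12 +ₑ const 1)) =ₑ reg 15 +ₑ const 1)))

namespace Layout

variable {L : Layout}

variable (L) in
/-- The smallest entry of the profit vector with code `a`. -/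
noncomputable def level (a : ℕ) : ℕ := ⨅ c : Fin L.k, dig L.base a c

lemma level_eq {a x : ℕ} (hk : 1 ≤ L.k) (h1 : ∀ c < L.k, x ≤ dig L.base a c)
    (h2 : ∃ c < L.k, x = dig L.base a c) : L.level a = x := by
  have : Nonempty (Fin L.k) := ⟨⟨0, hk⟩⟩
  refine le_antisymm ?_ (le_ciInf fun c => h1 c c.isLt)
  obtain ⟨c, hc, rfl⟩ := h2
  exact ciInf_le' (fun c : Fin L.k => dig L.base a c) ⟨c, hc⟩

lemma min_spec {s : State} (h : L.Env s) (hk : 1 ≤ L.k) (hb : 0 < L.base) :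
    (minProg.run s).reg 24 = L.level (s.reg 13) := by
  rw [minProg, run_seq]
  have hF₁ := frame_run (assign 24 (reg 8)) s
  have r24 : ((assign 24 (reg 8)).run s).reg 24 = L.base := by
    simp [run, State.setReg, Expr.eval, h.base]
  set s₁ := (assign 24 (reg 8)).run s
  have h₁ := h.of_frame hF₁
  have := loop_induction (x := 15) (y := 2) (s := s₁)
    (P := ite ((reg 13 /ₑ load 9 (reg 15)) %ₑ reg 8 <ₑ reg 24)
      (assign 24 ((reg 13 /ₑ load 9 (reg 15)) %ₑ reg 8)) skip)
    (fun i s' => (∀ c < i, s'.reg 24 ≤ dig L.base (s.reg 13) c) ∧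
      (s'.reg 24 = L.base ∨ ∃ c < i, s'.reg 24 = dig L.base (s.reg 13) c))
    (by simp [State.setReg, r24]) (by
    intro i hi s' hF hx ⟨i1, i2⟩
    rw [h₁.k] at hi
    have h' := h₁.of_frame hF
    have e : ((reg 13 /ₑ load 9 (reg 15)) %ₑ reg 8).eval s' = dig L.base (s.reg 13) i := by
      simp only [Expr.eval, Op.eval, h'.base, hx, h'.powB i hi.le, hF.1 13 rfl, hF₁.1 13 rfl, dig]
    have e' : ((reg 13 /ₑ load 9 (reg 15)) %ₑ reg 8 <ₑ reg 24).eval s' ≠ 0 ↔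
        dig L.base (s.reg 13) i < s'.reg 24 := by
      rw [Expr.eval, e]
      simp only [Expr.eval, Op.eval]
      split_ifs with hc <;> simp [hc]
    rw [run]
    split_ifs with hc
    · rw [e'] at hc
      rw [run, e]
      simp only [State.setReg, Function.update_apply, Nat.reduceEqDiff, if_false, if_true]
      refine ⟨fun c hc' => ?_, Or.inr ⟨i, by omega, rfl⟩⟩
      rcases Nat.lt_succ_iff_lt_or_eq.1 hc' with h4 | rfl
      · exact hc.le.trans (i1 c h4)
      · exact le_rfl
    · rw [e', not_lt] at hc
      simp only [run, State.setReg, Function.update_apply, Nat.reduceEqDiff, if_false]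
      refine ⟨fun c hc' => ?_, i2.imp id fun ⟨c, h1, h2⟩ => ⟨c, by omega, h2⟩⟩
      rcases Nat.lt_succ_iff_lt_or_eq.1 hc' with h4 | rfl
      · exact i1 c h4
      · exact hc)
  rw [h₁.k] at this
  refine (level_eq hk this.1 ?_).symm
  -- The initial value `base` exceeds every digit, and there is a digit because `1 ≤ k`, so it has
  -- been replaced.
  refine this.2.resolve_left fun he => ?_
  have h0 := this.1 0 hk
  rw [he] at h0
  have := dig_lt hb (s.reg 13) 0
  omega

lemma best_spec (hL : L.Valid) {s : State} (h : L.Env s) (hk : 1 ≤ L.k) {D : Set ℕ} {x : ℕ}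
    (hx : s.mem 5 0 = x) (hT : L.IsTable (L.tab (s.mem 7) x) D 0) :
    (bestProg.run s).reg 22 = x ∧ (bestProg.run s).reg 25 < L.base ^ L.k ∧
      L.tab (s.mem 7) x 0 ((bestProg.run s).reg 25) 0 ≠ 0 ∧
      ∀ a < L.base ^ L.k, L.tab (s.mem 7) x 0 a 0 ≠ 0 →
        L.level a ≤ L.level ((bestProg.run s).reg 25) := by
  have hb : 0 < L.base := by
    have := hL.carry 0 hk
    omega
  have hM : 0 < L.base ^ L.k := Nat.pow_pos hb
  -- The empty coloring is attainable, so the code `0` is a legitimate first candidate.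
  have hfl0 : L.tab (s.mem 7) x 0 0 0 ≠ 0 := by
    have := hT.complete 0 (by positivity) (by simp [dig]) (fun _ => 0)
      ⟨by simp, by simp, by simp, by simp⟩
    have hw : L.weight (fun _ => 0) = 0 := by simp [weight, gain]
    rwa [hw] at this
  have hlev0 : L.level 0 = 0 := level_eq hk (by simp) ⟨0, hk, by simp [dig]⟩
  simp only [bestProg, run_seq]
  have hF₁ := frame_run (seq (assign 22 (load 5 (const 0))) (seq (assign 16 (const 0))
    (assign 25 (const 0)))) s
  have r : ∀ y, ((seq (assign 22 (load 5 (const 0))) (seq (assign 16 (const 0))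
      (assign 25 (const 0)))).run s).reg y = if y = 25 then 0 else if y = 16 then 0 else
      if y = 22 then x else s.reg y := by
    intro y
    simp [run, State.setReg, Expr.eval, Function.update_apply, hx]
  simp only [run_seq] at hF₁ r
  set s₁ := (assign 25 (const 0)).run ((assign 16 (const 0)).run
    ((assign 22 (load 5 (const 0))).run s))
  have h₁ := h.of_frame hF₁
  have r22 : s₁.reg 22 = x := by rw [r]; rfl
  set body := ite (load 7 (cellE (reg 22) (const 0) (reg 13) (const 0)))
    (seq minProg (ite (reg 16 <ₑ reg 24) (seq (assign 16 (reg 24)) (assign 25 (reg 13))) skip)) skip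
    with hbody
  have := loop_induction (x := 13) (y := 4) (s := s₁) (P := body)
    (fun i s' => s'.reg 25 < L.base ^ L.k ∧ L.tab (s.mem 7) x 0 (s'.reg 25) 0 ≠ 0 ∧
      s'.reg 16 = L.level (s'.reg 25) ∧
      ∀ a < i, L.tab (s.mem 7) x 0 a 0 ≠ 0 → L.level a ≤ s'.reg 16) ?_ ?_
  · rw [h₁.M] at this
    obtain ⟨i1, i2, i3, i4⟩ := this
    refine ⟨?_, i1, i2, fun a ha hf => ?_⟩
    · rw [run_reg (loop 13 4 body) (by rfl), r22]
    · rw [← i3]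
      exact i4 a ha hf
  · have e25 : (s₁.setReg 13 0).reg 25 = 0 := by
      simp [State.setReg, r]
    have e16 : (s₁.setReg 13 0).reg 16 = 0 := by
      simp [State.setReg, r]
    rw [e25, e16]
    exact ⟨hM, hfl0, hlev0.symm, by simp⟩
  · rintro i hi s' hF hxi ⟨i1, i2, i3, i4⟩
    have h' := h₁.of_frame hF
    rw [h₁.M] at hi
    have e : (load 7 (cellE (reg 22) (const 0) (reg 13) (const 0))).eval s' =
        L.tab (s.mem 7) x 0 i 0 := by
      rw [Expr.eval, h'.eval_cellE]
      simp only [Expr.eval, hxi, hF.1 22 rfl, hF.2 7 rfl, hF₁.2 7 rfl, r22]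
      rfl
    rw [hbody, run, e]
    split_ifs with hfl
    · rw [run_seq]
      have hm := min_spec h' hk hb
      rw [hxi] at hm
      have hF₂ := frame_run minProg s'
      set s₂ := minProg.run s'
      have r16 : s₂.reg 16 = s'.reg 16 := hF₂.1 16 rfl
      have r25 : s₂.reg 25 = s'.reg 25 := hF₂.1 25 rfl
      have r13 : s₂.reg 13 = i := by rw [hF₂.1 13 rfl, hxi]
      have e' : (reg 16 <ₑ reg 24).eval s₂ ≠ 0 ↔ s'.reg 16 < L.level i := by
        simp [Expr.eval, Op.eval, r16, hm]
      rw [run]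
      split_ifs with hlt
      · rw [e'] at hlt
        simp only [run, State.setReg, Function.update_apply, Nat.reduceEqDiff, if_false, if_true,
          Expr.eval, hm, r13]
        refine ⟨hi, hfl, trivial, fun a ha hfa => ?_⟩
        rcases Nat.lt_succ_iff_lt_or_eq.1 ha with h4 | rfl
        · exact (i4 a h4 hfa).trans hlt.le
        · exact le_rfl
      · rw [e', not_lt] at hlt
        simp only [run, State.setReg, Function.update_apply, Nat.reduceEqDiff, if_false, r16, r25]
        refine ⟨i1, i2, i3, fun a ha hfa => ?_⟩
        rcases Nat.lt_succ_iff_lt_or_eq.1 ha with h4 | rfl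
        · exact i4 a h4 hfa
        · exact hlt
    · simp only [run, State.setReg, Function.update_apply, Nat.reduceEqDiff, if_false]
      refine ⟨i1, i2, i3, fun a ha hfa => ?_⟩
      rcases Nat.lt_succ_iff_lt_or_eq.1 ha with h4 | rfl
      · exact i4 a h4 hfa
      · exact absurd hfa hfl

/-- Distinct pairs of a position and a color address distinct output cells, because the search order
is injective with values below `n`. Hence a cell once written correctly is not spoiled later. -/
lemma write_spec {s : State} (h : L.Env s)
    (hlt : ∀ u, 1 ≤ u → u ≤ L.n → s.mem 3 u < L.n)
    (hinj : ∀ u v, 1 ≤ u → u ≤ L.n → 1 ≤ v → v ≤ L.n → s.mem 3 u = s.mem 3 v → u = v)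
    {u c : ℕ} (hu : u < L.n) (hc : c < L.k) :
    (writeProg.run s).mem 2 (c * L.n + s.mem 3 (u + 1)) =
      if L.tab (s.mem 7) (s.reg 22) 0 (s.reg 25) (u + 1) = c + 1 then 1 else 0 := by
  obtain ⟨-, -, k⟩ := Prog.Collects.loop (x := 12) (y := 0) (s := s) (b := 2)
    (P := loop 15 2 (store 2 (reg 15 *ₑ reg 0 +ₑ load 3 (reg 12 +ₑ const 1))
      (load 7 (cellE (reg 22) (const 0) (reg 25) (reg 12 +ₑ const 1)) =ₑ reg 15 +ₑ const 1)))
    (Inv := fun _ => True)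
    (Fl := fun m => {z : ℕ × ℕ | z.1 < L.n ∧ z.2 < L.k ∧ m (z.2 * L.n + s.mem 3 (z.1 + 1)) =
      if L.tab (s.mem 7) (s.reg 22) 0 (s.reg 25) (z.1 + 1) = z.2 + 1 then 1 else 0})
    (fun u => {z | ∃ c < s.reg 2, z ∈ {z : ℕ × ℕ | z = (u, c)}}) (by
    intro u hu s₁ hF₁ hx₁
    have h₁ := h.of_frame hF₁
    rw [h.n] at hu
    rw [← hF₁.1 2 rfl]
    refine Prog.Collects.loop _ fun c hc s₂ hF₂ hx₂ _ => ?_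
    have h₂ := h₁.of_frame hF₂
    rw [h₁.k] at hc
    have e : (store 2 (reg 15 *ₑ reg 0 +ₑ load 3 (reg 12 +ₑ const 1))
      (load 7 (cellE (reg 22) (const 0) (reg 25) (reg 12 +ₑ const 1)) =ₑ
        reg 15 +ₑ const 1)).run s₂ = s₂.setMem 2 (c * L.n + s.mem 3 (u + 1))
          (if L.tab (s.mem 7) (s.reg 22) 0 (s.reg 25) (u + 1) = c + 1 then 1 else 0) := by
      simp only [run, Expr.eval, Op.eval, h₂.eval_cellE, h₂.n, hx₂, hF₂.1 12 rfl, hx₁, hF₂.2 3 rfl,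
        hF₁.2 3 rfl, hF₂.2 7 rfl, hF₁.2 7 rfl, hF₂.1 22 rfl, hF₁.1 22 rfl, hF₂.1 25 rfl,
        hF₁.1 25 rfl]
      rfl
    rw [e]
    simp only [State.setMem, Function.update_self]
    refine ⟨trivial, ?_, ?_⟩
    · rintro ⟨u', c'⟩ ⟨hu', hc', hz⟩
      refine ⟨hu', hc', ?_⟩
      by_cases h1 : c' * L.n + s.mem 3 (u' + 1) = c * L.n + s.mem 3 (u + 1)
      · obtain ⟨rfl, h3⟩ := mul_add_inj (hlt _ (by omega) (by omega)) (hlt _ (by omega) (by omega)) h1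
        have := hinj _ _ (by omega) (by omega) (by omega) (by omega) h3
        obtain rfl : u' = u := by omega
        exact Function.update_self ..
      · exact (Function.update_of_ne h1 ..).trans hz
    · rintro z rfl
      exact ⟨hu, hc, by simp⟩) trivial
  exact (k (a := (u, c)) ⟨u, by rwa [h.n], c, by rwa [h.k], rfl⟩).2.2

end Layout

/-! ### Preparation of the registers and of the tables of powers -/

/-- Write the powers of register `y` into the bank `m`. -/
def powProg (m y : ℕ) : Prog :=
  seq (assign 9 (const 1))
    (loop 11 6 (seq (store m (reg 11) (reg 9)) (assign 9 (reg 9 *ₑ reg y))))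

/-- Add up all profits. -/
def sumProg : Prog := loop 11 7 (assign 8 (reg 8 +ₑ load 1 (reg 11)))

/-- Prepare the registers and the tables of powers. -/
def setupProg (k : ℕ) : Prog :=
  seq (assign 2 (const k)) <| seq (assign 1 (reg 0 +ₑ const 1)) <| seq (assign 6 (const (k + 1))) <|
  seq (assign 7 (const k *ₑ reg 0)) <| seq sumProg <| seq (assign 8 (reg 8 +ₑ const 1)) <|
  seq (powProg 8 1) <| seq (powProg 9 8) <| seq (assign 3 (load 8 (const k))) <|
  seq (assign 4 (load 9 (const k))) (assign 5 (reg 3 *ₑ reg 4 *ₑ reg 1))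

/-! ### Programs whose values grow, controlled by invariants. -/

namespace Prog

/-- With every word bound from `b ^ P.deg D` on, the program `P` runs safely from `s` and keeps all
contents at most `b ^ D`. -/
def Keeps (b D : ℕ) (env : ℕ → ℕ) (P : Prog) (s : State) : Prop :=
  ∀ B, b ^ P.deg D ≤ B → P.Safe B env s ∧ (P.run s).Bounded (b ^ D)

variable {b D : ℕ} {env : ℕ → ℕ}

lemma Keeps.seq (hb : 2 ≤ b) {P₁ P₂ : Prog} {s : State} (h₁ : P₁.Keeps b D env s)
    (h₂ : (P₁.run s).Bounded (b ^ D) → P₂.Keeps b D env (P₁.run s)) :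
    (Prog.seq P₁ P₂).Keeps b D env s := fun B hB => by
  have g₁ := h₁ B ((Nat.pow_le_pow_right (by omega) (Nat.le_add_right _ _)).trans hB)
  have g₂ := h₂ g₁.2 B ((Nat.pow_le_pow_right (by omega) (Nat.le_add_left _ _)).trans hB)
  exact ⟨⟨g₁.1, g₂.1⟩, g₂.2⟩

lemma keeps_assign (hb : 2 ≤ b) {x : ℕ} {e : Expr} {s : State} (hs : s.Bounded (b ^ D))
    (he : e.eval s ≤ b ^ D) : (assign x e).Keeps b D env s := fun _ hB =>
  ⟨(e.fits_of_bounded hb hs).2.mono hB, hs.setReg he⟩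

lemma keeps_store (hb : 2 ≤ b) {m : ℕ} {i e : Expr} {s : State} (hs : s.Bounded (b ^ D))
    (he : e.eval s ≤ b ^ D) : (store m i e).Keeps b D env s := fun _ hB =>
  ⟨⟨(i.fits_of_bounded hb hs).2.mono
      ((Nat.pow_le_pow_right (by omega) (Nat.le_add_right _ _)).trans hB),
    (e.fits_of_bounded hb hs).2.mono
      ((Nat.pow_le_pow_right (by omega) (Nat.le_add_left _ _)).trans hB)⟩, hs.setMem he⟩

/-- Here the bound on the contents may depend on the actual values, so safety and the invariant `I`
are established by one common induction. -/
lemma keeps_loop (hb : 2 ≤ b) {x y : ℕ} {P : Prog} {s : State} (hs : s.Bounded (b ^ D))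
    (hxy : x ≠ y) (hx : P.wr x = false) (hy : P.wr y = false) (hye : s.reg y ≤ env y)
    (I : ℕ → State → Prop) (h0 : I 0 (s.setReg x 0))
    (hstep : ∀ i < s.reg y, ∀ s', (Prog.loop x y P).Frame s s' → s'.reg x = i → s'.Bounded (b ^ D) →
      I i s' → P.Keeps b D env s' ∧ I (i + 1) ((P.run s').setReg x (i + 1))) :
    (Prog.loop x y P).Keeps b D env s ∧ I (s.reg y) ((Prog.loop x y P).run s) := by
  have hyA := hs.1 y
  have key : ∀ i ≤ s.reg y, (P.iter x s i).Bounded (b ^ D) ∧ I i (P.iter x s i) := by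
    intro i hi
    induction i with
    | zero => exact ⟨hs.setReg (Nat.zero_le _), h0⟩
    | succ i ih =>
      obtain ⟨h1, h2⟩ := ih (by omega)
      obtain ⟨g1, g2⟩ := hstep i (by omega) _ (frame_iter P x y s i) (iter_counter s i) h1 h2
      exact ⟨((g1 _ le_rfl).2).setReg (by omega), g2⟩
  refine ⟨fun B hB => ⟨⟨hxy, hx, hy, ?_, ?_, hye, fun i hi => ?_⟩, (key _ le_rfl).1⟩, (key _ le_rfl).2⟩
  · exact (Nat.one_le_pow _ _ (by omega)).trans hB
  · exact hyA.trans ((Nat.pow_le_pow_right (by omega) (Nat.le_add_right _ _)).trans hB)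
  · obtain ⟨h1, h2⟩ := key i hi.le
    exact ((hstep i hi _ (frame_iter P x y s i) (iter_counter s i) h1 h2).1 B
      ((Nat.pow_le_pow_right (by omega) (Nat.le_add_left _ _)).trans hB)).1

end Prog

/-- The bound is required for `z ^ (k + 1)`, since the loop multiplies once more after it has stored
`z ^ k`. -/
lemma pow_spec {b D : ℕ} {env : ℕ → ℕ} (hb : 2 ≤ b) {s : State} (hs : s.Bounded (b ^ D)) {k m y z : ℕ}
    (h6 : s.reg 6 = k + 1) (h6e : k + 1 ≤ env 6) (hy : y ≠ 9 ∧ y ≠ 11) (hyz : s.reg y = z)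
    (hz : 1 ≤ z) (hzb : z ^ (k + 1) ≤ b ^ D) :
    (powProg m y).Keeps b D env s ∧ ∀ c ≤ k, ((powProg m y).run s).mem m c = z ^ c := by
  have hy9 : (assign 9 (const 1)).wr y = false := by simp [wr, hy.1.symm]
  have hyl : (loop 11 6 (seq (store m (reg 11) (reg 9)) (assign 9 (reg 9 *ₑ reg y)))).wr y = false := by
    simp [wr, hy.1.symm, hy.2.symm]
  have k₁ : (assign 9 (const 1)).Keeps b D env s :=
    keeps_assign hb hs (Nat.one_le_pow _ _ (by omega))
  have hs₁ := (k₁ _ le_rfl).2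
  have hF₁ := frame_run (assign 9 (const 1)) s
  have r9 : ((assign 9 (const 1)).run s).reg 9 = 1 := by simp [run, State.setReg, Expr.eval]
  rw [powProg, run_seq]
  have hseq := k₁.seq hb (P₂ := loop 11 6 (seq (store m (reg 11) (reg 9)) (assign 9 (reg 9 *ₑ reg y))))
  set s₁ := (assign 9 (const 1)).run s
  obtain ⟨g1, g2⟩ := keeps_loop (x := 11) (y := 6) (env := env) hb hs₁
    (P := seq (store m (reg 11) (reg 9)) (assign 9 (reg 9 *ₑ reg y)))
    (by decide) rfl rfl (by rw [hF₁.1 6 rfl, h6]; exact h6e)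
    (fun i s' => s'.reg 9 = z ^ i ∧ ∀ c < i, s'.mem m c = z ^ c)
    (by simp [State.setReg, r9]) (by
    rintro i hi s' hF hx hsb ⟨i1, i2⟩
    rw [hF₁.1 6 rfl, h6] at hi
    have ry : s'.reg y = z := by rw [hF.1 y hyl, hF₁.1 y hy9, hyz]
    have hle : ∀ j ≤ k + 1, z ^ j ≤ b ^ D := fun j hj => (Nat.pow_le_pow_right hz hj).trans hzb
    refine ⟨(keeps_store hb hsb (by rw [Expr.eval, i1]; exact hle i (by omega))).seq hb
      fun hsb' => keeps_assign hb hsb' ?_, ?_, fun c hc => ?_⟩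
    · simp only [run, State.setMem, Expr.eval, Op.eval, i1, ry, ← pow_succ]
      exact hle _ (by omega)
    · simp [run, State.setMem, State.setReg, Expr.eval, Op.eval, i1, ry, pow_succ]
    · simp only [run, State.setMem, State.setReg, Expr.eval, hx, i1, Function.update_self]
      rw [Function.update_apply]
      split_ifs with h
      · rw [h]
      · exact i2 c (by omega))
  rw [hF₁.1 6 rfl, h6] at g2
  exact ⟨hseq fun _ => g1, fun c hc => g2.2 c (by omega)⟩

/-- The sum `T` of all profits replaces the maximum `Q` in the base: a single loop computes it, and
the loss is a factor that depends only on `k`. Each instruction needs the values left by the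
previous ones to be seen not to overflow, hence the chain of intermediate states. -/
lemma setup_spec {b D k n : ℕ} {env : ℕ → ℕ} (hb : 2 ≤ b) {s : State} (hs : s.Bounded (b ^ D))
    (hn : s.reg 0 = n) (h8 : s.reg 8 = 0) {T : ℕ} (hT : T = ∑ i ∈ Finset.range (k * n), s.mem 1 i)
    (h6e : k + 1 ≤ env 6) (h7e : k * n ≤ env 7) (hk : k + 1 ≤ b ^ D) (hkn : k * n ≤ b ^ D)
    (hN : (n + 1) ^ (k + 1) ≤ b ^ D) (hM : (T + 1) ^ (k + 1) ≤ b ^ D)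
    (hKMN : (n + 1) ^ k * (T + 1) ^ k * (n + 1) ≤ b ^ D) :
    (setupProg k).Keeps b D env s ∧ ∀ s', s' = (setupProg k).run s →
      s'.reg 1 = n + 1 ∧ s'.reg 2 = k ∧ s'.reg 3 = (n + 1) ^ k ∧ s'.reg 4 = (T + 1) ^ k ∧
      s'.reg 5 = (n + 1) ^ k * (T + 1) ^ k * (n + 1) ∧ s'.reg 8 = T + 1 ∧
      (∀ c ≤ k, s'.mem 8 c = (n + 1) ^ c) ∧ ∀ c ≤ k, s'.mem 9 c = (T + 1) ^ c := by
  have hpow : ∀ {z j : ℕ}, 1 ≤ z → j ≤ k + 1 → z ^ (k + 1) ≤ b ^ D → z ^ j ≤ b ^ D :=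
    fun hz hj h => (Nat.pow_le_pow_right hz hj).trans h
  have hN1 : n + 1 ≤ b ^ D := by simpa using hpow (j := 1) (by omega) (by omega) hN
  have hM1 : T + 1 ≤ b ^ D := by simpa using hpow (j := 1) (by omega) (by omega) hM
  simp only [setupProg, run_seq]
  -- the constants
  have k₁ : (assign 2 (const k)).Keeps b D env s := keeps_assign hb hs (by rw [Expr.eval]; omega)
  have v₁ : ((assign 2 (const k)).run s).reg 2 = k := by simp [run, State.setReg, Expr.eval]
  have F₁ := frame_run (assign 2 (const k)) s
  have b₁ := (k₁ _ le_rfl).2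
  have c₁ := fun P₂ => k₁.seq hb (P₂ := P₂)
  set s₁ := (assign 2 (const k)).run s
  have e₂ : (reg 0 +ₑ const 1).eval s₁ = n + 1 := by simp [Expr.eval, Op.eval, F₁.1 0 rfl, hn]
  have k₂ : (assign 1 (reg 0 +ₑ const 1)).Keeps b D env s₁ := keeps_assign hb b₁ (by rw [e₂]; omega)
  have v₂ : ((assign 1 (reg 0 +ₑ const 1)).run s₁).reg 1 = n + 1 := by
    rw [run, e₂]; simp [State.setReg]
  have F₂ := frame_run (assign 1 (reg 0 +ₑ const 1)) s₁
  have b₂ := (k₂ _ le_rfl).2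
  have c₂ := fun P₂ => k₂.seq hb (P₂ := P₂)
  set s₂ := (assign 1 (reg 0 +ₑ const 1)).run s₁
  have k₃ : (assign 6 (const (k + 1))).Keeps b D env s₂ := keeps_assign hb b₂ (by rw [Expr.eval]; omega)
  have v₃ : ((assign 6 (const (k + 1))).run s₂).reg 6 = k + 1 := by simp [run, State.setReg, Expr.eval]
  have F₃ := frame_run (assign 6 (const (k + 1))) s₂
  have b₃ := (k₃ _ le_rfl).2
  have c₃ := fun P₂ => k₃.seq hb (P₂ := P₂)
  set s₃ := (assign 6 (const (k + 1))).run s₂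
  have e₄ : (const k *ₑ reg 0).eval s₃ = k * n := by
    simp [Expr.eval, Op.eval, F₃.1 0 rfl, F₂.1 0 rfl, F₁.1 0 rfl, hn]
  have k₄ : (assign 7 (const k *ₑ reg 0)).Keeps b D env s₃ := keeps_assign hb b₃ (by rw [e₄]; omega)
  have v₄ : ((assign 7 (const k *ₑ reg 0)).run s₃).reg 7 = k * n := by
    rw [run, e₄]; simp [State.setReg]
  have F₄ := frame_run (assign 7 (const k *ₑ reg 0)) s₃
  have b₄ := (k₄ _ le_rfl).2
  have c₄ := fun P₂ => k₄.seq hb (P₂ := P₂)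
  set s₄ := (assign 7 (const k *ₑ reg 0)).run s₃
  -- the sum of the profits
  have m1 : s₄.mem 1 = s.mem 1 := by rw [F₄.2 1 rfl, F₃.2 1 rfl, F₂.2 1 rfl, F₁.2 1 rfl]
  obtain ⟨k₅, v₅⟩ := keeps_loop (x := 11) (y := 7) (env := env) hb b₄
    (P := assign 8 (reg 8 +ₑ load 1 (reg 11))) (by decide) rfl rfl (by rw [v₄]; exact h7e)
    (fun i s' => s'.reg 8 = ∑ j ∈ Finset.range i, s.mem 1 j) (by
      have : s₄.reg 8 = 0 := by rw [F₄.1 8 rfl, F₃.1 8 rfl, F₂.1 8 rfl, F₁.1 8 rfl, h8]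
      simp [State.setReg, this]) (by
    intro i hi s' hF hx hsb ih
    rw [v₄] at hi
    have e : (reg 8 +ₑ load 1 (reg 11)).eval s' = ∑ j ∈ Finset.range (i + 1), s.mem 1 j := by
      simp only [Expr.eval, Op.eval, ih, hx, hF.2 1 rfl, m1, Finset.sum_range_succ]
    refine ⟨keeps_assign hb hsb ?_, ?_⟩
    · rw [e]
      have := Finset.sum_le_sum_of_subset (f := s.mem 1)
        (Finset.range_subset_range.2 (show i + 1 ≤ k * n by omega))
      omega
    · rw [run, e]
      simp [State.setReg])
  rw [v₄, ← hT] at v₅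
  change sumProg.Keeps b D env s₄ at k₅
  change (sumProg.run s₄).reg 8 = T at v₅
  have F₅ := frame_run sumProg s₄
  have b₅ := (k₅ _ le_rfl).2
  have c₅ := fun P₂ => k₅.seq hb (P₂ := P₂)
  set s₅ := sumProg.run s₄
  have e₆ : (reg 8 +ₑ const 1).eval s₅ = T + 1 := by simp [Expr.eval, Op.eval, v₅]
  have k₆ : (assign 8 (reg 8 +ₑ const 1)).Keeps b D env s₅ := keeps_assign hb b₅ (by rw [e₆]; omega)
  have v₆ : ((assign 8 (reg 8 +ₑ const 1)).run s₅).reg 8 = T + 1 := by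
    rw [run, e₆]; simp [State.setReg]
  have F₆ := frame_run (assign 8 (reg 8 +ₑ const 1)) s₅
  have b₆ := (k₆ _ le_rfl).2
  have c₆ := fun P₂ => k₆.seq hb (P₂ := P₂)
  set s₆ := (assign 8 (reg 8 +ₑ const 1)).run s₅
  -- the powers
  have r6 : s₆.reg 6 = k + 1 := by rw [F₆.1 6 rfl, F₅.1 6 rfl, F₄.1 6 rfl, v₃]
  have r1 : s₆.reg 1 = n + 1 := by
    rw [F₆.1 1 rfl, F₅.1 1 rfl, F₄.1 1 rfl, F₃.1 1 rfl, v₂]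
  have r2 : s₆.reg 2 = k := by
    rw [F₆.1 2 rfl, F₅.1 2 rfl, F₄.1 2 rfl, F₃.1 2 rfl, F₂.1 2 rfl, v₁]
  obtain ⟨k₇, v₇⟩ := pow_spec (m := 8) (y := 1) hb b₆ r6 h6e (by decide) r1 (by omega) hN
  have F₇ := frame_run (powProg 8 1) s₆
  have b₇ := (k₇ _ le_rfl).2
  have c₇ := fun P₂ => k₇.seq hb (P₂ := P₂)
  set s₇ := (powProg 8 1).run s₆
  obtain ⟨k₈, v₈⟩ := pow_spec (m := 9) (y := 8) hb b₇ (by rw [F₇.1 6 rfl, r6]) h6e (by decide)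
    (by rw [F₇.1 8 rfl, v₆]) (by omega) hM
  have F₈ := frame_run (powProg 9 8) s₇
  have b₈ := (k₈ _ le_rfl).2
  have c₈ := fun P₂ => k₈.seq hb (P₂ := P₂)
  set s₈ := (powProg 9 8).run s₇
  -- the sizes of the tables
  have e₉ : (load 8 (const k)).eval s₈ = (n + 1) ^ k := by
    rw [Expr.eval, Expr.eval, F₈.2 8 rfl, v₇ k le_rfl]
  have k₉ : (assign 3 (load 8 (const k))).Keeps b D env s₈ :=
    keeps_assign hb b₈ (by rw [e₉]; exact hpow (by omega) (by omega) hN)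
  have v₉ : ((assign 3 (load 8 (const k))).run s₈).reg 3 = (n + 1) ^ k := by
    rw [run, e₉]; simp [State.setReg]
  have F₉ := frame_run (assign 3 (load 8 (const k))) s₈
  have b₉ := (k₉ _ le_rfl).2
  have c₉ := fun P₂ => k₉.seq hb (P₂ := P₂)
  set s₉ := (assign 3 (load 8 (const k))).run s₈
  have e' : (load 9 (const k)).eval s₉ = (T + 1) ^ k := by
    rw [Expr.eval, Expr.eval, F₉.2 9 rfl, v₈ k le_rfl]
  have k' : (assign 4 (load 9 (const k))).Keeps b D env s₉ :=
    keeps_assign hb b₉ (by rw [e']; exact hpow (by omega) (by omega) hM)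
  have v' : ((assign 4 (load 9 (const k))).run s₉).reg 4 = (T + 1) ^ k := by
    rw [run, e']; simp [State.setReg]
  have F' := frame_run (assign 4 (load 9 (const k))) s₉
  have b' := (k' _ le_rfl).2
  have c' := fun P₂ => k'.seq hb (P₂ := P₂)
  set s' := (assign 4 (load 9 (const k))).run s₉
  have e'' : (reg 3 *ₑ reg 4 *ₑ reg 1).eval s' = (n + 1) ^ k * (T + 1) ^ k * (n + 1) := by
    simp only [Expr.eval, Op.eval, v', F'.1 3 rfl, v₉, F'.1 1 rfl, F₉.1 1 rfl, F₈.1 1 rfl,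
      F₇.1 1 rfl, r1]
  have k'' : (assign 5 (reg 3 *ₑ reg 4 *ₑ reg 1)).Keeps b D env s' :=
    keeps_assign hb b' (by rw [e'']; exact hKMN)
  have v'' : ((assign 5 (reg 3 *ₑ reg 4 *ₑ reg 1)).run s').reg 5 =
      (n + 1) ^ k * (T + 1) ^ k * (n + 1) := by
    rw [run, e'']; simp [State.setReg]
  have F'' := frame_run (assign 5 (reg 3 *ₑ reg 4 *ₑ reg 1)) s'
  refine ⟨c₁ _ fun _ => c₂ _ fun _ => c₃ _ fun _ => c₄ _ fun _ => c₅ _ fun _ => c₆ _ fun _ =>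
    c₇ _ fun _ => c₈ _ fun _ => c₉ _ fun _ => c' _ fun _ => k'', ?_⟩
  rintro _ rfl
  refine ⟨?_, ?_, ?_, ?_, v'', ?_, fun c hc => ?_, fun c hc => ?_⟩
  · rw [F''.1 1 rfl, F'.1 1 rfl, F₉.1 1 rfl, F₈.1 1 rfl, F₇.1 1 rfl, r1]
  · rw [F''.1 2 rfl, F'.1 2 rfl, F₉.1 2 rfl, F₈.1 2 rfl, F₇.1 2 rfl, r2]
  · rw [F''.1 3 rfl, F'.1 3 rfl, v₉]
  · rw [F''.1 4 rfl, v']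
  · rw [F''.1 8 rfl, F'.1 8 rfl, F₉.1 8 rfl, F₈.1 8 rfl, F₇.1 8 rfl, v₆]
  · rw [F''.2 8 rfl, F'.2 8 rfl, F₉.2 8 rfl, F₈.2 8 rfl, v₇ c hc]
  · rw [F''.2 9 rfl, F'.2 9 rfl, F₉.2 9 rfl, v₈ c hc]

/-- The search, the dynamic program and the output. -/
def mainProg : Prog := seq searchProg (seq tableProg (seq bestProg writeProg))

/-! ### Running time -/

/-- `F n q` is of order `n ^ α * q ^ β`. -/
def IsOrder (α β : ℕ) (F : ℕ → ℕ → ℕ) : Prop :=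
  ∃ C, ∀ n q, 1 ≤ n → 1 ≤ q → F n q ≤ C * (n ^ α * q ^ β)

namespace IsOrder

variable {α β α' β' : ℕ} {F F' : ℕ → ℕ → ℕ}

lemma const (c : ℕ) : IsOrder α β fun _ _ => c := ⟨c, fun n q hn hq => by
  have : 1 ≤ n ^ α * q ^ β := Nat.mul_pos (Nat.pow_pos hn) (Nat.pow_pos hq)
  exact Nat.le_mul_of_pos_right _ this⟩

lemma add (h : IsOrder α β F) (h' : IsOrder α β F') : IsOrder α β fun n q => F n q + F' n q := by
  obtain ⟨C, hC⟩ := h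
  obtain ⟨C', hC'⟩ := h'
  exact ⟨C + C', fun n q hn hq => by
    rw [add_mul]
    exact Nat.add_le_add (hC n q hn hq) (hC' n q hn hq)⟩

lemma mul (h : IsOrder α β F) (h' : IsOrder α' β' F') :
    IsOrder (α + α') (β + β') fun n q => F n q * F' n q := by
  obtain ⟨C, hC⟩ := h
  obtain ⟨C', hC'⟩ := h'
  refine ⟨C * C', fun n q hn hq => (Nat.mul_le_mul (hC n q hn hq) (hC' n q hn hq)).trans_eq ?_⟩
  rw [pow_add, pow_add]
  ring

lemma pow (h : IsOrder α β F) (k : ℕ) : IsOrder (α * k) (β * k) fun n q => F n q ^ k := by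
  obtain ⟨C, hC⟩ := h
  refine ⟨C ^ k, fun n q hn hq => (Nat.pow_le_pow_left (hC n q hn hq) k).trans_eq ?_⟩
  rw [mul_pow, mul_pow, pow_mul, pow_mul]

lemma mono (h : IsOrder α β F) (hα : α ≤ α') (hβ : β ≤ β') : IsOrder α' β' F := by
  obtain ⟨C, hC⟩ := h
  exact ⟨C, fun n q hn hq => (hC n q hn hq).trans (Nat.mul_le_mul_left _
    (Nat.mul_le_mul (Nat.pow_le_pow_right hn hα) (Nat.pow_le_pow_right hq hβ)))⟩

lemma left : IsOrder 1 0 fun n _ => n := ⟨1, fun n q _ _ => by simp⟩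

lemma right : IsOrder 0 1 fun _ q => q := ⟨1, fun n q _ _ => by simp⟩

end IsOrder

/-- Bounds for the numbers of rounds of the loops with the bound registers `0, …, 7`. -/
def rounds (k n q : ℕ) : ℕ → ℕ
  | 0 => n
  | 1 => n + 1
  | 2 => k
  | 3 => (n + 1) ^ k
  | 4 => (k * q) ^ k
  | 5 => (n + 1) ^ k * (k * q) ^ k * (n + 1)
  | 6 => k + 1
  | 7 => k * n
  | _ => 0

/-- The running time of `P` is of order `n ^ α * q ^ β`. -/
def Prog.HasOrder (k α β : ℕ) (P : Prog) : Prop := IsOrder α β fun n q => P.cost (rounds k n q)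

namespace Prog.HasOrder

variable {k α β : ℕ}

lemma skip : Prog.skip.HasOrder k α β := IsOrder.const _

lemma assign {x : ℕ} {e : Expr} : (Prog.assign x e).HasOrder k α β := IsOrder.const _

lemma store {b : ℕ} {i e : Expr} : (Prog.store b i e).HasOrder k α β := IsOrder.const _

lemma seq {P₁ P₂ : Prog} (h₁ : P₁.HasOrder k α β) (h₂ : P₂.HasOrder k α β) :
    (Prog.seq P₁ P₂).HasOrder k α β := IsOrder.add h₁ h₂

lemma ite {e : Expr} {P₁ P₂ : Prog} (h₁ : P₁.HasOrder k α β) (h₂ : P₂.HasOrder k α β) :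
    (Prog.ite e P₁ P₂).HasOrder k α β := IsOrder.add (IsOrder.const _) (IsOrder.add h₁ h₂)

lemma loop {α' β' : ℕ} {x y : ℕ} {P : Prog} (hy : IsOrder α' β' fun n q => rounds k n q y)
    (h : P.HasOrder k α β) : (Prog.loop x y P).HasOrder k (α' + α) (β' + β) :=
  IsOrder.add (IsOrder.const _) (hy.mul (IsOrder.add h (IsOrder.const _)))

lemma mono {α' β' : ℕ} {P : Prog} (h : P.HasOrder k α β) (hα : α ≤ α') (hβ : β ≤ β') :
    P.HasOrder k α' β' := IsOrder.mono h hα hβ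

end Prog.HasOrder

lemma isOrder_rounds (k : ℕ) :
    (IsOrder 1 0 fun n q => rounds k n q 0) ∧ (IsOrder 1 0 fun n q => rounds k n q 1) ∧
    (IsOrder 0 0 fun n q => rounds k n q 2) ∧ (IsOrder k 0 fun n q => rounds k n q 3) ∧
    (IsOrder 0 k fun n q => rounds k n q 4) ∧ (IsOrder (k + 1) k fun n q => rounds k n q 5) ∧
    (IsOrder 0 0 fun n q => rounds k n q 6) ∧ (IsOrder 1 0 fun n q => rounds k n q 7) := by
  have h1 : IsOrder 1 0 fun n _ => n + 1 := IsOrder.left.add (IsOrder.const 1)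
  have h3 : IsOrder k 0 fun n _ => (n + 1) ^ k := by simpa using h1.pow k
  have h4 : IsOrder 0 k fun _ q => (k * q) ^ k := by
    simpa using ((IsOrder.const (α := 0) (β := 0) k).mul IsOrder.right).pow k
  have h5 : IsOrder (k + 1) k fun n q => (n + 1) ^ k * (k * q) ^ k * (n + 1) := by
    simpa using (h3.mul h4).mul h1
  have h7 : IsOrder 1 0 fun n _ => k * n := by
    simpa using (IsOrder.const (α := 0) (β := 0) k).mul IsOrder.left
  exact ⟨IsOrder.left, h1, IsOrder.const _, h3, h4, h5, IsOrder.const _, h7⟩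

/-- The merge dominates: `n` positions, `(n + 1) ^ k` tuples, the square of at most `(k * q) ^ k`
codes, and `n + 1` cells to copy, with `q` standing for `Q + 1`. -/
theorem solver_order {k : ℕ} (hk : 1 ≤ k) : (seq (setupProg k) mainProg).HasOrder k (k + 2) (2 * k) := by
  obtain ⟨r0, r1, r2, r3, r4, r5, r6, r7⟩ := isOrder_rounds k
  have hc : countProg.HasOrder k 1 0 := .loop (α := 0) (β := 0) r0 (.ite .assign .skip)
  have hs : selectProg.HasOrder k 2 0 := .loop (α := 1) (β := 0) r0 (.ite .skip (.seq .assign (.seq hc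
    (.ite (.seq .assign .assign) .skip))))
  have hsearch : searchProg.HasOrder k 3 0 := .loop (α := 2) (β := 0) r0 (.seq .assign (.seq .assign (.seq hs
    (.seq .store .store))))
  have hpar : parentProg.HasOrder k 1 0 := .seq .assign (.loop (α := 0) (β := 0) r1 (.ite .assign .skip))
  have hcopy : copyProg.HasOrder k (k + 1 + 0) (k + 0) := .loop r5 .store
  have hee : extendEntry.HasOrder k (1 + 0) (0 + 0) := .ite (.seq (.loop r1 .store) .store) .skip
  have hec : extendColor.HasOrder k (0 + (1 + 0)) (k + (0 + 0)) :=
    .seq .assign (.ite (.ite .skip (.loop r4 hee)) .skip)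
  have hex : extendProg.HasOrder k (k + (0 + (0 + (1 + 0)))) (0 + (0 + (k + (0 + 0)))) :=
    .loop r3 (.loop r2 hec)
  have hme : mergeEntry.HasOrder k (1 + 0) (0 + 0) := .ite (.loop r1 (.ite .store .store)) .skip
  have hmerge : mergeProg.HasOrder k (k + (0 + (0 + (1 + 0)))) (0 + (k + (k + (0 + 0)))) :=
    .loop r3 (.loop r4 (.loop r4 hme))
  have hpos : positionProg.HasOrder k (k + 1) (2 * k) :=
    .seq .assign <| .seq (hpar.mono (by omega) (by omega)) <| .seq .assign <|
    .seq (hcopy.mono (by omega) (by omega)) <| .seq (hex.mono (by omega) (by omega)) <|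
    .seq .assign <| .seq (hmerge.mono (by omega) (by omega)) .store
  have hinit : initProg.HasOrder k (k + 0) (0 + 0) := .loop r3 .store
  have htable : tableProg.HasOrder k (k + 2) (2 * k) :=
    .seq (hinit.mono (by omega) (by omega)) ((HasOrder.loop r0 hpos).mono (by omega) (by omega))
  have hmin : minProg.HasOrder k (0 + 0) (0 + 0) := .seq .assign (.loop r2 (.ite .assign .skip))
  have hbest : bestProg.HasOrder k (0 + (0 + 0)) (k + (0 + 0)) :=
    .seq .assign (.seq .assign (.seq .assign (.loop r4 (.ite (.seq hmin
      (.ite (.seq .assign .assign) .skip)) .skip))))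
  have hwrite : writeProg.HasOrder k (1 + (0 + 0)) (0 + (0 + 0)) := .loop r0 (.loop r2 .store)
  have hsum : sumProg.HasOrder k (1 + 0) (0 + 0) := .loop r7 .assign
  have hp : ∀ m y, (powProg m y).HasOrder k (0 + 0) (0 + 0) := fun m y =>
    .seq .assign (.loop r6 (.seq .store .assign))
  have hsetup : (setupProg k).HasOrder k (k + 2) (2 * k) :=
    .seq .assign <| .seq .assign <| .seq .assign <| .seq .assign <|
    .seq (hsum.mono (by omega) (by omega)) <| .seq .assign <|
    .seq ((hp _ _).mono (by omega) (by omega)) <| .seq ((hp _ _).mono (by omega) (by omega)) <|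
    .seq .assign <| .seq .assign .assign
  -- The search takes cubic time, which `n ^ (k + 2)` covers because `1 ≤ k`.
  exact .seq hsetup (.seq (hsearch.mono (by omega) (by omega)) (.seq htable
    (.seq (hbest.mono (by omega) (by omega)) (hwrite.mono (by omega) (by omega)))))

/-! ### The layout found by the search -/

/-- The layout of a graph with adjacency matrix `adj` and profit table `prof` along the ordering
`ord` of the vertices. -/
def searchLayout (n k T : ℕ) (adj prof ord : ℕ → ℕ) : Layout where
  n := n
  k := k
  base := T + 1
  R u v := (1 ≤ u ∧ u ≤ n) ∧ (1 ≤ v ∧ v ≤ n) ∧ adj (ord v * n + ord u) ≠ 0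
  p c u := prof (c * n + ord u)

/-- An injective list of `n` out of `n` vertices is a bijection, and `pos` is its inverse. -/
lemma IsSearchOrder.exists_pos {n : ℕ} {adj ord : ℕ → ℕ} (ho : IsSearchOrder n adj n ord) :
    ∃ pos : Fin n → ℕ, Function.Injective pos ∧ (∀ v, 1 ≤ pos v ∧ pos v ≤ n ∧ ord (pos v) = v) ∧
      ∀ u, 1 ≤ u → u ≤ n → ∃ v, pos v = u ∧ ord u = v := by
  let e : Fin n → Fin n := fun i => ⟨ord (i + 1), ho.lt _ (by omega) (by omega)⟩
  have he : Function.Injective e := fun i j hij => by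
    have := ho.inj (i + 1) (j + 1) (by omega) (by omega) (by omega) (by omega) (Fin.ext_iff.1 hij)
    ext
    omega
  have hs : Function.Surjective e := Finite.surjective_of_injective he
  choose t ht using hs
  have htv : ∀ v, ord (t v + 1) = v := fun v => Fin.ext_iff.1 (ht v)
  refine ⟨fun v => t v + 1, fun v w hvw => ?_, fun v => ⟨Nat.succ_pos _, (t v).isLt, htv v⟩,
    fun u hu hun => ?_⟩
  · have h1 := htv v
    have h2 := htv w
    dsimp only at hvw
    rw [hvw, h2] at h1
    exact Fin.ext h1.symm
  · refine ⟨⟨ord u, ho.lt u hu hun⟩, ?_, rfl⟩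
    exact ho.inj _ _ (Nat.succ_pos _) (t _).isLt hu hun (htv _)

/-! ### From the search order to a valid layout, and from a table to an optimal coloring. -/

section

variable {n k T : ℕ} {adj prof ord : ℕ → ℕ} {G : SimpleGraph (Fin n)} {p : Fin k → Fin n → ℕ}

/-- Maximum cardinality search meets the hypothesis of `IsChordal.isClique_earlier`: if all visited
neighbours of `b` were neighbours of `c`, and `a` a further visited neighbour of `c`, then `c` would
have had a larger score than `b` when `b` was chosen. -/
lemma searchLayout_valid (hG : IsChordal G) (hadj : ∀ a b : Fin n, adj (a * n + b) ≠ 0 ↔ G.Adj a b)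
    (ho : IsSearchOrder n adj n ord)
    (hT : ∀ c < k, ∑ v ∈ Finset.range n, prof (c * n + v) ≤ T) :
    (searchLayout n k T adj prof ord).Valid := by
  classical
  obtain ⟨pos, hinj, hpos, hsur⟩ := ho.exists_pos
  have hR : ∀ a b : Fin n, (searchLayout n k T adj prof ord).R (pos a) (pos b) ↔ G.Adj a b := by
    intro a b
    simp only [searchLayout, (hpos a).2.2, (hpos b).2.2, (hpos a).1, (hpos a).2.1, (hpos b).1,
      (hpos b).2.1, true_and, hadj, and_self]
    exact G.adj_comm b a
  have hex : ∀ {u v}, (searchLayout n k T adj prof ord).R u v → ∃ a b, pos a = u ∧ pos b = v ∧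
      G.Adj a b := by
    intro u v h
    obtain ⟨a, ha, -⟩ := hsur u h.1.1 h.1.2
    obtain ⟨b, hb, -⟩ := hsur v h.2.1.1 h.2.1.2
    refine ⟨a, b, ha, hb, ?_⟩
    rwa [← hR, ha, hb]
  refine ⟨fun {u v} h => ?_, fun u h => ?_, fun h => h.1, fun {x y w} hne hx hy h1 h2 => ?_,
    fun c hc => ?_⟩
  · obtain ⟨a, b, rfl, rfl, hab⟩ := hex h
    exact (hR b a).2 hab.symm
  · obtain ⟨a, b, rfl, hb, hab⟩ := hex h
    exact hab.ne (hinj hb.symm)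
  · obtain ⟨a, c, rfl, rfl, hac⟩ := hex h1
    obtain ⟨b, c', rfl, hc', hbc⟩ := hex h2
    obtain rfl := hinj hc'
    refine (hR a b).2 (hG.isClique_earlier hinj ?_ (fun h => hne (congrArg pos h)) hx hy hac hbc)
    intro a b c hab hbc hac hnab
    by_contra! hall
    have hg := ho.greedy (pos b) (hpos b).1 (hpos b).2.1 c c.isLt (fun a' h1 h2 h3 => by
      obtain ⟨d, rfl, hd⟩ := hsur a' h1 (by have := (hpos b).2.1; omega)
      rw [hd] at h3
      rw [Fin.ext h3] at h2
      omega)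
    rw [(hpos b).2.2] at hg
    refine absurd hg (not_le.2 (Finset.card_lt_card ?_))
    rw [Finset.ssubset_iff_of_subset]
    · refine ⟨a, ?_, ?_⟩
      · simp only [Finset.mem_filter, Finset.mem_range, a.isLt, true_and, hadj]
        exact ⟨⟨pos a, (hpos a).1, hab, (hpos a).2.2⟩, hac.symm⟩
      · simp only [Finset.mem_filter, hadj, not_and]
        exact fun _ _ h => hnab h.symm
    · intro u hu
      simp only [Finset.mem_filter, Finset.mem_range] at hu ⊢
      obtain ⟨hun, ⟨a', h1, h2, rfl⟩, hub⟩ := hu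
      obtain ⟨d, rfl, hd⟩ := hsur a' h1 (by have := (hpos b).2.1; omega)
      refine ⟨hun, ⟨pos d, h1, h2, rfl⟩, ?_⟩
      rw [hd, hadj] at hub ⊢
      exact (hall d h2 hub.symm).symm
  · refine Nat.lt_succ_of_le (le_trans ?_ (hT c hc))
    have hi : Set.InjOn ord (Finset.Icc 1 n : Finset ℕ) := fun u hu v hv h =>
      ho.inj u v (Finset.mem_Icc.1 hu).1 (Finset.mem_Icc.1 hu).2 (Finset.mem_Icc.1 hv).1
        (Finset.mem_Icc.1 hv).2 h
    change ∑ u ∈ Finset.Icc 1 n, prof (c * n + ord u) ≤ _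
    rw [← Finset.sum_image (f := fun v => prof (c * n + v)) hi]
    refine Finset.sum_le_sum_of_subset fun v hv => ?_
    obtain ⟨u, hu, rfl⟩ := Finset.mem_image.1 hv
    exact Finset.mem_range.2 (ho.lt u (Finset.mem_Icc.1 hu).1 (Finset.mem_Icc.1 hu).2)

/-- A best attainable profit code yields an optimal partial coloring. -/
lemma isOptimal_of_table (hadj : ∀ a b : Fin n, adj (a * n + b) ≠ 0 ↔ G.Adj a b)
    (hprof : ∀ (c : Fin k) (v : Fin n), prof (c * n + v) = p c v) (ho : IsSearchOrder n adj n ord)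
    (hL : (searchLayout n k T adj prof ord).Valid) {D : Set ℕ} {tab : ℕ → ℕ → ℕ → ℕ}
    (hD : ∀ u ∈ Finset.Icc 1 n, u ∈ D) (ht : (searchLayout n k T adj prof ord).IsTable tab D 0)
    {a : ℕ} (ha : a < (T + 1) ^ k) (hfl : tab 0 a 0 ≠ 0)
    (hbest : ∀ a' < (T + 1) ^ k, tab 0 a' 0 ≠ 0 → (searchLayout n k T adj prof ord).level a' ≤
      (searchLayout n k T adj prof ord).level a) {X : Fin k → Finset (Fin n)}
    (hX : ∀ j : Fin k, ∀ u < n, ∀ v : Fin n, ord (u + 1) = v → (v ∈ X j ↔ tab 0 a (u + 1) = j + 1)) :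
    IsOptimal G p X := by
  classical
  obtain ⟨pos, hinj, hpos, hsur⟩ := ho.exists_pos
  have hR : ∀ a b : Fin n, (searchLayout n k T adj prof ord).R (pos a) (pos b) ↔ G.Adj a b := by
    intro a b
    simp only [searchLayout, (hpos a).2.2, (hpos b).2.2, (hpos a).1, (hpos a).2.1, (hpos b).1,
      (hpos b).2.1, true_and, hadj, and_self]
    exact G.adj_comm b a
  have hX' : ∀ j v, v ∈ X j ↔ tab 0 a (pos v) = j + 1 := by
    intro j v
    have h1 := hpos v
    have := hX j (pos v - 1) (by omega) v (by rw [Nat.sub_add_cancel h1.1]; exact h1.2.2)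
    rwa [Nat.sub_add_cancel h1.1] at this
  have hsat : ∀ (col : ℕ → ℕ) (Y : Fin k → Finset (Fin n)), (∀ u ∈ Finset.Icc 1 n, col u ≤ k) →
      (∀ j v, v ∈ Y j ↔ col (pos v) = j + 1) →
      (searchLayout n k T adj prof ord).level ((searchLayout n k T adj prof ord).weight col) =
        satisfaction p Y := by
    intro col Y hle hY
    rw [Layout.level, satisfaction]
    congr 1
    funext j
    rw [Layout.dig_weight hL hle j.isLt]
    symm
    refine Finset.sum_bij (fun v _ => pos v) (fun v hv => ?_) (fun v _ w _ h => hinj h)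
      (fun u hu => ?_) (fun v hv => ?_)
    · exact Finset.mem_filter.2 ⟨Finset.mem_Icc.2 ⟨(hpos v).1, (hpos v).2.1⟩, (hY j v).1 hv⟩
    · obtain ⟨h1, h2⟩ := Finset.mem_filter.1 hu
      obtain ⟨v, rfl, -⟩ := hsur u (Finset.mem_Icc.1 h1).1 (Finset.mem_Icc.1 h1).2
      exact ⟨v, (hY j v).2 h2, rfl⟩
    · change p j v = prof (j * n + ord (pos v))
      rw [(hpos v).2.2]
      exact (hprof j v).symm
  obtain ⟨hg, hw⟩ := ht.sound 0 (Nat.pow_pos (Nat.succ_pos _)) a ha hfl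
  refine ⟨⟨fun i j hij => ?_, fun j v hv w hw _ hvw => ?_⟩, fun Y hY => ?_⟩
  · rw [Finset.disjoint_left]
    intro v hi hj
    rw [hX'] at hi hj
    exact hij (Fin.ext (by omega))
  · rw [Finset.mem_coe, hX'] at hv hw
    exact hg.proper _ _ ((hR v w).2 hvw) (by omega) (by omega)
  -- The competitor `Y` becomes a coloring of the positions. The chosen color is the only possible
  -- one, as the sets are disjoint.
  · set col : ℕ → ℕ := fun u => if h : ∃ (j : Fin k) (v : Fin n), pos v = u ∧ v ∈ Y j then
      h.choose.val + 1 else 0 with hcol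
    have hcolY : ∀ j v, v ∈ Y j ↔ col (pos v) = j + 1 := by
      intro j v
      constructor
      · intro hv
        have h : ∃ (j : Fin k) (v' : Fin n), pos v' = pos v ∧ v' ∈ Y j := ⟨j, v, rfl, hv⟩
        simp only [hcol, dif_pos h]
        obtain ⟨v', h1, h2⟩ := h.choose_spec
        rw [hinj h1] at h2
        by_contra hne
        exact Finset.disjoint_left.1 (hY.1 h.choose j fun e => hne (by rw [e])) h2 hv
      · intro h
        simp only [hcol] at h
        split_ifs at h with hex
        obtain ⟨v', h1, h2⟩ := hex.choose_spec
        rw [hinj h1] at h2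
        rwa [show j = hex.choose from Fin.ext (by omega)]
    have hle : ∀ u ∈ Finset.Icc 1 n, col u ≤ k := by
      intro u _
      simp only [hcol]
      split_ifs with h
      · exact h.choose.isLt
      · omega
    have hgood : (searchLayout n k T adj prof ord).Good D 0 col := by
      refine ⟨hle, fun u hu _ => hD u hu, fun u v huv hu he => ?_, fun c hc u hu _ hr => ?_⟩
      · obtain ⟨x, rfl, -⟩ := hsur u huv.1.1 huv.1.2
        obtain ⟨y, rfl, -⟩ := hsur v huv.2.1.1 huv.2.1.2
        have hb := hle _ (Finset.mem_Icc.2 huv.1)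
        have h1 := (hcolY ⟨col (pos x) - 1, by omega⟩ x).2 (by dsimp only; omega)
        have h2 := (hcolY ⟨col (pos x) - 1, by omega⟩ y).2 (by dsimp only; omega)
        have hxy := (hR x y).1 huv
        exact hY.2 _ h1 h2 hxy.ne hxy
      -- All digits of the tuple `0` are `0`, which is adjacent to nothing, so this tuple imposes no
      -- restriction.
      · have := (hL.range hr).1
        simp [dig] at this
    have hflag := ht.complete 0 (Nat.pow_pos (Nat.succ_pos _)) (by simp [dig]) col hgood
    rw [← hsat _ Y hle hcolY, ← hsat _ X hg.le hX', hw]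
    exact hbest _ (Layout.weight_lt hL hle) hflag

end

/-! ### The input -/

section

variable {n k : ℕ} (G : SimpleGraph (Fin n)) (p : Fin k → Fin n → ℕ)

lemma inputState_adj (a b : Fin n) : (inputState G p).mem 0 (a * n + b) ≠ 0 ↔ G.Adj a b := by
  have : (∃ u v : Fin n, a.val * n + b.val = u.val * n + v.val ∧ G.Adj u v) ↔ G.Adj a b := by
    constructor
    · rintro ⟨u, v, h, huv⟩
      obtain ⟨h1, h2⟩ := mul_add_inj b.isLt v.isLt h
      rwa [Fin.ext h1, Fin.ext h2]
    · exact fun h => ⟨a, b, rfl, h⟩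
  simp [inputState, this]

lemma inputState_profit (c : Fin k) (v : Fin n) : (inputState G p).mem 1 (c * n + v) = p c v := by
  have h1 : (c.val * n + v.val) / n = c := by
    rw [mul_comm, Nat.mul_add_div (by have := v.isLt; omega), Nat.div_eq_of_lt v.isLt, add_zero]
  have h2 : (c.val * n + v.val) % n = v := by
    rw [Nat.mul_add_mod', Nat.mod_eq_of_lt v.isLt]
  simp [inputState, h1, h2]

lemma sum_profit_le (c : Fin k) : ∑ v, p c v ≤ maxProfit p :=
  Finset.le_sup (f := fun j => ∑ v, p j v) (Finset.mem_univ c)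

lemma inputState_bounded : (inputState G p).Bounded (n + maxProfit p + 1) := by
  refine ⟨fun x => ?_, fun b i => ?_⟩
  · simp only [inputState]
    split_ifs <;> omega
  · simp only [inputState]
    split_ifs with h1 h2 h3 h4
    · omega
    · omega
    · have := (Finset.single_le_sum (f := fun v => p ⟨i / n, h4.1⟩ v) (fun _ _ => Nat.zero_le _)
        (Finset.mem_univ ⟨i % n, h4.2⟩)).trans (sum_profit_le p ⟨i / n, h4.1⟩)
      omega
    · omega
    · omega

end

lemma sum_range_mul (f : ℕ → ℕ) (k n : ℕ) : ∑ i ∈ Finset.range (k * n), f i =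
    ∑ c ∈ Finset.range k, ∑ v ∈ Finset.range n, f (c * n + v) := by
  induction k with
  | zero => simp
  | succ k ih => rw [Nat.succ_mul, Finset.sum_range_add, ih, Finset.sum_range_succ]

/-! ### Correctness and running time -/

/-- The layout can be named only after the search, since it depends on the order that the search
leaves in bank `3`. -/
lemma main_spec {n k T : ℕ} (hk : 1 ≤ k) {G : SimpleGraph (Fin n)}
    {p : Fin k → Fin n → ℕ} (hG : IsChordal G) {s : State}
    (hadj : ∀ a b : Fin n, s.mem 0 (a * n + b) ≠ 0 ↔ G.Adj a b)
    (hprof : ∀ (c : Fin k) (v : Fin n), s.mem 1 (c * n + v) = p c v)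
    (hT : ∀ c < k, ∑ v ∈ Finset.range n, s.mem 1 (c * n + v) ≤ T)
    (h0 : s.reg 0 = n) (h1 : s.reg 1 = n + 1) (h2 : s.reg 2 = k) (h3 : s.reg 3 = (n + 1) ^ k)
    (h4 : s.reg 4 = (T + 1) ^ k) (h5 : s.reg 5 = (n + 1) ^ k * (T + 1) ^ k * (n + 1))
    (h8 : s.reg 8 = T + 1) (m8 : ∀ c ≤ k, s.mem 8 c = (n + 1) ^ c)
    (m9 : ∀ c ≤ k, s.mem 9 c = (T + 1) ^ c) (m4 : ∀ v, s.mem 4 v = 0) (m5 : ∀ v, s.mem 5 v = 0)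
    (m7 : ∀ v, s.mem 7 v = 0) : IsOptimal G p (outputSets n k (mainProg.run s)) := by
  have ho := search_spec h0 h1 m4
  have F₁ := frame_run searchProg s
  simp only [mainProg, run_seq]
  set s₁ := searchProg.run s
  set L := searchLayout n k T (s.mem 0) (s.mem 1) (s₁.mem 3) with hLdef
  have hL : L.Valid := searchLayout_valid hG hadj ho hT
  have E₁ : L.Env s₁ := by
    refine ⟨?_, ?_, ?_, ?_, ?_, ?_, ?_, fun x hx w hw => ?_, fun c _ u _ => ?_, fun c hc => ?_,
      fun c hc => ?_⟩
    · rw [F₁.1 0 rfl, h0]; rfl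
    · rw [F₁.1 1 rfl, h1]; rfl
    · rw [F₁.1 2 rfl, h2]; rfl
    · rw [F₁.1 3 rfl, h3]; rfl
    · rw [F₁.1 4 rfl, h4]; rfl
    · rw [F₁.1 5 rfl, h5]; rfl
    · rw [F₁.1 8 rfl, h8]; rfl
    · rw [F₁.2 0 rfl]
      exact ⟨fun h => ⟨Finset.mem_Icc.1 hx, Finset.mem_Icc.1 hw, h⟩, fun h => h.2.2⟩
    · rw [F₁.2 1 rfl]; rfl
    · rw [F₁.2 8 rfl]; exact m8 c hc
    · rw [F₁.2 9 rfl]; exact m9 c hc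
  obtain ⟨D, hD, ht⟩ := Layout.table_spec hL E₁ (fun x => by rw [F₁.2 5 rfl, m5])
    (fun x => by rw [F₁.2 7 rfl, m7])
  have F₂ := frame_run tableProg s₁
  set s₂ := tableProg.run s₁
  have E₂ := E₁.of_frame F₂
  obtain ⟨b1, b2, b3, b4⟩ := Layout.best_spec hL E₂ hk rfl ht
  have F₃ := frame_run bestProg s₂
  set s₃ := bestProg.run s₂
  have E₃ := E₂.of_frame F₃
  have e3 : s₃.mem 3 = s₁.mem 3 := by rw [F₃.2 3 rfl, F₂.2 3 rfl]
  have hw : ∀ {u c : ℕ}, u < n → c < k → _ := fun hu hc => Layout.write_spec E₃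
    (by rw [e3]; exact ho.lt) (by rw [e3]; exact ho.inj) hu hc
  rw [e3, F₃.2 7 rfl, b1] at hw
  refine isOptimal_of_table hadj hprof ho hL hD ht b2 b3 b4 fun j u hu v hv => ?_
  have := hw hu j.isLt
  rw [hv] at this
  simp only [outputSets, Finset.mem_filter, Finset.mem_univ, true_and]
  rw [show j.val * n = j.val * L.n from rfl, this]
  split_ifs with h <;> simp [h]

end FairDivision

theorem theorem6 (k : ℕ) (hk : 1 ≤ k) :
    ∃ (P : FairDivision.Program) (C c : ℕ),
      ∀ (n : ℕ) (_ : 1 ≤ n) (G : SimpleGraph (Fin n)) (p : Fin k → Fin n → ℕ),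
        FairDivision.IsChordal G →
        ∃ (t : ℕ) (s : FairDivision.State),
          FairDivision.Runs ((n + FairDivision.maxProfit p + 1) ^ c) P
            (FairDivision.inputState G p) t s ∧
          t ≤ C * (n ^ (k + 2) * (FairDivision.maxProfit p + 1) ^ (2 * k)) ∧
          FairDivision.IsOptimal G p (FairDivision.outputSets n k s) := by
  obtain ⟨C, hC⟩ := FairDivision.solver_order hk
  set P : FairDivision.Prog := .seq (FairDivision.setupProg k) FairDivision.mainProg with hP
  -- The largest exponent needed for the stored values is `(k + 2) * (k + 1)`, from the bound `b ^
  -- (k + 2)` for `T + 1` raised to the power `k + 1`.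
  set D := (k + 3) ^ 2 with hD
  refine ⟨P.compile, C, P.deg D, fun n hn G p hG => ?_⟩
  set Q := FairDivision.maxProfit p with hQ
  set b := n + Q + 1 with hb_def
  set s := FairDivision.inputState G p with hs
  have hb : 2 ≤ b := by omega
  obtain ⟨T, hT⟩ : ∃ T, T = ∑ i ∈ Finset.range (k * n), s.mem 1 i := ⟨_, rfl⟩
  have hrow : ∀ c : Fin k, ∑ v ∈ Finset.range n, s.mem 1 (c * n + v) = ∑ v, p c v := fun c => by
    rw [Finset.sum_range]
    exact Finset.sum_congr rfl fun v _ => FairDivision.inputState_profit G p c v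
  have hTsum : T = ∑ c ∈ Finset.range k, ∑ v ∈ Finset.range n, s.mem 1 (c * n + v) := by
    rw [hT, FairDivision.sum_range_mul]
  have hTc : ∀ c < k, ∑ v ∈ Finset.range n, s.mem 1 (c * n + v) ≤ T := fun c hc => by
    rw [hTsum]
    exact Finset.single_le_sum (f := fun c => ∑ v ∈ Finset.range n, s.mem 1 (c * n + v))
      (fun _ _ => Nat.zero_le _) (Finset.mem_range.2 hc)
  have hTQ : T ≤ k * Q := by
    rw [hTsum]
    refine (Finset.sum_le_card_nsmul _ _ Q fun c hc => ?_).trans_eq (by simp)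
    exact (hrow ⟨c, Finset.mem_range.1 hc⟩).trans_le (FairDivision.sum_profit_le p _)
  have hTq : T + 1 ≤ k * (Q + 1) := by rw [Nat.mul_succ]; omega
  -- all values are polynomially bounded
  have hpow : ∀ {i j : ℕ}, i ≤ j → b ^ i ≤ b ^ j := fun h => Nat.pow_le_pow_right (by omega) h
  have hkb : k + 1 ≤ b ^ (k + 1) := (Nat.lt_pow_self hb).le
  have hTb : T + 1 ≤ b ^ (k + 2) := by
    calc T + 1 ≤ (k + 1) * b := hTq.trans (Nat.mul_le_mul (by omega) (by omega))
      _ ≤ b ^ (k + 1) * b := Nat.mul_le_mul_right _ hkb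
      _ = b ^ (k + 2) := (pow_succ _ _).symm
  have hNb : ∀ j, (n + 1) ^ j ≤ b ^ j := fun j => Nat.pow_le_pow_left (by omega) j
  have hTj : ∀ j, (T + 1) ^ j ≤ b ^ ((k + 2) * j) := fun j => by
    rw [pow_mul]; exact Nat.pow_le_pow_left hTb j
  have hbd : s.Bounded (b ^ D) := by
    have hi := FairDivision.inputState_bounded G p
    have h1 : b ≤ b ^ D := by
      calc b = b ^ 1 := (pow_one b).symm
        _ ≤ b ^ D := hpow (by rw [hD]; nlinarith)
    exact ⟨fun x => (hi.1 x).trans h1, fun m i => (hi.2 m i).trans h1⟩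
  obtain ⟨hsetup, hres⟩ := FairDivision.setup_spec (env := FairDivision.rounds k n (Q + 1)) hb hbd
    (n := n) (k := k) (by simp [hs, FairDivision.inputState]) (by simp [hs, FairDivision.inputState])
    hT le_rfl le_rfl (hkb.trans (hpow (by rw [hD]; nlinarith)))
    (by
      calc k * n ≤ b ^ (k + 1) * b := Nat.mul_le_mul (by omega) (by omega)
        _ = b ^ (k + 2) := (pow_succ _ _).symm
        _ ≤ b ^ D := hpow (by rw [hD]; nlinarith))
    ((hNb _).trans (hpow (by rw [hD]; nlinarith)))
    ((hTj _).trans (hpow (by rw [hD]; nlinarith)))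
    (by
      calc (n + 1) ^ k * (T + 1) ^ k * (n + 1) ≤ b ^ k * b ^ ((k + 2) * k) * b :=
            Nat.mul_le_mul (Nat.mul_le_mul (hNb k) (hTj k)) (by omega)
        _ = b ^ (k + (k + 2) * k + 1) := by rw [pow_succ, pow_add]
        _ ≤ b ^ D := hpow (by rw [hD]; nlinarith))
  obtain ⟨r1, r2, r3, r4, r5, r8, m8, m9⟩ := hres _ rfl
  have hF := FairDivision.Prog.frame_run (FairDivision.setupProg k) s
  have hsafe₁ := hsetup (b ^ P.deg D) (hpow (Nat.le_add_right _ _))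
  set s₁ := (FairDivision.setupProg k).run s
  have r0 : s₁.reg 0 = n := by rw [hF.1 0 rfl]; simp [hs, FairDivision.inputState]
  have hM : (T + 1) ^ k ≤ (k * (Q + 1)) ^ k := Nat.pow_le_pow_left hTq k
  -- After the setup no stored value grows any more, and all loops are bounded by the registers `0,
  -- …, 5`.
  have hsafe₂ := FairDivision.Prog.safe_of_tame (Y := [0, 1, 2, 3, 4, 5]) (D := D)
    (B := b ^ P.deg D) (env := FairDivision.rounds k n (Q + 1)) hb FairDivision.mainProg s₁ (by decide)
    (hpow (Nat.le_add_left _ _)) hsafe₁.2 (by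
      simp only [List.mem_cons, List.not_mem_nil, or_false, forall_eq_or_imp, forall_eq]
      exact ⟨r0.le, r1.le, r2.le, r3.le, r4.le.trans hM,
        r5.le.trans (Nat.mul_le_mul_right _ (Nat.mul_le_mul_left _ hM))⟩)
  obtain ⟨t, ht, hrun⟩ := FairDivision.Prog.runs_of_safe P s ⟨hsafe₁.1, hsafe₂.1⟩
  refine ⟨t, _, hrun, ht.trans (hC n (Q + 1) hn (Nat.succ_pos _)), ?_⟩
  have hzero : ∀ m, 2 ≤ m → ∀ v, s.mem m v = 0 := fun m hm v => by
    simp [hs, FairDivision.inputState, show m ≠ 0 by omega, show m ≠ 1 by omega]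
  refine FairDivision.main_spec (T := T) hk hG (s := s₁) ?_ ?_ ?_ r0 r1 r2 r3 r4 r5 r8 m8 m9 ?_ ?_ ?_
  · rw [hF.2 0 rfl]; exact FairDivision.inputState_adj G p
  · rw [hF.2 1 rfl]; exact FairDivision.inputState_profit G p
  · rw [hF.2 1 rfl]; exact hTc
  · rw [hF.2 4 rfl]; exact hzero 4 (by omega)
  · rw [hF.2 5 rfl]; exact hzero 5 (by omega)
  · rw [hF.2 7 rfl]; exact hzero 7 (by omega)
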